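/- For a nonzero finite Borel measure $\sigma$ on $\mathbb R$ let $F_\sigma(z)=\left(\int_{\mathbb R}\frac{d\sigma(t)}{z-t}\right)^{-1}$, $z\in\mathbb C^+=\{\Im z>0\}$. For a probability measure $\sigma$ and $n\ge 1$ let $\sigma^{\triangleright n}$ ($n$-th monotone convolution power) be the unique probability measure with $F_{\sigma^{\triangleright n}}=F_\sigma^{\circ n}$ on $\mathbb C^+$. Write $m_k(\sigma)=\int t^k\,d\sigma(t)$, $m(\sigma)=m_1(\sigma)$, and let $\gamma$ be the arcsine law $d\gamma(t)=\frac{dt}{\pi\sqrt{2-t^2}}$ on $(-\sqrt2,\sqrt2)$. For probability measures $\alpha,\beta$ on $\mathbb R$ put $\|C_\alpha-C_\beta\|_\infty=\sup_{x\in\mathbb R}|\alpha((-\infty,x])-\beta((-\infty,x])|$. **Theorem.** Let $\mu$ be a probability measure on $\mathbb R$ with mean $0$ and variance $1$, and let $\mu_n(A)=\mu^{\triangleright n}(\sqrt n\,A)$ for Borel sets $A$. There is a finite Borel measure $\nu$ on $\mathbb R$ with $$F_\mu(z)=z+\int_{\mathbb R}\frac{1}{t-z}\,d\nu(t),\qquad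 z\in\mathbb C^+ .$$ For any such $\nu$ (it is unique, and a probability measure) put $c=\int_{\mathbb R}|t|\,d\nu(t)\in[0,+\infty]$. 1. If $0<c<+\infty$, then $$\|C_{\mu_n}-C_\gamma\|_\infty\le \frac{71\,c^{1/4}}{n^{1/8}}\qquad\text{for all } n>\max\left\{(8\sqrt{3c})^4,\,(8c\sqrt c)^{-4}\right\}.$$ If $m_4(\mu)<+\infty$, then $c<+\infty$; so this estimate holds in particular when $m_4(\mu)<+\infty$ and $c>0$. 2. Suppose $0<c<+\infty$ and that there is a finite Borel measure $\rho$ on $\mathbb R$ with $$F_\nu(z)=z-m(\nu)+\int_{\mathbb R}\frac{1}{t-z}\,d\rho(t),\quad z\in\mathbb C^+,\qquad d=\int_{\mathbb R}|t|\,d\rho(t)<+\infty .$$ Then $m_2(\nu)<+\infty$ and, with $D=d+3(1+m_2(\nu))^2$, $$\|C_{\mu_n}-C_\gamma\|_\infty\le\frac{200\sqrt{D}}{n^{1/4}}\qquad\text{for all } n>\max\left\{4m(\nu)^2,\,4m_2(\nu)^2,\,12288\,D^2\right\}.$$ If $m_6(\mu)<+\infty$, then $c<+\infty$ and such a $\rho$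 with $d<+\infty$ exists; so this estimate holds in particular when $m_6(\mu)<+\infty$ and $c>0$. 3. One has $c=0$ if and only if $\mu=\frac12(\delta_{-1}+\delta_1)$, and in this case $$\|C_{\mu_n}-C_\gamma\|_\infty\le\frac{200}{n^{1/4}}\qquad\text{for all } n>12288 .$$ -/

import Mathlib

open MeasureTheory
open scoped ENNReal

namespace MonotoneCLT

/-- The `F`-transform of a measure `μ` on `ℝ`: `F_μ(z) = 1 / ∫ 1 / (z - t) dμ(t)`.
It is only used at points of the upper half-plane. -/
noncomputable def fTransform (μ : Measure ℝ) (z : ℂ) : ℂ :=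
  1 / ∫ t : ℝ, 1 / (z - (t : ℂ)) ∂μ

/-- `m` is an `n`-th monotone convolution power of `μ`: a probability measure on `ℝ` whose
`F`-transform on the upper half-plane is the `n`-fold iterate of the `F`-transform of `μ`. -/
def IsMonotonePower (μ : Measure ℝ) (n : ℕ) (m : Measure ℝ) : Prop :=
  IsProbabilityMeasure m ∧ ∀ z : ℂ, 0 < z.im → fTransform m z = (fTransform μ)^[n] z

open Classical in
/-- The `n`-th monotone convolution power `μ^{▷ n}`: the measure with
`F_{μ^{▷ n}} = F_μ^{∘ n}` on the upper half-plane. For a probability measure `μ` it exists and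
is unique (a probability measure is determined by its `F`-transform); the value `0` would be
used only for measures `μ` without such a power. -/
noncomputable def monotonePower (μ : Measure ℝ) (n : ℕ) : Measure ℝ :=
  if h : ∃ m : Measure ℝ, IsMonotonePower μ n m then h.choose else 0

/-- The normalization `μ_n(A) = μ^{▷ n}(√n A)` (that is, the image of `μ^{▷ n}` under
`t ↦ t / √n`), for `n ≥ 1`. -/
noncomputable def normalizedPower (μ : Measure ℝ) (n : ℕ) : Measure ℝ :=
  (monotonePower μ n).map (fun t : ℝ => t / √(n : ℝ))

/-- The arcsine law on `(-√2, √2)`, with density `1 / (π √(2 - t²))`. -/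
noncomputable def arcsineLaw : Measure ℝ :=
  (volume.restrict (Set.Ioo (-√2) √2)).withDensity
    (fun t : ℝ => ENNReal.ofReal (1 / (Real.pi * √(2 - t ^ 2))))

/-- The Kolmogorov distance `sup_x |α((-∞, x]) - β((-∞, x])|` (of finite measures). -/
noncomputable def kolmogorovDist (α β : Measure ℝ) : ℝ :=
  ⨆ x : ℝ, |α.real (Set.Iic x) - β.real (Set.Iic x)|

/-- `τ` is the Nevanlinna measure of `σ`: a finite Borel measure with
`F_σ(z) = z - m(σ) + ∫ 1 / (t - z) dτ(t)` on the upper half-plane, `m(σ)` being the mean of `σ`. -/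
def IsNevanlinnaMeasure (σ τ : Measure ℝ) : Prop :=
  IsFiniteMeasure τ ∧ ∀ z : ℂ, 0 < z.im →
    fTransform σ z = z - ((∫ t, t ∂σ : ℝ) : ℂ) + ∫ t : ℝ, 1 / ((t : ℂ) - z) ∂τ

/-- The first absolute moment `∫ |t| dτ(t)`; finite exactly when `Integrable id τ`. -/
noncomputable def absMoment (τ : Measure ℝ) : ℝ := ∫ t, |t| ∂τ

/-- The quantity `d + 3 (1 + m₂(ν))²`, where `d = ∫ |t| dρ(t)` and `m₂(ν) = ∫ t² dν(t)`. -/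
noncomputable def rateConst (ν ρ : Measure ℝ) : ℝ :=
  absMoment ρ + 3 * (1 + ∫ t, t ^ 2 ∂ν) ^ 2

/-- The symmetric Bernoulli law `(δ_{-1} + δ_1) / 2`. -/
noncomputable def symmetricBernoulli : Measure ℝ :=
  (1 / 2 : ℝ≥0∞) • (Measure.dirac (-1) + Measure.dirac 1)

end MonotoneCLT

open MonotoneCLT

/-! ### Cauchy transforms, resolvent integrals and the growth of imaginary parts. -/

namespace MonotoneCLT

open Filter Topology

/-! Mean 0 and variance 1 give `F_μ(w) = w - G_ν(w)` with `ν` a probability measure. Since `w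
G_ν(w)` is close to 1, squaring shows that one application of `F_μ` lowers `w²` by about 2. After
`n` steps from `Z = √n z` and division by `n`, this says `F_{μ_n}(z)² ≈ z² - 2`, and `z² - 2` is
exactly `F_γ(z)²` for the arcsine law. `F_μ` never decreases imaginary parts, so every estimate made
at height `Im Z` persists along the orbit.

If `c < ∞`, then `|w G_ν(w) - 1| ≤ c / Im w`, and the `n` errors are simply added
(`norm_iterate_sq_sub_le`).

If moreover `F_ν(w) = w - m - G_ρ(w)`, the identity `F_ν G_ν = 1` evaluates `w G_ν(w)` one order
further. The term `2m G_ν` telescopes to `2m (Z - F_μ^n(Z))`, while the remaining error is at most a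
constant times `∫ |w - t|⁻² dν(t)`. This integral times `Im w` is the increase of `Im w` in that
step, so these errors telescope too, and their sum is of order `√n / Im Z` instead of `n / Im Z`
(`norm_step_le`, `norm_iterate_sq_sub_le_of_second`).

To pass from transforms to distributions, suppose `|F_α² - (z² - 2)| ≤ y / 2` on the line `Im z =
y`. Then `G_α - G_γ` has `L¹` norm `O(√y)` on that line. Poisson smoothing at height `y`, with the
bound `O(√h)` for the arcsine mass of an interval of length `h`, gives distance at most `8 √y`
(`kolmogorovDist_arcsineLaw_le`). The rates come from the smallest admissible order of `y`: `√c /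
n^{1/4}` in the first case, `D / √n` in the second.

Existence of `ν`, `ρ` and the monotone powers rests on `exists_stieltjes_measure`, obtained from the
Herglotz theorem on the disc. Moments pass between a measure and its Nevanlinna measure through
expansions in `1 / z` along the imaginary axis. The degenerate case `c = 0` is detected by the
Cauchy transform at the single point `i`. -/

/-- The Cauchy transform `G_σ(z) = ∫ 1 / (z - t) dσ(t)`. -/
noncomputable def cauchyTransform (σ : Measure ℝ) (z : ℂ) : ℂ := ∫ t : ℝ, 1 / (z - (t : ℂ)) ∂σ

/-- The integral `∫ 1 / |z - t|² dσ(t)`. -/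
noncomputable def sqResolventIntegral (σ : Measure ℝ) (z : ℂ) : ℝ :=
  ∫ t : ℝ, 1 / ‖z - (t : ℂ)‖ ^ 2 ∂σ

lemma fTransform_eq (σ : Measure ℝ) (z : ℂ) : fTransform σ z = 1 / cauchyTransform σ z := rfl

lemma im_le_norm_sub_ofReal (z : ℂ) (t : ℝ) : z.im ≤ ‖z - (t : ℂ)‖ := by
  simpa using (le_abs_self _).trans (Complex.abs_im_le_norm (z - (t : ℂ)))

lemma sub_ofReal_ne_zero {z : ℂ} (hz : 0 < z.im) (t : ℝ) : z - (t : ℂ) ≠ 0 :=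
  norm_pos_iff.1 (hz.trans_le (im_le_norm_sub_ofReal z t))

lemma norm_div_sub_le {z : ℂ} (hz : 0 < z.im) (a : ℂ) (t : ℝ) :
    ‖a / (z - (t : ℂ))‖ ≤ ‖a‖ / z.im := by
  rw [norm_div]
  exact div_le_div_of_nonneg_left (norm_nonneg _) hz (im_le_norm_sub_ofReal z t)

lemma integrable_div_sub {σ : Measure ℝ} {z : ℂ} (hz : 0 < z.im) {g : ℝ → ℂ}
    (hg : Integrable g σ) : Integrable (fun t : ℝ => g t / (z - (t : ℂ))) σ := by
  refine (hg.norm.div_const z.im).mono' ?_ (ae_of_all _ fun t => norm_div_sub_le hz _ t)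
  have : Measurable fun t : ℝ => (z - (t : ℂ))⁻¹ := by fun_prop
  simp only [div_eq_mul_inv]
  exact hg.aestronglyMeasurable.mul this.aestronglyMeasurable

lemma norm_integral_div_sub_le {σ : Measure ℝ} {z : ℂ} (hz : 0 < z.im) {g : ℝ → ℂ}
    (hg : Integrable g σ) : ‖∫ t : ℝ, g t / (z - (t : ℂ)) ∂σ‖ ≤ (∫ t, ‖g t‖ ∂σ) / z.im := by
  rw [← integral_div]
  exact norm_integral_le_of_norm_le (hg.norm.div_const _) (ae_of_all _ fun t => norm_div_sub_le hz _ t)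

lemma sqResolventIntegral_nonneg {σ : Measure ℝ} {z : ℂ} : 0 ≤ sqResolventIntegral σ z :=
  integral_nonneg fun t => by positivity

/-- Cauchy–Schwarz against the constant 1, read off from the nonnegative integral of `(M ‖f‖ - A)²`,
where `M` is the total mass and `A = ∫ ‖f‖`. -/
lemma sq_integral_norm_le {σ : Measure ℝ} [IsFiniteMeasure σ] {f : ℝ → ℂ} (hf : Integrable f σ)
    (hf2 : Integrable (fun t => ‖f t‖ ^ 2) σ) :
    ‖∫ t, f t ∂σ‖ ^ 2 ≤ σ.real Set.univ * ∫ t, ‖f t‖ ^ 2 ∂σ := by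
  set M := σ.real Set.univ with hM
  set A := ∫ t, ‖f t‖ ∂σ with hA
  have h1 : ‖∫ t, f t ∂σ‖ ≤ A := norm_integral_le_integral_norm _
  have h0 : 0 ≤ ∫ t, (M * ‖f t‖ - A) ^ 2 ∂σ := integral_nonneg fun t => sq_nonneg _
  have h2 : ∫ t, (M * ‖f t‖ - A) ^ 2 ∂σ = M ^ 2 * (∫ t, ‖f t‖ ^ 2 ∂σ) - 2 * M * A * A + A ^ 2 * M := by
    have : (fun t => (M * ‖f t‖ - A) ^ 2) =
        fun t => M ^ 2 * ‖f t‖ ^ 2 - 2 * M * A * ‖f t‖ + A ^ 2 := by ext t; ring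
    have hi := (hf2.const_mul (M ^ 2)).sub (hf.norm.const_mul (2 * M * A))
    have h3 := integral_sub (hf2.const_mul (M ^ 2)) (hf.norm.const_mul (2 * M * A))
    have h4 := integral_add hi (integrable_const (A ^ 2))
    simp only [Pi.sub_apply, integral_const_mul, integral_const, smul_eq_mul] at h3 h4
    rw [this, h4, h3]
    ring
  have hM0 : 0 ≤ M := measureReal_nonneg
  rcases hM0.eq_or_lt with h | h
  · have : σ = 0 := by
      rw [← Measure.measure_univ_eq_zero]
      exact (measureReal_eq_zero_iff).1 (hM.symm.trans h.symm)
    simp [this]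
  · have h3 : 0 ≤ M * (M * (∫ t, ‖f t‖ ^ 2 ∂σ) - A ^ 2) := by
      rw [h2] at h0; linarith
    have h4 := nonneg_of_mul_nonneg_right h3 h
    have h5 := pow_le_pow_left₀ (norm_nonneg _) h1 2
    linarith

section Finite

variable {σ : Measure ℝ} [IsFiniteMeasure σ] {z : ℂ}

lemma integrable_one_div_sub (hz : 0 < z.im) : Integrable (fun t : ℝ => 1 / (z - (t : ℂ))) σ :=
  integrable_div_sub hz (integrable_const _)

lemma norm_cauchyTransform_le (hz : 0 < z.im) : ‖cauchyTransform σ z‖ ≤ σ.real Set.univ / z.im := by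
  simpa [cauchyTransform] using norm_integral_div_sub_le (σ := σ) hz (integrable_const (1 : ℂ))

lemma integrable_sqResolvent (hz : 0 < z.im) :
    Integrable (fun t : ℝ => 1 / ‖z - (t : ℂ)‖ ^ 2) σ := by
  refine (integrable_const (1 / z.im ^ 2)).mono' (Measurable.aestronglyMeasurable (by fun_prop))
    (ae_of_all _ fun t => ?_)
  rw [Real.norm_of_nonneg (by positivity)]
  exact one_div_le_one_div_of_le (by positivity)
    (pow_le_pow_left₀ hz.le (im_le_norm_sub_ofReal z t) 2)

lemma sqResolventIntegral_le (hz : 0 < z.im) :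
    sqResolventIntegral σ z ≤ σ.real Set.univ / z.im ^ 2 := by
  have : ∫ _ : ℝ, 1 / z.im ^ 2 ∂σ = σ.real Set.univ / z.im ^ 2 := by simp [div_eq_mul_inv]
  rw [← this]
  exact integral_mono (integrable_sqResolvent hz) (integrable_const _) fun t =>
    one_div_le_one_div_of_le (by positivity)
      (pow_le_pow_left₀ hz.le (im_le_norm_sub_ofReal z t) 2)

lemma im_one_div_sub (z : ℂ) (t : ℝ) :
    (1 / (z - (t : ℂ))).im = -(z.im * (1 / ‖z - (t : ℂ)‖ ^ 2)) := by
  rw [one_div, Complex.inv_im, Complex.normSq_eq_norm_sq]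
  simp [div_eq_mul_inv]

lemma im_cauchyTransform (hz : 0 < z.im) :
    (cauchyTransform σ z).im = -(z.im * sqResolventIntegral σ z) := by
  have := Complex.imCLM.integral_comp_comm (integrable_one_div_sub (σ := σ) hz)
  simp only [Complex.imCLM_apply] at this
  rw [cauchyTransform, ← this, sqResolventIntegral, ← integral_const_mul, ← integral_neg]
  exact integral_congr_ae (ae_of_all _ fun t => im_one_div_sub z t)

lemma sq_norm_cauchyTransform_le (hz : 0 < z.im) :
    ‖cauchyTransform σ z‖ ^ 2 ≤ σ.real Set.univ * sqResolventIntegral σ z := by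
  have h2 : Integrable (fun t : ℝ => ‖1 / (z - (t : ℂ))‖ ^ 2) σ := by
    simpa using integrable_sqResolvent (σ := σ) hz
  have := sq_integral_norm_le (integrable_one_div_sub (σ := σ) hz) h2
  simpa [cauchyTransform, sqResolventIntegral] using this

lemma differentiableOn_cauchyTransform :
    DifferentiableOn ℂ (cauchyTransform σ) {z | 0 < z.im} := by
  have h := (analyticOn_resolventTransform (μ := σ)).differentiableOn.neg
  have h2 : cauchyTransform σ = -resolventTransform σ := by
    ext z
    simp only [cauchyTransform, Pi.neg_apply, resolventTransform_apply, ← integral_neg]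
    refine integral_congr_ae (ae_of_all _ fun t => ?_)
    simp [resolvent, ← inv_neg]
  rw [h2]
  refine h.mono ?_
  rintro z hz ⟨t, -, rfl⟩
  simp at hz

end Finite

section Prob

variable {σ : Measure ℝ} [IsProbabilityMeasure σ] {z : ℂ}

lemma sqResolventIntegral_pos (hz : 0 < z.im) : 0 < sqResolventIntegral σ z := by
  refine (integral_pos_iff_support_of_nonneg (fun t => by positivity) (integrable_sqResolvent hz)).2 ?_
  have : (Function.support fun t : ℝ => 1 / ‖z - (t : ℂ)‖ ^ 2) = Set.univ := by
    ext t
    simp only [Function.mem_support, Set.mem_univ, iff_true]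
    have := norm_pos_iff.2 (sub_ofReal_ne_zero hz t)
    positivity
  rw [this]
  simp

lemma cauchyTransform_ne_zero (hz : 0 < z.im) : cauchyTransform σ z ≠ 0 := by
  intro h
  have := im_cauchyTransform (σ := σ) hz
  rw [h] at this
  have h2 := mul_pos hz (sqResolventIntegral_pos (σ := σ) hz)
  simp at this
  rcases this with h | h
  · exact hz.ne' h
  · exact (sqResolventIntegral_pos (σ := σ) hz).ne' h

lemma im_fTransform (hz : 0 < z.im) :
    (fTransform σ z).im = z.im * sqResolventIntegral σ z / ‖cauchyTransform σ z‖ ^ 2 := by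
  rw [fTransform_eq, one_div, Complex.inv_im, im_cauchyTransform hz, Complex.normSq_eq_norm_sq,
    neg_neg]

/-- By Cauchy–Schwarz `|G|²` is at most `∫ |z - t|⁻² dσ`, the factor in `im_fTransform`. Hence
orbits of `F` never sink, and bounds by the starting height hold along the whole orbit. -/
lemma im_le_im_fTransform (hz : 0 < z.im) : z.im ≤ (fTransform σ z).im := by
  rw [im_fTransform hz, le_div_iff₀ (by have := cauchyTransform_ne_zero (σ := σ) hz; positivity)]
  have := sq_norm_cauchyTransform_le (σ := σ) hz
  simp at this
  exact mul_le_mul_of_nonneg_left this hz.le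

lemma differentiableOn_fTransform : DifferentiableOn ℂ (fTransform σ) {z | 0 < z.im} := by
  have := (differentiableOn_const (1 : ℂ)).div (differentiableOn_cauchyTransform (σ := σ))
    fun z hz => cauchyTransform_ne_zero hz
  exact this

end Prob

end MonotoneCLT

namespace MonotoneCLT

open Filter Topology Metric

/-! ### The Herglotz representation on the disc -/

/-- On the circle `ζ⁻¹` is the conjugate of `ζ`; this turns the kernel, which has a pole at `w`,
into the conjugate of a function analytic in the disc. -/
lemma star_herglotz_of_norm_one {ζ : ℂ} (hζ : ‖ζ‖ = 1) (w : ℂ) (hw : ‖w‖ < 1) :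
    (ζ + w) / (ζ - w) =
      (starRingEnd ℂ) ((1 + (starRingEnd ℂ) w * ζ) / (1 - (starRingEnd ℂ) w * ζ)) := by
  have h1 : ζ * (starRingEnd ℂ) ζ = 1 := by
    rw [Complex.mul_conj, Complex.normSq_eq_norm_sq, hζ]; simp
  have h0 : ζ ≠ 0 := by intro h; simp [h] at hζ
  have h2 : (starRingEnd ℂ) ζ = ζ⁻¹ := eq_inv_of_mul_eq_one_right h1
  have h3 : ζ - w ≠ 0 := by
    intro h
    rw [sub_eq_zero] at h
    rw [h] at hζ; linarith
  simp only [map_div₀, map_add, map_sub, map_one, map_mul, Complex.conj_conj, h2]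
  have h4 : 1 - w * ζ⁻¹ ≠ 0 := by
    intro h
    apply h3
    rw [sub_eq_zero] at h ⊢
    field_simp at h
    exact h
  field_simp

/-- Write `Re g` as half of `g` plus its conjugate. Against `g` the kernel is `2ζ/(ζ - w) - 1`, so
Cauchy's formula applies. Against the conjugate it is the conjugate of an analytic kernel equal to 1
at the origin, so the mean value property gives the conjugate of `g 0`. -/
lemma circleAverage_herglotz_re {g : ℂ → ℂ} (hg : DiffContOnCl ℂ g (ball 0 1)) {w : ℂ}
    (hw : w ∈ ball (0 : ℂ) 1) :
    Real.circleAverage (fun ζ => (ζ + w) / (ζ - w) * ((g ζ).re : ℂ)) 0 1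
      = g w - Complex.I * (g 0).im := by
  have hw1 : ‖w‖ < 1 := by simpa using hw
  have hgc : ContinuousOn g (sphere 0 1) := by
    have := hg.2
    rw [closure_ball _ one_ne_zero] at this
    exact this.mono sphere_subset_closedBall
  have hne : ∀ ζ ∈ sphere (0 : ℂ) 1, ζ - w ≠ 0 := by
    intro ζ hζ h
    rw [sub_eq_zero] at h
    rw [h] at hζ
    simp at hζ
    linarith
  set A : ℂ → ℂ := fun ζ => (ζ / (ζ - w)) * g ζ with hA
  set B : ℂ → ℂ := fun ζ => (1 + (starRingEnd ℂ) w * ζ) / (1 - (starRingEnd ℂ) w * ζ) * g ζ with hB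
  have hAc : CircleIntegrable A 0 1 := ContinuousOn.circleIntegrable zero_le_one
    ((continuousOn_id.div (by fun_prop) hne).mul hgc)
  have hne2 : ∀ ζ ∈ closedBall (0 : ℂ) 1, 1 - (starRingEnd ℂ) w * ζ ≠ 0 := by
    intro ζ hζ h
    rw [sub_eq_zero] at h
    have h2 := congrArg norm h
    simp at h2 hζ
    nlinarith [norm_nonneg w, norm_nonneg ζ]
  have hBd : DiffContOnCl ℂ B (ball 0 1) := by
    have hk : DiffContOnCl ℂ (fun ζ => (1 + (starRingEnd ℂ) w * ζ) * (1 - (starRingEnd ℂ) w * ζ)⁻¹)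
        (ball 0 1) := by
      apply DifferentiableOn.diffContOnCl
      rw [closure_ball _ one_ne_zero]
      exact DifferentiableOn.mul (by fun_prop) (DifferentiableOn.inv (by fun_prop) hne2)
    simpa [hB, div_eq_mul_inv, smul_eq_mul] using hk.smul hg
  have hBc : CircleIntegrable B 0 1 := by
    refine ContinuousOn.circleIntegrable zero_le_one ?_
    have := hBd.2
    rw [closure_ball _ one_ne_zero] at this
    exact this.mono sphere_subset_closedBall
  have hgi : CircleIntegrable g 0 1 := ContinuousOn.circleIntegrable zero_le_one hgc
  have hCB : CircleIntegrable (Complex.conjCLE ∘ B) 0 1 := by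
    refine ContinuousOn.circleIntegrable zero_le_one ?_
    have := hBd.2
    rw [closure_ball _ one_ne_zero] at this
    exact Complex.continuous_conj.comp_continuousOn (this.mono sphere_subset_closedBall)
  have eA : Real.circleAverage A 0 1 = g w := by
    have := DiffContOnCl.circleAverage_smul_div (R := 1) (c := 0) (f := g) (w := w)
      (by simpa using hg) (by simpa using hw)
    simpa [hA] using this
  have eB : Real.circleAverage B 0 1 = g 0 := by
    have := DiffContOnCl.circleAverage (R := 1) (c := 0) (f := B) (by simpa using hBd)
    simpa [hB] using this
  have eg : Real.circleAverage g 0 1 = g 0 :=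
    DiffContOnCl.circleAverage (R := 1) (c := 0) (by simpa using hg)
  have eCB : Real.circleAverage (Complex.conjCLE ∘ B) 0 1 = (starRingEnd ℂ) (g 0) := by
    have := ContinuousLinearMap.circleAverage_comp_comm (Complex.conjCLE : ℂ →L[ℝ] ℂ) hBc
    rw [eB] at this
    simpa using this
  have key : Set.EqOn (fun ζ => (ζ + w) / (ζ - w) * ((g ζ).re : ℂ))
      (fun ζ => (A ζ + (-(1 / 2 : ℂ)) • g ζ) + (1 / 2 : ℂ) • (Complex.conjCLE ∘ B) ζ)
      (sphere 0 |1|) := by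
    intro ζ hζ
    rw [abs_one] at hζ
    have h1 : ‖ζ‖ = 1 := by simpa using hζ
    have h2 : ((g ζ).re : ℂ) = (g ζ + (starRingEnd ℂ) (g ζ)) / 2 := by
      rw [Complex.add_conj]; simp
    have h3 : (Complex.conjCLE ∘ B) ζ = (ζ + w) / (ζ - w) * (starRingEnd ℂ) (g ζ) := by
      rw [star_herglotz_of_norm_one h1 w hw1]
      simp [hB]
    have h4 := hne ζ hζ
    simp only [h3, h2, hA, smul_eq_mul]
    field_simp
    ring
  rw [Real.circleAverage_congr_sphere key]
  have i1 : CircleIntegrable (fun ζ => (-(1 / 2 : ℂ)) • g ζ) 0 1 := hgi.const_smul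
  have i2 : CircleIntegrable (fun ζ => (1 / 2 : ℂ) • (Complex.conjCLE ∘ B) ζ) 0 1 := hCB.const_smul
  have e1 := Real.circleAverage_fun_add (hAc.add i1) i2
  simp only [Pi.add_apply] at e1
  rw [e1, Real.circleAverage_add hAc i1,
    Real.circleAverage_fun_smul, Real.circleAverage_fun_smul, eA, eg, eCB]
  have h5 : g 0 - (starRingEnd ℂ) (g 0) = 2 * (g 0).im * Complex.I := by
    rw [Complex.sub_conj]; push_cast; ring
  simp only [smul_eq_mul]
  linear_combination (-1 / 2) * h5

/-- A nonnegative continuous function on the unit circle as the density of a measure with respect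
to normalized arc length. -/
lemma exists_circle_measure {h : ℂ → ℝ} (hc : ContinuousOn h (sphere 0 1))
    (h0 : ∀ ζ ∈ sphere (0 : ℂ) 1, 0 ≤ h ζ) :
    ∃ σ : Measure (sphere (0 : ℂ) 1), IsFiniteMeasure σ ∧ ∀ k : ℂ → ℂ, ContinuousOn k (sphere 0 1) →
      ∫ ζ : sphere (0 : ℂ) 1, k ζ ∂σ = Real.circleAverage (fun ζ => k ζ * (h ζ : ℂ)) 0 1 := by
  have hcm : ∀ θ, circleMap 0 1 θ ∈ sphere (0 : ℂ) 1 := fun θ => circleMap_mem_sphere 0 zero_le_one θ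
  have hcont : Continuous fun θ : ℝ => (2 * Real.pi)⁻¹ * h (circleMap 0 1 θ) :=
    continuous_const.mul (hc.comp_continuous (continuous_circleMap 0 1) hcm)
  have hpos : ∀ θ : ℝ, 0 ≤ (2 * Real.pi)⁻¹ * h (circleMap 0 1 θ) := fun θ =>
    mul_nonneg (by positivity) (h0 _ (hcm θ))
  set ρ : Measure ℝ := (volume.restrict (Set.Ioc 0 (2 * Real.pi))).withDensity
    (fun θ => ENNReal.ofReal ((2 * Real.pi)⁻¹ * h (circleMap 0 1 θ))) with hρ
  have hfin : IsFiniteMeasure ρ := by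
    apply isFiniteMeasure_withDensity_ofReal
    exact (hcont.integrableOn_Ioc).2
  have hec : Continuous fun θ : ℝ => (⟨circleMap 0 1 θ, hcm θ⟩ : sphere (0 : ℂ) 1) :=
    (continuous_circleMap 0 1).subtype_mk _
  refine ⟨ρ.map fun θ => ⟨circleMap 0 1 θ, hcm θ⟩, inferInstance, fun k hk => ?_⟩
  have hkc : Continuous fun ζ : sphere (0 : ℂ) 1 => k ζ := hk.comp_continuous continuous_subtype_val (by simp)
  rw [integral_map (hec.measurable.aemeasurable) hkc.aestronglyMeasurable, hρ,
    integral_withDensity_eq_integral_toReal_smul hcont.measurable.ennreal_ofReal (by simp), Real.circleAverage,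
    intervalIntegral.integral_of_le (by positivity), ← integral_smul]
  refine integral_congr_ae (ae_of_all _ fun θ => ?_)
  simp only [ENNReal.toReal_ofReal (hpos θ), Complex.real_smul]
  push_cast
  ring

/-- **Herglotz representation**: an analytic function with nonnegative real part on the unit disc
is, up to an imaginary constant, the Herglotz integral of a finite measure on the circle. -/
theorem exists_herglotz_measure {f : ℂ → ℂ} (hf : DifferentiableOn ℂ f (ball 0 1))
    (hre : ∀ w ∈ ball (0 : ℂ) 1, 0 ≤ (f w).re) :
    ∃ σ : Measure (sphere (0 : ℂ) 1), IsFiniteMeasure σ ∧ ∀ w ∈ ball (0 : ℂ) 1,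
      f w = Complex.I * (f 0).im + ∫ ζ : sphere (0 : ℂ) 1, ((ζ : ℂ) + w) / ((ζ : ℂ) - w) ∂σ := by
  set r : ℕ → ℝ := fun n => 1 - 1 / ((n : ℝ) + 1) with hr
  have hr0 : ∀ n, 0 ≤ r n := fun n => by
    have : 1 / ((n : ℝ) + 1) ≤ 1 := by
      rw [div_le_one (by positivity)]; linarith [(Nat.cast_nonneg n : (0 : ℝ) ≤ n)]
    simp only [hr]; linarith
  have hr1 : ∀ n, r n < 1 := fun n => by
    have : 0 < 1 / ((n : ℝ) + 1) := by positivity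
    simp only [hr]; linarith
  have hrt : Tendsto r atTop (𝓝 1) := by
    simpa [hr] using (tendsto_one_div_add_atTop_nhds_zero_nat (𝕜 := ℝ)).const_sub 1
  have hmaps : ∀ n, Set.MapsTo (fun ζ : ℂ => (r n : ℂ) * ζ) (closedBall 0 1) (ball 0 1) := by
    intro n ζ hζ
    simp at hζ ⊢
    rw [abs_of_nonneg (hr0 n)]
    nlinarith [hr0 n, hr1 n, norm_nonneg ζ]
  have hgd : ∀ n, DiffContOnCl ℂ (fun ζ => f (r n * ζ)) (ball 0 1) := by
    intro n
    apply DifferentiableOn.diffContOnCl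
    rw [closure_ball _ one_ne_zero]
    exact hf.comp (by fun_prop) (hmaps n)
  have hgc : ∀ n, ContinuousOn (fun ζ => (f (r n * ζ)).re) (sphere 0 1) := by
    intro n
    have := (hgd n).2
    rw [closure_ball _ one_ne_zero] at this
    exact Complex.continuous_re.comp_continuousOn (this.mono sphere_subset_closedBall)
  choose σ hσ hσk using fun n => exists_circle_measure (hgc n)
    (fun ζ hζ => hre _ (hmaps n (sphere_subset_closedBall hζ)))
  have hker : ∀ w ∈ ball (0 : ℂ) 1, ContinuousOn (fun ζ => (ζ + w) / (ζ - w)) (sphere (0 : ℂ) 1) := by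
    intro w hw
    refine ContinuousOn.div (by fun_prop) (by fun_prop) fun ζ hζ h => ?_
    rw [sub_eq_zero] at h
    rw [h] at hζ
    simp at hζ hw
    linarith
  have hrep : ∀ n, ∀ w ∈ ball (0 : ℂ) 1,
      ∫ ζ : sphere (0 : ℂ) 1, ((ζ : ℂ) + w) / ((ζ : ℂ) - w) ∂(σ n) = f (r n * w) - Complex.I * (f 0).im := by
    intro n w hw
    rw [hσk n (fun ζ => (ζ + w) / (ζ - w)) (hker w hw), circleAverage_herglotz_re (hgd n) hw]
    simp
  set τ : ℕ → FiniteMeasure (sphere (0 : ℂ) 1) := fun n => ⟨σ n, hσ n⟩ with hτ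
  -- At `w = 0` the kernel is 1, so all approximating measures have the same mass, as weak
  -- compactness requires.
  have hmass : ∀ n, (τ n).mass = Real.toNNReal (f 0).re := by
    intro n
    have h1 := hrep n 0 (by simp)
    have h2 : ∫ ζ : sphere (0 : ℂ) 1, ((ζ : ℂ) + 0) / ((ζ : ℂ) - 0) ∂(σ n) = ((σ n).real Set.univ : ℂ) := by
      have : ∀ ζ : sphere (0 : ℂ) 1, ((ζ : ℂ) + 0) / ((ζ : ℂ) - 0) = 1 := fun ζ => by
        rw [add_zero, sub_zero, div_self (ne_of_mem_sphere ζ.2 one_ne_zero)]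
      simp_rw [this]
      simp
    rw [h2] at h1
    have h3 := congrArg Complex.re h1
    simp at h3
    apply NNReal.eq
    rw [Real.coe_toNNReal _ (hre 0 (by simp)), ← h3]
    rfl
  have hcomp := isCompact_setOfPred_finiteMeasure_eq_of_compactSpace (sphere (0 : ℂ) 1) (Real.toNNReal (f 0).re)
  -- A limit along a free ultrafilter serves as the weak limit point, with no extraction of a
  -- subsequence.
  obtain ⟨s, -, hs⟩ := hcomp.ultrafilter_le_nhds' ((Filter.hyperfilter ℕ).map τ)
    (Filter.mem_map.2 (Filter.Eventually.of_forall hmass))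
  have hts : Tendsto τ (Filter.hyperfilter ℕ) (𝓝 s) := hs
  rw [FiniteMeasure.tendsto_iff_forall_integral_rclike_tendsto ℂ] at hts
  refine ⟨s, inferInstance, fun w hw => ?_⟩
  have hkc : Continuous fun ζ : sphere (0 : ℂ) 1 => ((ζ : ℂ) + w) / ((ζ : ℂ) - w) :=
    (hker w hw).comp_continuous continuous_subtype_val (by simp)
  have h1 := hts (BoundedContinuousFunction.mkOfCompact ⟨_, hkc⟩)
  simp only [BoundedContinuousFunction.mkOfCompact_apply, ContinuousMap.coe_mk] at h1
  have h2 : Tendsto (fun n => f (r n * w) - Complex.I * (f 0).im) (Filter.hyperfilter ℕ)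
      (𝓝 (f w - Complex.I * (f 0).im)) := by
    refine Tendsto.mono_left ?_ Nat.hyperfilter_le_atTop
    have hcw : ContinuousAt f w := (hf.differentiableAt (isOpen_ball.mem_nhds hw)).continuousAt
    have h3 : Tendsto (fun n => (r n : ℂ) * w) atTop (𝓝 w) := by
      have := (Complex.continuous_ofReal.tendsto 1).comp hrt
      simpa using this.mul_const w
    exact (hcw.tendsto.comp h3).sub_const _
  have h4 : (fun n => f (r n * w) - Complex.I * (f 0).im) =
      fun n => ∫ ζ : sphere (0 : ℂ) 1, ((ζ : ℂ) + w) / ((ζ : ℂ) - w) ∂(τ n : Measure (sphere (0 : ℂ) 1)) := by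
    ext n
    exact (hrep n w hw).symm
  rw [h4] at h2
  rw [← tendsto_nhds_unique h2 h1]
  ring

end MonotoneCLT

namespace MonotoneCLT

open Filter Topology Metric

/-! ### The Nevanlinna representation on the upper half-plane -/

lemma tendsto_cutoff (t : ℝ) :
    Tendsto (fun y : ℝ => y ^ 2 / (t ^ 2 + y ^ 2)) atTop (𝓝 1) := by
  have h : Tendsto (fun y : ℝ => 1 - t ^ 2 / (t ^ 2 + y ^ 2)) atTop (𝓝 (1 - 0)) := by
    refine tendsto_const_nhds.sub (Tendsto.div_atTop tendsto_const_nhds ?_)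
    exact tendsto_atTop_add_const_left _ _ (tendsto_pow_atTop two_ne_zero)
  rw [sub_zero] at h
  refine h.congr' ?_
  filter_upwards [eventually_gt_atTop 0] with y hy
  field_simp
  ring

/-- Fatou's lemma: the cutoffs tend to 1 pointwise. This converts bounds along the imaginary axis
into finite moments. -/
lemma integrable_of_cutoff_integral_le {τ : Measure ℝ} {g : ℝ → ℝ} (hg : Measurable g)
    (h0 : ∀ t, 0 ≤ g t) {C : ℝ}
    (hC : ∀ᶠ y : ℝ in atTop, Integrable (fun t => g t * (y ^ 2 / (t ^ 2 + y ^ 2))) τ ∧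
      ∫ t, g t * (y ^ 2 / (t ^ 2 + y ^ 2)) ∂τ ≤ C) : Integrable g τ := by
  refine ⟨hg.aestronglyMeasurable, ?_⟩
  rw [hasFiniteIntegral_iff_ofReal (ae_of_all _ h0)]
  have hlim : ∀ t, Tendsto (fun n : ℕ => ENNReal.ofReal (g t * ((n : ℝ) ^ 2 / (t ^ 2 + (n : ℝ) ^ 2))))
      atTop (𝓝 (ENNReal.ofReal (g t))) := by
    intro t
    refine ENNReal.tendsto_ofReal ?_
    simpa using ((tendsto_cutoff t).comp tendsto_natCast_atTop_atTop).const_mul (g t)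
  have h1 : ∫⁻ t, ENNReal.ofReal (g t) ∂τ ≤
      liminf (fun n : ℕ => ∫⁻ t, ENNReal.ofReal (g t * ((n : ℝ) ^ 2 / (t ^ 2 + (n : ℝ) ^ 2))) ∂τ)
        atTop := by
    simp_rw [← fun t => (hlim t).liminf_eq]
    exact lintegral_liminf_le fun n => by fun_prop
  refine (h1.trans ?_).trans_lt (ENNReal.ofReal_lt_top (r := C))
  refine liminf_le_of_frequently_le' (Eventually.frequently ?_)
  filter_upwards [tendsto_natCast_atTop_atTop.eventually hC] with n hn
  rw [← ofReal_integral_eq_lintegral_ofReal hn.1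
    (ae_of_all _ fun t => mul_nonneg (h0 t) (by positivity))]
  exact ENNReal.ofReal_le_ofReal hn.2

lemma im_cayley (w : ℂ) :
    (Complex.I * (1 + w) / (1 - w)).im = (1 - ‖w‖ ^ 2) / ‖1 - w‖ ^ 2 := by
  rw [← Complex.normSq_eq_norm_sq, ← Complex.normSq_eq_norm_sq, Complex.div_im]
  simp [Complex.normSq_apply]
  ring

lemma cayley_kernel_one {z : ℂ} (hz : z + Complex.I ≠ 0) :
    Complex.I * ((1 + (z - Complex.I) / (z + Complex.I)) / (1 - (z - Complex.I) / (z + Complex.I)))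
      = z := by
  have h1 : 1 - (z - Complex.I) / (z + Complex.I) = 2 * Complex.I / (z + Complex.I) := by
    field_simp; ring
  have h2 : 1 + (z - Complex.I) / (z + Complex.I) = 2 * z / (z + Complex.I) := by
    field_simp; ring
  rw [h1, h2]
  field_simp [Complex.I_ne_zero]

/-- The Cayley transform carries the Herglotz kernel of the disc to the Nevanlinna kernel; the
excluded point `ζ = 1` is infinity on the line. -/
lemma cayley_kernel {z ζ : ℂ} (hz : z + Complex.I ≠ 0) (hζ : ζ ≠ 1) {t : ℝ}
    (ht : Complex.I * (1 + ζ) / (1 - ζ) = t) (htz : (t : ℂ) - z ≠ 0) :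
    Complex.I * ((ζ + (z - Complex.I) / (z + Complex.I)) / (ζ - (z - Complex.I) / (z + Complex.I)))
      = (1 + t * z) / (t - z) := by
  have hI : Complex.I * Complex.I = -1 := Complex.I_mul_I
  have h1 : 1 - ζ ≠ 0 := sub_ne_zero.2 hζ.symm
  have htI : (t : ℂ) + Complex.I ≠ 0 := by
    intro h
    have := congrArg Complex.im h
    simp at this
  have hζt : ζ = (t - Complex.I) / (t + Complex.I) := by
    rw [div_eq_iff h1] at ht
    rw [eq_div_iff htI]
    linear_combination ht
  have e1 : ζ + (z - Complex.I) / (z + Complex.I)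
      = 2 * (1 + t * z) / ((t + Complex.I) * (z + Complex.I)) := by
    rw [hζt, div_add_div _ _ htI hz]
    congr 1
    linear_combination -2 * hI
  have e2 : ζ - (z - Complex.I) / (z + Complex.I)
      = 2 * Complex.I * (t - z) / ((t + Complex.I) * (z + Complex.I)) := by
    rw [hζt, div_sub_div _ _ htI hz]
    congr 1
    ring
  rw [e1, e2]
  have := Complex.I_ne_zero
  field_simp

/-- An analytic function on the upper half-plane with nonnegative imaginary part that decays like
`1 / y` along the imaginary axis is `z ↦ ∫ 1 / (t - z) dτ(t)` for a finite measure `τ`. -/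
theorem exists_stieltjes_measure {φ : ℂ → ℂ} (hφ : DifferentiableOn ℂ φ {z | 0 < z.im})
    (him : ∀ z : ℂ, 0 < z.im → 0 ≤ (φ z).im) {C : ℝ}
    (hC : ∀ y : ℝ, 1 ≤ y → y * ‖φ (y * Complex.I)‖ ≤ C) :
    ∃ τ : Measure ℝ, IsFiniteMeasure τ ∧ ∀ z : ℂ, 0 < z.im → φ z = -cauchyTransform τ z := by
  have hmem : ∀ w ∈ ball (0 : ℂ) 1, 0 < (Complex.I * (1 + w) / (1 - w)).im := by
    intro w hw
    have hw1 : ‖w‖ < 1 := by simpa using hw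
    rw [im_cayley]
    have h1 : 0 < ‖1 - w‖ := by
      rw [norm_pos_iff, sub_ne_zero]
      rintro rfl
      simp at hw1
    have h2 : 0 < 1 - ‖w‖ ^ 2 := by nlinarith [norm_nonneg w]
    positivity
  set f : ℂ → ℂ := fun w => -Complex.I * φ (Complex.I * (1 + w) / (1 - w)) with hf
  have hfd : DifferentiableOn ℂ f (ball 0 1) := by
    refine DifferentiableOn.const_mul (hφ.comp (DifferentiableOn.div (by fun_prop) (by fun_prop) ?_)
      hmem) _
    intro w hw h
    rw [sub_eq_zero] at h
    simp [← h] at hw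
  obtain ⟨σ, hσ, hrep⟩ := exists_herglotz_measure hfd (fun w hw => by
    simpa [hf] using him _ (hmem w hw))
  set c : ℂ → ℂ := fun z => (z - Complex.I) / (z + Complex.I) with hc
  set a : ℝ := -(f 0).im with ha
  have hzI : ∀ z : ℂ, 0 < z.im → z + Complex.I ≠ 0 := by
    intro z hz h
    have := congrArg Complex.im h
    simp at this
    linarith
  have hcb : ∀ z : ℂ, 0 < z.im → c z ∈ ball (0 : ℂ) 1 := by
    intro z hz
    simp only [hc, mem_ball_zero_iff, norm_div]
    rw [div_lt_one (norm_pos_iff.2 (hzI z hz))]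
    refine lt_of_pow_lt_pow_left₀ 2 (norm_nonneg _) ?_
    rw [← Complex.normSq_eq_norm_sq, ← Complex.normSq_eq_norm_sq, Complex.normSq_apply,
      Complex.normSq_apply]
    simp
    nlinarith
  set K : ℂ → sphere (0 : ℂ) 1 → ℂ := fun z ζ =>
    Complex.I * (((ζ : ℂ) + c z) / ((ζ : ℂ) - c z)) with hK
  have hKc : ∀ z : ℂ, 0 < z.im → Continuous (K z) := by
    intro z hz
    refine continuous_const.mul (Continuous.div (by fun_prop) (by fun_prop) fun ζ h => ?_)
    have h1 := hcb z hz
    rw [sub_eq_zero] at h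
    rw [← h] at h1
    simp at h1
  have hKi : ∀ z : ℂ, 0 < z.im → Integrable (K z) σ := fun z hz =>
    (hKc z hz).integrable_of_hasCompactSupport (HasCompactSupport.of_compactSpace _)
  have hφK : ∀ z : ℂ, 0 < z.im → φ z = a + ∫ ζ, K z ζ ∂σ := by
    intro z hz
    have h1 := hrep (c z) (hcb z hz)
    have h2 : f (c z) = -Complex.I * φ z := by
      simp only [hf, hc]
      rw [mul_div_assoc, cayley_kernel_one (hzI z hz)]
    rw [h2] at h1
    simp only [hK]
    rw [integral_const_mul, ha]
    push_cast
    linear_combination Complex.I * h1 + (φ z + (f 0).im) * Complex.I_mul_I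
  set T : sphere (0 : ℂ) 1 → ℝ := fun ζ => (Complex.I * (1 + (ζ : ℂ)) / (1 - (ζ : ℂ))).re with hT
  have hTm : Measurable T := by
    refine Complex.measurable_re.comp (Measurable.div ?_ ?_) <;> fun_prop
  have hTe : ∀ ζ : sphere (0 : ℂ) 1, (ζ : ℂ) ≠ 1 →
      Complex.I * (1 + (ζ : ℂ)) / (1 - (ζ : ℂ)) = T ζ := by
    intro ζ hζ
    apply Complex.ext
    · simp [hT]
    · rw [im_cayley]
      simp
  have htz : ∀ z : ℂ, 0 < z.im → ∀ t : ℝ, (t : ℂ) - z ≠ 0 := fun z hz t => by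
    rw [← neg_ne_zero, neg_sub]; exact sub_ofReal_ne_zero hz t
  have hKT : ∀ z : ℂ, 0 < z.im → ∀ ζ : sphere (0 : ℂ) 1, (ζ : ℂ) ≠ 1 →
      K z ζ = (1 + T ζ * z) / (T ζ - z) := fun z hz ζ hζ =>
    cayley_kernel (hzI z hz) hζ (hTe ζ hζ) (htz z hz _)
  have him_ker : ∀ y : ℝ, 0 < y → ∀ t : ℝ,
      ((1 + (t : ℂ) * (y * Complex.I)) / (t - y * Complex.I)).im
        = (1 + t ^ 2) * (y ^ 2 / (t ^ 2 + y ^ 2)) / y := by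
    intro y hy t
    have hn : t ^ 2 + y ^ 2 ≠ 0 := by positivity
    rw [Complex.div_im]
    simp [Complex.normSq_apply]
    rw [← sq, ← sq]
    field_simp
    ring
  have hyI : ∀ y : ℝ, 0 < y → 0 < ((y : ℂ) * Complex.I).im := fun y hy => by simpa using hy
  -- no mass at the point corresponding to infinity
  set one : sphere (0 : ℂ) 1 := ⟨1, by simp⟩ with hone
  have hKone : ∀ z : ℂ, 0 < z.im → K z one = z := fun z hz => cayley_kernel_one (hzI z hz)
  have hKim0 : ∀ y : ℝ, 0 < y → ∀ ζ, 0 ≤ (K (y * Complex.I) ζ).im := by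
    intro y hy ζ
    by_cases h : (ζ : ℂ) = 1
    · have : ζ = one := Subtype.ext h
      rw [this, hKone _ (hyI y hy)]
      simpa using hy.le
    · rw [hKT _ (hyI y hy) ζ h, him_ker y hy]
      positivity
  have hφim : ∀ y : ℝ, 0 < y → (φ (y * Complex.I)).im = ∫ ζ, (K (y * Complex.I) ζ).im ∂σ := by
    intro y hy
    have := Complex.imCLM.integral_comp_comm (hKi _ (hyI y hy))
    simp only [Complex.imCLM_apply] at this
    rw [hφK _ (hyI y hy), this]
    simp
  have hyC : ∀ y : ℝ, 1 ≤ y → y * (φ (y * Complex.I)).im ≤ C := fun y hy =>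
    (mul_le_mul_of_nonneg_left ((le_abs_self _).trans (Complex.abs_im_le_norm _))
      (by linarith)).trans (hC y hy)
  have hatom : σ {one} = 0 := by
    -- At the point `one` the kernel is `z` itself, so an atom there adds `y σ{one}` to `Im φ(iy)`,
    -- incompatible with the decay of `φ` as `y` grows.
    have h1 : ∀ y : ℝ, 1 ≤ y → y ^ 2 * σ.real {one} ≤ C := by
      intro y hy
      have hy0 : 0 < y := by linarith
      refine le_trans ?_ (hyC y hy)
      rw [sq, mul_assoc]
      refine mul_le_mul_of_nonneg_left ?_ hy0.le
      rw [hφim y hy0]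
      refine le_trans (le_of_eq ?_) (setIntegral_le_integral (s := {one})
        (hKi _ (hyI y hy0)).im (ae_of_all _ (hKim0 y hy0)))
      rw [Measure.restrict_singleton, integral_smul_measure, integral_dirac, hKone _ (hyI y hy0)]
      simp [measureReal_def, mul_comm]
    rw [← measureReal_eq_zero_iff]
    by_contra hne
    have hpos : 0 < σ.real {one} := lt_of_le_of_ne measureReal_nonneg (Ne.symm hne)
    set y := max 1 (C / σ.real {one} + 1) with hy
    have hy1 : 1 ≤ y := le_max_left _ _
    have h2 := h1 y hy1
    have h3 : C / σ.real {one} + 1 ≤ y := le_max_right _ _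
    have h4 : C / σ.real {one} < y ^ 2 := by nlinarith
    rw [div_lt_iff₀ hpos] at h4
    linarith
  have hae : ∀ᵐ ζ : sphere (0 : ℂ) 1 ∂σ, (ζ : ℂ) ≠ 1 := by
    rw [ae_iff]
    refine measure_mono_null ?_ hatom
    intro ζ hζ
    simp only [Set.mem_ofPred_eq, not_not] at hζ
    exact Subtype.ext hζ
  set τ' : Measure ℝ := σ.map T with hτ'
  have hfin' : IsFiniteMeasure τ' := inferInstance
  have hkm : ∀ z : ℂ, Measurable fun t : ℝ => (1 + (t : ℂ) * z) / ((t : ℂ) - z) := fun z =>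
    Measurable.div (by fun_prop) (by fun_prop)
  have hφτ : ∀ z : ℂ, 0 < z.im → φ z = a + ∫ t : ℝ, (1 + (t : ℂ) * z) / ((t : ℂ) - z) ∂τ' := by
    intro z hz
    rw [hφK z hz, hτ', integral_map hTm.aemeasurable (hkm z).aestronglyMeasurable]
    congr 1
    refine integral_congr_ae ?_
    filter_upwards [hae] with ζ hζ using hKT z hz ζ hζ
  have hcut : ∀ y : ℝ, 1 ≤ y → Integrable (fun t => (1 + t ^ 2) * (y ^ 2 / (t ^ 2 + y ^ 2))) τ' ∧
      ∫ t, (1 + t ^ 2) * (y ^ 2 / (t ^ 2 + y ^ 2)) ∂τ' ≤ C := by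
    intro y hy
    have hy0 : 0 < y := by linarith
    refine ⟨(integrable_const (1 + y ^ 2)).mono'
      (Measurable.aestronglyMeasurable (by fun_prop)) (ae_of_all _ fun t => ?_), ?_⟩
    · rw [Real.norm_of_nonneg (by positivity), ← mul_div_assoc, div_le_iff₀ (by positivity)]
      nlinarith [sq_nonneg t, sq_nonneg (y ^ 2)]
    · refine le_trans (le_of_eq ?_) (hyC y hy)
      rw [hφim y hy0, hτ', integral_map hTm.aemeasurable
        (Measurable.aestronglyMeasurable (by fun_prop)), ← integral_const_mul]
      refine integral_congr_ae ?_
      filter_upwards [hae] with ζ hζ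
      rw [hKT _ (hyI y hy0) ζ hζ, him_ker y hy0]
      field_simp
  -- The quantity `y Im φ(iy)` is the integral of `1 + t²` against the cutoff, so the assumed decay
  -- and Fatou's lemma give a second moment.
  have hint : Integrable (fun t : ℝ => 1 + t ^ 2) τ' :=
    integrable_of_cutoff_integral_le (by fun_prop) (fun t => by positivity)
      ((eventually_ge_atTop 1).mono hcut)
  have hintt : Integrable (fun t : ℝ => (t : ℂ)) τ' := by
    refine hint.mono' (Measurable.aestronglyMeasurable (by fun_prop)) (ae_of_all _ fun t => ?_)
    simp only [Complex.norm_real, Real.norm_eq_abs]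
    rw [abs_le]
    constructor <;> nlinarith [sq_nonneg (t - 1), sq_nonneg (t + 1)]
  refine ⟨τ'.withDensity fun t => ENNReal.ofReal (1 + t ^ 2),
    isFiniteMeasure_withDensity_ofReal hint.2, ?_⟩
  set τ := τ'.withDensity fun t => ENNReal.ofReal (1 + t ^ 2) with hτ
  have hτf : IsFiniteMeasure τ := isFiniteMeasure_withDensity_ofReal hint.2
  have hG : ∀ z : ℂ, 0 < z.im →
      φ z = ((a : ℂ) - ∫ t : ℝ, (t : ℂ) ∂τ') + -cauchyTransform τ z := by
    intro z hz
    have h1 : cauchyTransform τ z = ∫ t : ℝ, ((1 + t ^ 2 : ℝ) : ℂ) / (z - t) ∂τ' := by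
      rw [cauchyTransform, hτ, integral_withDensity_eq_integral_toReal_smul (by fun_prop) (by simp)]
      refine integral_congr_ae (ae_of_all _ fun t => ?_)
      simp only [ENNReal.toReal_ofReal (by positivity : (0 : ℝ) ≤ 1 + t ^ 2), Complex.real_smul]
      ring
    have hi : Integrable (fun t : ℝ => ((1 + t ^ 2 : ℝ) : ℂ) / (z - t)) τ' :=
      integrable_div_sub hz hint.ofReal
    rw [hφτ z hz, h1]
    -- The density `1 + t²` is absorbed into the measure `τ`, leaving the Stieltjes kernel and a
    -- constant.
    have h2 : ∀ t : ℝ, (1 + (t : ℂ) * z) / ((t : ℂ) - z)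
        = -(((1 + t ^ 2 : ℝ) : ℂ) / (z - t)) - t := by
      intro t
      have h3 := htz z hz t
      have h4 := sub_ofReal_ne_zero hz t
      push_cast
      field_simp
      ring
    simp_rw [h2]
    have h5 := integral_sub hi.neg hintt
    simp only [Pi.neg_apply, integral_neg] at h5
    rw [h5]
    ring
  -- Both `φ` and the Cauchy transform are `O(1 / y)` on the imaginary axis, so the constant between
  -- them vanishes.
  have hzero : (a : ℂ) - ∫ t : ℝ, (t : ℂ) ∂τ' = 0 := by
    set b := (a : ℂ) - ∫ t : ℝ, (t : ℂ) ∂τ' with hb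
    have h1 : ∀ y : ℝ, 1 ≤ y → y * ‖b‖ ≤ C + τ.real Set.univ := by
      intro y hy
      have hy0 : 0 < y := by linarith
      have h2 : b = φ (y * Complex.I) + cauchyTransform τ (y * Complex.I) := by
        rw [hG _ (hyI y hy0)]; ring
      have h3 := norm_cauchyTransform_le (σ := τ) (hyI y hy0)
      have h4 : ((y : ℂ) * Complex.I).im = y := by simp
      rw [h4, le_div_iff₀ hy0] at h3
      have h5 := hC y hy
      have h6 : ‖b‖ ≤ ‖φ (y * Complex.I)‖ + ‖cauchyTransform τ (y * Complex.I)‖ := by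
        rw [h2]; exact norm_add_le _ _
      nlinarith
    by_contra hne
    have hpos : 0 < ‖b‖ := norm_pos_iff.2 hne
    set y := max 1 ((C + τ.real Set.univ) / ‖b‖ + 1) with hy
    have h2 := h1 y (le_max_left _ _)
    have h3 : (C + τ.real Set.univ) / ‖b‖ < y :=
      lt_of_lt_of_le (by linarith) (le_max_right _ _)
    rw [div_lt_iff₀ hpos] at h3
    linarith
  intro z hz
  rw [hG z hz, hzero, zero_add]

end MonotoneCLT

namespace MonotoneCLT

open Filter Topology Polynomial Asymptotics

/-! ### Asymptotics along the imaginary axis -/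

lemma ofReal_mul_I_im_pos {y : ℝ} (hy : 0 < y) : 0 < ((y : ℂ) * Complex.I).im := by simpa using hy

lemma ofReal_mul_I_ne_zero {y : ℝ} (hy : 0 < y) : (y : ℂ) * Complex.I ≠ 0 :=
  mul_ne_zero (by exact_mod_cast hy.ne') Complex.I_ne_zero

lemma norm_ofReal_mul_I {y : ℝ} (hy : 0 < y) : ‖(y : ℂ) * Complex.I‖ = y := by
  simp [abs_of_pos hy]

lemma norm_mul_I_div_sub_le {y : ℝ} (hy : 0 < y) (t : ℝ) :
    ‖(y : ℂ) * Complex.I / (y * Complex.I - t)‖ ≤ 1 := by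
  have h := norm_div_sub_le (ofReal_mul_I_im_pos hy) ((y : ℂ) * Complex.I) t
  rw [norm_ofReal_mul_I hy] at h
  simpa [hy.ne'] using h

lemma measurable_mul_I_div_sub (y : ℝ) :
    Measurable fun t : ℝ => (y : ℂ) * Complex.I / (y * Complex.I - t) := by
  simp only [div_eq_mul_inv]
  fun_prop

lemma re_mul_I_div_sub (y t : ℝ) :
    ((y : ℂ) * Complex.I / (y * Complex.I - t)).re = y ^ 2 / (t ^ 2 + y ^ 2) := by
  rw [Complex.div_re]
  simp [Complex.normSq_apply]
  ring

lemma tendsto_inv_mul_I : Tendsto (fun y : ℝ => ((y : ℂ) * Complex.I)⁻¹) atTop (𝓝 0) := by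
  rw [tendsto_zero_iff_norm_tendsto_zero]
  refine tendsto_inv_atTop_zero.congr' ?_
  filter_upwards [eventually_gt_atTop 0] with y hy
  rw [norm_inv, norm_ofReal_mul_I hy]

lemma integrable_mul_resolvent {σ : Measure ℝ} {g : ℝ → ℂ} (hg : Integrable g σ) {y : ℝ}
    (hy : 0 < y) : Integrable (fun t : ℝ => g t * ((y : ℂ) * Complex.I / (y * Complex.I - t))) σ := by
  refine hg.norm.mono' (hg.aestronglyMeasurable.mul
    (measurable_mul_I_div_sub y).aestronglyMeasurable) (ae_of_all _ fun t => ?_)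
  rw [norm_mul]
  exact mul_le_of_le_one_right (norm_nonneg _) (norm_mul_I_div_sub_le hy t)

lemma norm_integral_mul_resolvent_le {σ : Measure ℝ} {g : ℝ → ℂ} (hg : Integrable g σ) {y : ℝ}
    (hy : 0 < y) :
    ‖∫ t : ℝ, g t * ((y : ℂ) * Complex.I / (y * Complex.I - t)) ∂σ‖ ≤ ∫ t, ‖g t‖ ∂σ := by
  refine norm_integral_le_of_norm_le hg.norm (ae_of_all _ fun t => ?_)
  rw [norm_mul]
  exact mul_le_of_le_one_right (norm_nonneg _) (norm_mul_I_div_sub_le hy t)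

lemma tendsto_integral_mul_resolvent {σ : Measure ℝ} {g : ℝ → ℂ} (hg : Integrable g σ) :
    Tendsto (fun y : ℝ => ∫ t : ℝ, g t * ((y : ℂ) * Complex.I / (y * Complex.I - t)) ∂σ) atTop
      (𝓝 (∫ t, g t ∂σ)) := by
  refine tendsto_integral_filter_of_dominated_convergence (fun t => ‖g t‖) ?_ ?_ hg.norm ?_
  · exact Eventually.of_forall fun y => hg.aestronglyMeasurable.mul
      (measurable_mul_I_div_sub y).aestronglyMeasurable
  · filter_upwards [eventually_gt_atTop 0] with y hy
    refine ae_of_all _ fun t => ?_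
    rw [norm_mul]
    exact mul_le_of_le_one_right (norm_nonneg _) (norm_mul_I_div_sub_le hy t)
  · refine ae_of_all _ fun t => ?_
    have h1 : Tendsto (fun y : ℝ => g t * (1 - (t : ℂ) * ((y : ℂ) * Complex.I)⁻¹)⁻¹) atTop
        (𝓝 (g t * (1 - (t : ℂ) * 0)⁻¹)) := by
      refine tendsto_const_nhds.mul (Tendsto.inv₀ ?_ (by norm_num))
      exact tendsto_const_nhds.sub (tendsto_const_nhds.mul tendsto_inv_mul_I)
    simp only [mul_zero, sub_zero, inv_one, mul_one] at h1
    refine h1.congr' ?_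
    filter_upwards [eventually_gt_atTop 0] with y hy
    have h2 := ofReal_mul_I_ne_zero hy
    have h3 := sub_ofReal_ne_zero (ofReal_mul_I_im_pos hy) t
    have h4 : 1 - (t : ℂ) * ((y : ℂ) * Complex.I)⁻¹ = (y * Complex.I - t) / (y * Complex.I) := by
      rw [eq_div_iff h2, sub_mul, mul_assoc, inv_mul_cancel₀ h2, one_mul, mul_one]
    rw [h4, inv_div]

lemma mul_cauchyTransform_eq (σ : Measure ℝ) (y : ℝ) :
    (y : ℂ) * Complex.I * cauchyTransform σ (y * Complex.I)
      = ∫ t : ℝ, (1 : ℂ) * ((y : ℂ) * Complex.I / (y * Complex.I - t)) ∂σ := by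
  rw [cauchyTransform, ← integral_const_mul]
  refine integral_congr_ae (ae_of_all _ fun t => ?_)
  simp only []
  ring

lemma tendsto_mul_cauchyTransform (σ : Measure ℝ) [IsFiniteMeasure σ] :
    Tendsto (fun y : ℝ => (y : ℂ) * Complex.I * cauchyTransform σ (y * Complex.I)) atTop
      (𝓝 (σ.real Set.univ)) := by
  simp_rw [mul_cauchyTransform_eq]
  simpa using tendsto_integral_mul_resolvent (σ := σ) (integrable_const (1 : ℂ))

lemma re_mul_cauchyTransform (σ : Measure ℝ) [IsFiniteMeasure σ] {y : ℝ} (hy : 0 < y) :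
    ((y : ℂ) * Complex.I * cauchyTransform σ (y * Complex.I)).re
      = ∫ t : ℝ, y ^ 2 / (t ^ 2 + y ^ 2) ∂σ := by
  rw [mul_cauchyTransform_eq]
  have h := Complex.reCLM.integral_comp_comm
    (integrable_mul_resolvent (σ := σ) (integrable_const (1 : ℂ)) hy)
  simp only [Complex.reCLM_apply, one_mul] at h
  simp only [one_mul]
  rw [← h]
  exact integral_congr_ae (ae_of_all _ fun t => re_mul_I_div_sub y t)

lemma integrable_pow_of_le {σ : Measure ℝ} [IsFiniteMeasure σ] {j N : ℕ} (hj : j ≤ N)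
    (h : Integrable (fun t : ℝ => t ^ N) σ) : Integrable (fun t : ℝ => t ^ j) σ := by
  refine ((integrable_const (1 : ℝ)).add h.norm).mono' (by fun_prop) (ae_of_all _ fun t => ?_)
  simp only [Pi.add_apply, norm_pow, Real.norm_eq_abs]
  rcases le_total |t| 1 with h1 | h1
  · have := pow_le_one₀ (n := j) (abs_nonneg t) h1
    have := pow_nonneg (abs_nonneg t) N
    linarith
  · have := pow_le_pow_right₀ h1 hj
    linarith

/-! ### Polynomials in a small parameter -/

lemma tendsto_aeval_zero {w : ℝ → ℂ} (hw : Tendsto w atTop (𝓝 0)) (P : ℝ[X]) :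
    Tendsto (fun y => aeval (w y) P) atTop (𝓝 (P.coeff 0 : ℂ)) := by
  have h := ((P.continuous_aeval (A := ℂ)).tendsto 0).comp hw
  rw [← Polynomial.coeff_zero_eq_aeval_zero'] at h
  exact h

lemma aeval_isBigO_of_dvd {w : ℝ → ℂ} (hw : Tendsto w atTop (𝓝 0)) {P : ℝ[X]} {k : ℕ}
    (h : X ^ k ∣ P) : (fun y => aeval (w y) P) =O[atTop] fun y => w y ^ k := by
  obtain ⟨Q, rfl⟩ := h
  have hQ := (tendsto_aeval_zero hw Q).isBigO_one ℂ
  simpa using (isBigO_refl (fun y => w y ^ k) atTop).mul hQ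

/-- Factor out the exact power of `X`; the cofactor tends to its nonzero constant term, so smallness
can only come from that power. This is uniqueness of asymptotic expansions. -/
lemma X_pow_dvd_of_isLittleO {w : ℝ → ℂ} (hw : Tendsto w atTop (𝓝 0))
    (hne : ∀ᶠ y in atTop, w y ≠ 0) {P : ℝ[X]} {k : ℕ}
    (h : (fun y => aeval (w y) P) =o[atTop] fun y => w y ^ k) : X ^ (k + 1) ∣ P := by
  by_cases hP : P = 0
  · simp [hP]
  obtain ⟨Q, hPQ, hQ⟩ := P.exists_eq_pow_rootMultiplicity_mul_and_not_dvd hP 0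
  set j := P.rootMultiplicity 0
  rw [C_0, sub_zero] at hPQ hQ
  rw [X_dvd_iff] at hQ
  rcases lt_or_ge k j with hkj | hkj
  · rw [hPQ]
    exact (pow_dvd_pow X hkj).mul_right Q
  · exfalso
    have h1 : (fun y => w y ^ k) =O[atTop] fun y => w y ^ j := by
      have h2 : (fun y => w y ^ (k - j)) =O[atTop] fun _ => (1 : ℂ) :=
        (hw.pow (k - j)).isBigO_one ℂ
      have h3 := (isBigO_refl (fun y => w y ^ j) atTop).mul h2
      simpa [← pow_add, Nat.add_sub_cancel' hkj] using h3
    have h2 := h.trans_isBigO h1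
    rw [hPQ] at h2
    have h3 : (fun y => aeval (w y) Q) =o[atTop] fun _ => (1 : ℂ) := by
      rw [isLittleO_one_iff]
      have h4 := h2.tendsto_div_nhds_zero
      refine h4.congr' ?_
      filter_upwards [hne] with y hy
      simp [hy]
    rw [isLittleO_one_iff] at h3
    have := tendsto_nhds_unique h3 (tendsto_aeval_zero hw Q)
    exact hQ (by exact_mod_cast this.symm)

/-- `f` is, along the positive imaginary axis, a real polynomial in `1 / z` up to an error
`O(|z|⁻ᴺ)`. -/
def HasRealExpansion (f : ℝ → ℂ) (N : ℕ) (p : ℝ[X]) : Prop :=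
  (fun y : ℝ => f y - aeval ((y : ℂ) * Complex.I)⁻¹ p) =O[atTop]
    fun y : ℝ => (((y : ℂ) * Complex.I)⁻¹) ^ N

lemma HasRealExpansion.tendsto {f : ℝ → ℂ} {N : ℕ} {p : ℝ[X]} (h : HasRealExpansion f N p)
    (hN : N ≠ 0) : Tendsto f atTop (𝓝 (p.coeff 0 : ℂ)) := by
  have h1 := h.trans_tendsto (by simpa [hN] using tendsto_inv_mul_I.pow N)
  simpa using h1.add (tendsto_aeval_zero tendsto_inv_mul_I p)

/-- A nonzero constant term makes `p` coprime to `X ^ N`. In a Bézout relation `a p + b X ^ N = 1`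
the polynomial `a` is a truncated inverse, and `1 - a f = b X ^ N - a (f - p)` is the error. -/
lemma HasRealExpansion.inv {f : ℝ → ℂ} {N : ℕ} {p : ℝ[X]} (h : HasRealExpansion f N p)
    (hN : N ≠ 0) (hp : p.coeff 0 ≠ 0) : ∃ q : ℝ[X], HasRealExpansion (fun y => (f y)⁻¹) N q := by
  have hcop : IsCoprime p (X ^ N) := by
    refine IsCoprime.pow_right (IsCoprime.symm ?_)
    rw [irreducible_X.coprime_iff_not_dvd, X_dvd_iff]
    exact hp
  obtain ⟨a, b, hab⟩ := hcop
  refine ⟨a, ?_⟩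
  have hft := h.tendsto hN
  have hp' : (p.coeff 0 : ℂ) ≠ 0 := by exact_mod_cast hp
  have hinv : (fun y => (f y)⁻¹) =O[atTop] fun _ => (1 : ℂ) := (hft.inv₀ hp').isBigO_one ℂ
  have hb := (aeval_isBigO_of_dvd tendsto_inv_mul_I (dvd_mul_left (X ^ N) b))
  have ha := ((tendsto_aeval_zero tendsto_inv_mul_I a).isBigO_one ℂ).mul h
  simp only [one_mul] at ha
  have hm := (hb.sub ha).mul hinv
  simp only [mul_one] at hm
  refine hm.congr' ?_ EventuallyEq.rfl
  filter_upwards [hft.eventually_ne hp'] with y hy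
  have h1 := congrArg (aeval ((y : ℂ) * Complex.I)⁻¹) hab
  simp only [map_add, map_mul, map_one] at h1 ⊢
  generalize ((y : ℂ) * Complex.I)⁻¹ = u at h1 ⊢
  field_simp
  linear_combination h1

/-- Odd powers of `1 / (iy)` are purely imaginary and even ones are powers of `-1 / y²`; the
coefficients must be real for this. -/
lemma exists_eval_eq_re_aeval (p : ℝ[X]) :
    ∃ q : ℝ[X], ∀ y : ℝ, (aeval ((y : ℂ) * Complex.I)⁻¹ p).re = q.eval ((y ^ 2)⁻¹) := by
  induction p using Polynomial.induction_on' with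
  | add p p' hp hp' =>
    obtain ⟨q, hq⟩ := hp
    obtain ⟨q', hq'⟩ := hp'
    exact ⟨q + q', fun y => by rw [map_add, Complex.add_re, hq, hq', eval_add]⟩
  | monomial n a =>
    have hsq : ∀ y : ℝ, (((y : ℂ) * Complex.I)⁻¹) ^ 2 = ((-(y ^ 2)⁻¹ : ℝ) : ℂ) := by
      intro y
      rw [inv_pow, mul_pow, Complex.I_sq]
      push_cast
      rw [mul_neg_one, inv_neg]
    rcases Nat.even_or_odd' n with ⟨m, rfl | rfl⟩
    · refine ⟨monomial m (a * (-1) ^ m), fun y => ?_⟩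
      rw [aeval_monomial, pow_mul, hsq, ← Complex.ofReal_pow, eval_monomial]
      simp only [Complex.coe_algebraMap, ← Complex.ofReal_mul, Complex.ofReal_re]
      rw [neg_pow, mul_assoc]
    · refine ⟨0, fun y => ?_⟩
      rw [aeval_monomial, pow_add, pow_mul, hsq, ← Complex.ofReal_pow]
      simp only [Complex.coe_algebraMap, ← mul_assoc, ← Complex.ofReal_mul, pow_one,
        Complex.re_ofReal_mul]
      simp

end MonotoneCLT

namespace MonotoneCLT

open Filter Topology Polynomial Asymptotics

/-! ### Moments and real expansions -/

/-- Integrate the finite geometric expansion of `z / (z - t)` in `t / z`. The remainder carries the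
factor `z / (z - t)`, of modulus at most 1 on the imaginary axis. -/
lemma hasRealExpansion_of_integrable_pow {σ : Measure ℝ} [IsFiniteMeasure σ] {N : ℕ}
    (h : Integrable (fun t : ℝ => t ^ N) σ) :
    HasRealExpansion (fun y => (y : ℂ) * Complex.I * cauchyTransform σ (y * Complex.I)) N
      (∑ j ∈ Finset.range N, C (∫ t, t ^ j ∂σ) * X ^ j) := by
  refine IsBigO.of_bound (∫ t, ‖((t ^ N : ℝ) : ℂ)‖ ∂σ) ?_
  filter_upwards [eventually_gt_atTop 0] with y hy
  set z : ℂ := (y : ℂ) * Complex.I with hz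
  have hz0 : z ≠ 0 := ofReal_mul_I_ne_zero hy
  have hint : ∀ j ∈ Finset.range N, Integrable (fun t : ℝ => ((t ^ j : ℝ) : ℂ) * z⁻¹ ^ j) σ :=
    fun j hj => (integrable_pow_of_le (Finset.mem_range.1 hj).le h).ofReal.mul_const _
  have hpt : ∀ t : ℝ, (1 : ℂ) * (z / (z - t))
      = ∑ j ∈ Finset.range N, ((t ^ j : ℝ) : ℂ) * z⁻¹ ^ j
        + z⁻¹ ^ N * (((t ^ N : ℝ) : ℂ) * (z / (z - t))) := by
    intro t
    have h1 : z - t ≠ 0 := sub_ofReal_ne_zero (ofReal_mul_I_im_pos hy) t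
    have h2 := geom_sum_mul ((t : ℂ) * z⁻¹) N
    have h3 : ∑ j ∈ Finset.range N, ((t ^ j : ℝ) : ℂ) * z⁻¹ ^ j
        = ∑ j ∈ Finset.range N, ((t : ℂ) * z⁻¹) ^ j := by
      refine Finset.sum_congr rfl fun j _ => ?_
      push_cast
      rw [mul_pow]
    rw [h3]
    have h4 : (t : ℂ) * z⁻¹ - 1 = -((z - t) / z) := by
      field_simp
      ring
    rw [h4, mul_pow] at h2
    push_cast
    set S := ∑ j ∈ Finset.range N, ((t : ℂ) * z⁻¹) ^ j
    have h5 : S = (1 - (t : ℂ) ^ N * z⁻¹ ^ N) * (z / (z - t)) := by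
      rw [← neg_sub, ← h2]
      field_simp
    rw [h5]
    ring
  have hrem : Integrable (fun t : ℝ => z⁻¹ ^ N * (((t ^ N : ℝ) : ℂ) * (z / (z - t)))) σ :=
    (integrable_mul_resolvent h.ofReal hy).const_mul _
  rw [mul_cauchyTransform_eq]
  simp_rw [← hz, hpt]
  rw [integral_add (integrable_finsetSum _ hint) hrem, integral_finsetSum _ hint,
    integral_const_mul]
  have h6 : aeval z⁻¹ (∑ j ∈ Finset.range N, C (∫ t, t ^ j ∂σ) * X ^ j)
      = ∑ j ∈ Finset.range N, ∫ t : ℝ, ((t ^ j : ℝ) : ℂ) * z⁻¹ ^ j ∂σ := by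
    rw [map_sum]
    refine Finset.sum_congr rfl fun j _ => ?_
    rw [integral_mul_const, integral_complex_ofReal]
    simp
  rw [h6, add_sub_cancel_left, norm_mul, mul_comm]
  exact mul_le_mul_of_nonneg_right (norm_integral_mul_resolvent_le h.ofReal hy) (norm_nonneg _)

/-- The finite geometric sum with ratio `-t² / y²`. -/
lemma cutoff_expansion (t : ℝ) {y : ℝ} (hy : 0 < y) (k : ℕ) :
    y ^ 2 / (t ^ 2 + y ^ 2) = ∑ j ∈ Finset.range (k + 1), ((-1) ^ j * (y ^ 2)⁻¹ ^ j) * t ^ (2 * j)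
      + ((-1) ^ (k + 1) * (y ^ 2)⁻¹ ^ (k + 1)) * (t ^ (2 * (k + 1)) * (y ^ 2 / (t ^ 2 + y ^ 2))) := by
  have hn : t ^ 2 + y ^ 2 ≠ 0 := by positivity
  have h2 := geom_sum_mul (-(t ^ 2 * (y ^ 2)⁻¹)) (k + 1)
  have h3 : ∑ j ∈ Finset.range (k + 1), ((-1) ^ j * (y ^ 2)⁻¹ ^ j) * t ^ (2 * j)
      = ∑ j ∈ Finset.range (k + 1), (-(t ^ 2 * (y ^ 2)⁻¹)) ^ j := by
    refine Finset.sum_congr rfl fun j _ => ?_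
    rw [neg_pow (t ^ 2 * (y ^ 2)⁻¹), mul_pow, pow_mul]
    ring
  rw [h3]
  have h4 : -(t ^ 2 * (y ^ 2)⁻¹) - 1 = -((t ^ 2 + y ^ 2) / y ^ 2) := by
    field_simp
    ring
  rw [h4, neg_pow (t ^ 2 * (y ^ 2)⁻¹), mul_pow, ← pow_mul] at h2
  set S := ∑ j ∈ Finset.range (k + 1), (-(t ^ 2 * (y ^ 2)⁻¹)) ^ j
  have h5 : S = (1 - (-1) ^ (k + 1) * (t ^ (2 * (k + 1)) * (y ^ 2)⁻¹ ^ (k + 1)))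
      * (y ^ 2 / (t ^ 2 + y ^ 2)) := by
    rw [← neg_sub, ← h2]
    field_simp
  rw [h5]
  ring

/-- A real expansion of `Re (z G_τ(z))` along the imaginary axis up to `O(|z|^{-2k})` forces the
`2k`-th moment of `τ` to be finite. -/
lemma integrable_pow_of_re_expansion {τ : Measure ℝ} [IsFiniteMeasure τ] (k : ℕ) {q : ℝ[X]}
    (h : (fun y : ℝ => ∫ t : ℝ, y ^ 2 / (t ^ 2 + y ^ 2) ∂τ - q.eval ((y ^ 2)⁻¹)) =O[atTop]
      fun y : ℝ => ((y ^ 2)⁻¹) ^ k) : Integrable (fun t : ℝ => t ^ (2 * k)) τ := by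
  induction k with
  | zero => simp
  | succ k ih =>
    have hv : Tendsto (fun y : ℝ => (y ^ 2)⁻¹) atTop (𝓝 0) :=
      (tendsto_pow_atTop two_ne_zero).inv_tendsto_atTop
    have hv' : (fun y : ℝ => ((y ^ 2)⁻¹) ^ (k + 1)) =o[atTop] fun y : ℝ => ((y ^ 2)⁻¹) ^ k := by
      have h1 : (fun y : ℝ => (y ^ 2)⁻¹) =o[atTop] fun _ => (1 : ℝ) := by
        rwa [isLittleO_one_iff]
      refine ((isBigO_refl (fun y : ℝ => ((y ^ 2)⁻¹) ^ k) atTop).mul_isLittleO h1).congr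
        (fun y => (pow_succ _ _).symm) fun y => mul_one _
    have hk := ih (h.trans hv'.isBigO)
    have hkj : ∀ j ∈ Finset.range (k + 1), Integrable (fun t : ℝ => t ^ (2 * j)) τ := fun j hj =>
      integrable_pow_of_le (by have := Finset.mem_range.1 hj; omega) hk
    set g : ℝ → ℝ := fun t => t ^ (2 * (k + 1)) with hg
    have hg0 : ∀ t, 0 ≤ g t := fun t => by simp only [hg, pow_mul]; positivity
    set E : ℝ → ℝ := fun y => ∫ t, g t * (y ^ 2 / (t ^ 2 + y ^ 2)) ∂τ with hE
    have hbound : ∀ y : ℝ, 0 < y → ∀ t : ℝ, g t * (y ^ 2 / (t ^ 2 + y ^ 2)) ≤ y ^ 2 * t ^ (2 * k) := by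
      intro y hy t
      have h1 : g t = t ^ (2 * k) * t ^ 2 := by simp only [hg]; ring
      have h2 : 0 ≤ t ^ (2 * k) := by rw [pow_mul]; positivity
      have h3 : t ^ 2 * (y ^ 2 / (t ^ 2 + y ^ 2)) ≤ y ^ 2 := by
        rw [← mul_div_assoc, div_le_iff₀ (by positivity)]
        nlinarith [sq_nonneg (y ^ 2)]
      rw [h1, mul_assoc, mul_comm (y ^ 2)]
      exact mul_le_mul_of_nonneg_left h3 h2
    have hEi : ∀ y : ℝ, 0 < y → Integrable (fun t => g t * (y ^ 2 / (t ^ 2 + y ^ 2))) τ := by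
      intro y hy
      refine (hk.const_mul (y ^ 2)).mono' (Measurable.aestronglyMeasurable (by fun_prop))
        (ae_of_all _ fun t => ?_)
      rw [Real.norm_of_nonneg (mul_nonneg (hg0 t) (by positivity))]
      exact hbound y hy t
    set P : ℝ[X] := ∑ j ∈ Finset.range (k + 1), C ((-1) ^ j * ∫ t, t ^ (2 * j) ∂τ) * X ^ j with hP
    have hexp : ∀ y : ℝ, 0 < y → ∫ t : ℝ, y ^ 2 / (t ^ 2 + y ^ 2) ∂τ
        = P.eval ((y ^ 2)⁻¹) + (-1) ^ (k + 1) * ((y ^ 2)⁻¹) ^ (k + 1) * E y := by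
      intro y hy
      have h1 : ∫ t : ℝ, y ^ 2 / (t ^ 2 + y ^ 2) ∂τ
          = ∫ t : ℝ, (∑ j ∈ Finset.range (k + 1), ((-1) ^ j * (y ^ 2)⁻¹ ^ j) * t ^ (2 * j)
      + ((-1) ^ (k + 1) * (y ^ 2)⁻¹ ^ (k + 1)) * (g t * (y ^ 2 / (t ^ 2 + y ^ 2)))) ∂τ :=
        integral_congr_ae (ae_of_all _ fun t => cutoff_expansion t hy k)
      rw [h1, integral_add (integrable_finsetSum _ fun j hj => (hkj j hj).const_mul _)
        ((hEi y hy).const_mul _), integral_finsetSum _ fun j hj => (hkj j hj).const_mul _,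
        integral_const_mul, hP, eval_finsetSum]
      congr 1
      refine Finset.sum_congr rfl fun j _ => ?_
      rw [integral_const_mul]
      simp
      ring
    -- Dominated convergence with the moment of order `2k` known by induction. This weak bound
    -- suffices to match the expansions `P` and `q` through degree `k`.
    have hvE : Tendsto (fun y : ℝ => (y ^ 2)⁻¹ * E y) atTop (𝓝 0) := by
      have h1 : Tendsto (fun y : ℝ => ∫ t, (y ^ 2)⁻¹ * (g t * (y ^ 2 / (t ^ 2 + y ^ 2))) ∂τ) atTop
          (𝓝 (∫ _, (0 : ℝ) ∂τ)) := by
        refine tendsto_integral_filter_of_dominated_convergence (fun t => t ^ (2 * k)) ?_ ?_ hk ?_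
        · exact Eventually.of_forall fun y => Measurable.aestronglyMeasurable (by fun_prop)
        · filter_upwards [eventually_gt_atTop 0] with y hy
          refine ae_of_all _ fun t => ?_
          rw [Real.norm_of_nonneg (mul_nonneg (by positivity) (mul_nonneg (hg0 t) (by positivity))),
            inv_mul_le_iff₀ (by positivity)]
          exact hbound y hy t
        · refine ae_of_all _ fun t => ?_
          simpa using hv.mul ((tendsto_cutoff t).const_mul (g t))
      simp only [integral_const_mul, integral_zero] at h1
      exact h1
    set w : ℝ → ℂ := fun y => (((y ^ 2)⁻¹ : ℝ) : ℂ) with hw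
    have hw0 : Tendsto w atTop (𝓝 0) := by
      rw [← Complex.ofReal_zero]
      exact (Complex.continuous_ofReal.tendsto 0).comp hv
    have hwne : ∀ᶠ y in atTop, w y ≠ 0 := by
      filter_upwards [eventually_gt_atTop 0] with y hy
      simp [hw, hy.ne']
    have haev : ∀ (R : ℝ[X]) (y : ℝ), aeval (w y) R = ((R.eval ((y ^ 2)⁻¹) : ℝ) : ℂ) := fun R y => by
      simp only [hw]
      rw [← Complex.coe_algebraMap, aeval_algebraMap_apply, coe_aeval_eq_eval]
    have hwn : ∀ y, ‖w y‖ = ‖(y ^ 2)⁻¹‖ := fun y => by simp [hw]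
    have hrem : (fun y : ℝ => (-1) ^ (k + 1) * ((y ^ 2)⁻¹) ^ (k + 1) * E y) =o[atTop]
        fun y : ℝ => ((y ^ 2)⁻¹) ^ k := by
      have h1 : (fun y : ℝ => (y ^ 2)⁻¹ * E y) =o[atTop] fun _ => (1 : ℝ) := by
        rwa [isLittleO_one_iff]
      have h2 := ((isBigO_refl (fun y : ℝ => ((y ^ 2)⁻¹) ^ k) atTop).mul_isLittleO h1).const_mul_left
        ((-1 : ℝ) ^ (k + 1))
      refine (h2.congr_left fun y => ?_).congr_right fun y => ?_
      · ring
      · ring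
    have hdiff : (fun y : ℝ => (P - q).eval ((y ^ 2)⁻¹)) =o[atTop] fun y : ℝ => ((y ^ 2)⁻¹) ^ k := by
      refine ((h.trans_isLittleO hv').sub hrem).congr' ?_ EventuallyEq.rfl
      filter_upwards [eventually_gt_atTop 0] with y hy
      rw [hexp y hy, eval_sub]
      ring
    have hdvd : X ^ (k + 1) ∣ P - q := by
      refine X_pow_dvd_of_isLittleO hw0 hwne ?_
      rw [← isLittleO_norm_norm] at hdiff ⊢
      simpa only [haev, norm_pow, hwn, Complex.norm_real] using hdiff
    have hO := aeval_isBigO_of_dvd hw0 hdvd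
    have hO' : (fun y : ℝ => (P - q).eval ((y ^ 2)⁻¹)) =O[atTop]
        fun y : ℝ => ((y ^ 2)⁻¹) ^ (k + 1) := by
      rw [← isBigO_norm_norm] at hO ⊢
      simpa only [haev, norm_pow, hwn, Complex.norm_real] using hO
    -- Once `P - q` is divisible by `X ^ (k + 1)`, the remainder has the order of the assumed error.
    -- Hence the truncated moments stay bounded.
    have hEO : E =O[atTop] fun _ => (1 : ℝ) := by
      have h1 : (fun y : ℝ => (-1) ^ (k + 1) * ((y ^ 2)⁻¹) ^ (k + 1) * E y) =O[atTop]
          fun y : ℝ => ((y ^ 2)⁻¹) ^ (k + 1) := by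
        refine (h.sub hO').congr' ?_ EventuallyEq.rfl
        filter_upwards [eventually_gt_atTop 0] with y hy
        rw [hexp y hy, eval_sub]
        ring
      have h2 := h1.mul (isBigO_refl (fun y : ℝ => (-1) ^ (k + 1) * (y ^ 2) ^ (k + 1)) atTop)
      have h3 : (fun y : ℝ => ((y ^ 2)⁻¹) ^ (k + 1) * ((-1) ^ (k + 1) * (y ^ 2) ^ (k + 1)))
          =O[atTop] fun _ => (1 : ℝ) := by
        refine IsBigO.of_bound 1 ?_
        filter_upwards [eventually_gt_atTop 0] with y hy
        have : ((y ^ 2)⁻¹) ^ (k + 1) * ((-1) ^ (k + 1) * (y ^ 2) ^ (k + 1)) = (-1) ^ (k + 1) := by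
          rw [inv_pow]
          field_simp
        rw [this]
        simp
      refine (h2.trans h3).congr' ?_ EventuallyEq.rfl
      filter_upwards [eventually_gt_atTop 0] with y hy
      have h4 : ((y ^ 2)⁻¹) ^ (k + 1) * (y ^ 2) ^ (k + 1) = 1 := by
        rw [inv_pow, inv_mul_cancel₀ (by positivity)]
      have h5 : ((-1 : ℝ) ^ (k + 1)) * (-1) ^ (k + 1) = 1 := by
        rw [← mul_pow]; simp
      calc _ = ((-1 : ℝ) ^ (k + 1) * (-1) ^ (k + 1))
            * (((y ^ 2)⁻¹) ^ (k + 1) * (y ^ 2) ^ (k + 1)) * E y := by ring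
        _ = E y := by rw [h4, h5]; ring
    obtain ⟨c, hc⟩ := hEO.bound
    refine integrable_of_cutoff_integral_le (C := c) (by fun_prop) hg0 ?_
    filter_upwards [hc, eventually_gt_atTop 0] with y hy hy0
    refine ⟨hEi y hy0, (le_abs_self _).trans ?_⟩
    simpa using hy

lemma HasRealExpansion.integrable_pow {τ : Measure ℝ} [IsFiniteMeasure τ] {k : ℕ} {p : ℝ[X]}
    (h : HasRealExpansion (fun y => (y : ℂ) * Complex.I * cauchyTransform τ (y * Complex.I))
      (2 * k) p) : Integrable (fun t : ℝ => t ^ (2 * k)) τ := by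
  obtain ⟨q, hq⟩ := exists_eval_eq_re_aeval p
  refine integrable_pow_of_re_expansion k (q := q) ?_
  obtain ⟨c, hc⟩ := IsBigO.bound h
  refine IsBigO.of_bound c ?_
  filter_upwards [hc, eventually_gt_atTop 0] with y hy hy0
  rw [← re_mul_cauchyTransform τ hy0, ← hq, ← Complex.sub_re]
  refine (Complex.abs_re_le_norm _).trans (hy.trans (le_of_eq ?_))
  rw [norm_pow, norm_inv, norm_ofReal_mul_I hy0, Real.norm_of_nonneg (by positivity), pow_mul,
    inv_pow]

end MonotoneCLT

namespace MonotoneCLT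

open Filter Topology Polynomial Asymptotics

/-! ### The Nevanlinna measure and its moments -/

lemma isBigO_cauchyTransform (τ : Measure ℝ) [IsFiniteMeasure τ] :
    (fun y : ℝ => cauchyTransform τ (y * Complex.I)) =O[atTop]
      fun y : ℝ => ((y : ℂ) * Complex.I)⁻¹ := by
  refine IsBigO.of_bound (τ.real Set.univ) ?_
  filter_upwards [eventually_gt_atTop 0] with y hy
  have := norm_cauchyTransform_le (σ := τ) (ofReal_mul_I_im_pos hy)
  rw [norm_inv, norm_ofReal_mul_I hy]
  simpa [div_eq_mul_inv] using this

lemma eventually_inv_mul_I_ne_zero : ∀ᶠ y : ℝ in atTop, ((y : ℂ) * Complex.I)⁻¹ ≠ 0 := by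
  filter_upwards [eventually_gt_atTop 0] with y hy using inv_ne_zero (ofReal_mul_I_ne_zero hy)

/-- As `G_τ = O(1 / z)`, the quotient `F_σ / z` is `1 - m / z + O(z⁻²)`. Inverting expands `z G_σ`
to order 2, which forces a second moment. -/
lemma integrable_sq_of_fTransform_eq {σ τ : Measure ℝ} [IsProbabilityMeasure σ] [IsFiniteMeasure τ]
    {m : ℝ} (h : ∀ z : ℂ, 0 < z.im → fTransform σ z = z - m - cauchyTransform τ z) :
    Integrable (fun t : ℝ => t ^ 2) σ := by
  have h1 : HasRealExpansion (fun y => ((y : ℂ) * Complex.I * cauchyTransform σ (y * Complex.I))⁻¹)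
      2 (1 - C m * X) := by
    have h2 : (fun y : ℝ => -(((y : ℂ) * Complex.I)⁻¹ * cauchyTransform τ (y * Complex.I)))
        =O[atTop] fun y : ℝ => ((y : ℂ) * Complex.I)⁻¹ ^ 2 := by
      simpa only [sq] using ((isBigO_refl _ _).mul (isBigO_cauchyTransform τ)).neg_left
    refine h2.congr' ?_ EventuallyEq.rfl
    filter_upwards [eventually_gt_atTop 0] with y hy
    have h3 := h _ (ofReal_mul_I_im_pos hy)
    rw [fTransform_eq, one_div] at h3
    rw [mul_inv _ (cauchyTransform σ _), h3]
    have h4 := ofReal_mul_I_ne_zero hy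
    generalize (y : ℂ) * Complex.I = z at *
    simp only [map_sub, map_one, map_mul, aeval_C, aeval_X, Complex.coe_algebraMap]
    field_simp
    ring
  obtain ⟨q, hq⟩ := h1.inv two_ne_zero (by simp)
  simp only [inv_inv] at hq
  exact HasRealExpansion.integrable_pow (k := 1) hq

/-- Two finite moments of a probability measure are lost on passing to its Nevanlinna measure. -/
lemma integrable_pow_of_fTransform_eq {σ τ : Measure ℝ} [IsProbabilityMeasure σ]
    [IsFiniteMeasure τ] {m : ℝ}
    (h : ∀ z : ℂ, 0 < z.im → fTransform σ z = z - m - cauchyTransform τ z) {k : ℕ}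
    (hk : Integrable (fun t : ℝ => t ^ (2 * k + 2)) σ) : Integrable (fun t : ℝ => t ^ (2 * k)) τ := by
  have hexp := hasRealExpansion_of_integrable_pow hk
  obtain ⟨q, hq⟩ := hexp.inv (by omega) (by
    rw [finsetSum_coeff, Finset.sum_eq_single 0]
    · simp
    · intro b _ hb
      rw [coeff_C_mul_X_pow, if_neg hb.symm]
    · simp)
  set u : ℝ → ℂ := fun y => ((y : ℂ) * Complex.I)⁻¹ with hu
  have hu0 : Tendsto u atTop (𝓝 0) := tendsto_inv_mul_I
  set Z : ℝ → ℂ := fun y => (y : ℂ) * Complex.I * cauchyTransform τ (y * Complex.I) with hZ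
  -- Since `(z G_σ)⁻¹ = F_σ / z`, recovering `Z = z G_τ` costs a division by `u²`; this is where two
  -- moments are lost.
  have hZu : ∀ y : ℝ, 0 < y → Z y * u y ^ 2
      = 1 - m * u y - ((y : ℂ) * Complex.I * cauchyTransform σ (y * Complex.I))⁻¹ := by
    intro y hy
    have h3 := h _ (ofReal_mul_I_im_pos hy)
    rw [fTransform_eq, one_div] at h3
    simp only [hZ, hu]
    rw [mul_inv _ (cauchyTransform σ _), h3]
    have h4 := ofReal_mul_I_ne_zero hy
    generalize (y : ℂ) * Complex.I = z at *
    field_simp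
    ring
  have hZ1 : Z =O[atTop] fun _ => (1 : ℂ) := (tendsto_mul_cauchyTransform τ).isBigO_one ℂ
  have hsplit : ∀ y : ℝ, 0 < y → aeval (u y) (1 - C m * X - q) = Z y * u y ^ 2
      + (((y : ℂ) * Complex.I * cauchyTransform σ (y * Complex.I))⁻¹ - aeval (u y) q) := by
    intro y hy
    rw [hZu y hy]
    simp only [map_sub, map_one, map_mul, aeval_C, aeval_X, Complex.coe_algebraMap]
    ring
  have hpow : (fun y => u y ^ (2 * k + 2)) =O[atTop] fun y => u y ^ 2 := by
    have h1 : (fun y => u y ^ (2 * k)) =O[atTop] fun _ => (1 : ℂ) := (hu0.pow _).isBigO_one ℂ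
    simpa [pow_add] using h1.mul (isBigO_refl (fun y => u y ^ 2) atTop)
  have hP2 : (fun y => aeval (u y) (1 - C m * X - q)) =O[atTop] fun y => u y ^ 2 := by
    have h1 : (fun y => Z y * u y ^ 2) =O[atTop] fun y => u y ^ 2 := by
      simpa using hZ1.mul (isBigO_refl (fun y => u y ^ 2) atTop)
    refine (h1.add (hq.trans hpow)).congr' ?_ EventuallyEq.rfl
    filter_upwards [eventually_gt_atTop 0] with y hy using (hsplit y hy).symm
  have hlit : (fun y => u y ^ 2) =o[atTop] fun y => u y ^ 1 := by
    have h1 : u =o[atTop] fun _ => (1 : ℂ) := by rwa [isLittleO_one_iff]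
    simpa [sq] using (isBigO_refl u atTop).mul_isLittleO h1
  -- The polynomial is `O(u²)` because `Z` is bounded, so the division by `u²` leaves a polynomial.
  obtain ⟨Q, hQ⟩ := X_pow_dvd_of_isLittleO hu0 eventually_inv_mul_I_ne_zero
    (hP2.trans_isLittleO hlit)
  refine HasRealExpansion.integrable_pow (k := k) (p := Q) ?_
  have h1 := hq.neg_left.mul (isBigO_refl (fun y => (u y ^ 2)⁻¹) atTop)
  refine h1.congr' ?_ ?_
  · filter_upwards [eventually_gt_atTop 0, eventually_inv_mul_I_ne_zero] with y hy hne
    have h2 := hsplit y hy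
    rw [hQ] at h2
    simp only [map_mul, map_pow, aeval_X] at h2
    have hne' : u y ≠ 0 := hne
    change -(((y : ℂ) * Complex.I * cauchyTransform σ (y * Complex.I))⁻¹ - aeval (u y) q)
      * (u y ^ 2)⁻¹ = Z y - aeval (u y) Q
    rw [← div_eq_mul_inv, div_eq_iff (pow_ne_zero 2 hne')]
    linear_combination h2
  · filter_upwards [eventually_inv_mul_I_ne_zero] with y hne
    have hne' : u y ≠ 0 := hne
    change u y ^ (2 * k + 2) * (u y ^ 2)⁻¹ = u y ^ (2 * k)
    rw [pow_add, mul_assoc, mul_inv_cancel₀ (pow_ne_zero _ hne'), mul_one]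

/-- The transform `z ↦ ∫ t² z / (z - t) dσ(t)` at `z = iy`. -/
noncomputable def secondMomentTransform (σ : Measure ℝ) (y : ℝ) : ℂ :=
  ∫ t : ℝ, ((t ^ 2 : ℝ) : ℂ) * ((y : ℂ) * Complex.I / (y * Complex.I - t)) ∂σ

lemma mul_cauchyTransform_expansion {σ : Measure ℝ} [IsProbabilityMeasure σ]
    (h2 : Integrable (fun t : ℝ => t ^ 2) σ) {y : ℝ} (hy : 0 < y) :
    (y : ℂ) * Complex.I * cauchyTransform σ (y * Complex.I)
      = 1 + (∫ t, t ∂σ : ℝ) * ((y : ℂ) * Complex.I)⁻¹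
        + ((y : ℂ) * Complex.I)⁻¹ ^ 2 * secondMomentTransform σ y := by
  have h1 : Integrable (fun t : ℝ => t) σ := by
    simpa using integrable_pow_of_le (j := 1) one_le_two h2
  rw [mul_cauchyTransform_eq, secondMomentTransform, ← integral_const_mul,
    ← integral_complex_ofReal, ← integral_mul_const]
  set z : ℂ := (y : ℂ) * Complex.I with hz
  have hpt : ∀ t : ℝ, (1 : ℂ) * (z / (z - t))
      = (1 + (t : ℂ) * z⁻¹) + z⁻¹ ^ 2 * (((t ^ 2 : ℝ) : ℂ) * (z / (z - t))) := by
    intro t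
    have h3 : z - t ≠ 0 := sub_ofReal_ne_zero (ofReal_mul_I_im_pos hy) t
    have h4 : z ≠ 0 := ofReal_mul_I_ne_zero hy
    push_cast
    field_simp
    ring
  have i1 : Integrable (fun t : ℝ => (t : ℂ) * z⁻¹) σ := h1.ofReal.mul_const _
  have i2 : Integrable (fun t : ℝ => (1 : ℂ) + (t : ℂ) * z⁻¹) σ := (integrable_const _).add i1
  have i3 : Integrable (fun t : ℝ => z⁻¹ ^ 2 * (((t ^ 2 : ℝ) : ℂ) * (z / (z - t)))) σ :=
    (integrable_mul_resolvent h2.ofReal hy).const_mul _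
  simp_rw [hpt]
  rw [integral_add i2 i3,
    integral_add (integrable_const _) i1]
  simp

/-- An exact identity with two uses: its limit identifies the mass of the Nevanlinna measure with
the variance, and its modulus gives the decay needed for the existence of that measure. -/
lemma mul_fTransform_sub {σ : Measure ℝ} [IsProbabilityMeasure σ]
    (h2 : Integrable (fun t : ℝ => t ^ 2) σ) {y : ℝ} (hy : 0 < y) :
    (y : ℂ) * Complex.I
        * (fTransform σ (y * Complex.I) - (y * Complex.I - (∫ t, t ∂σ : ℝ)))
      = -(secondMomentTransform σ y - (∫ t, t ∂σ : ℝ) ^ 2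
          - (∫ t, t ∂σ : ℝ) * ((y : ℂ) * Complex.I)⁻¹ * secondMomentTransform σ y)
        / ((y : ℂ) * Complex.I * cauchyTransform σ (y * Complex.I)) := by
  have hG := cauchyTransform_ne_zero (σ := σ) (ofReal_mul_I_im_pos hy)
  have hz := ofReal_mul_I_ne_zero hy
  have hA := mul_cauchyTransform_expansion h2 hy
  rw [fTransform_eq]
  generalize cauchyTransform σ (y * Complex.I) = G at *
  generalize (y : ℂ) * Complex.I = z at *
  generalize secondMomentTransform σ y = M at *
  generalize ((∫ t, t ∂σ : ℝ) : ℂ) = m at *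
  rw [eq_div_iff (mul_ne_zero hz hG)]
  field_simp at hA ⊢
  linear_combination (m - z) * hA

lemma tendsto_secondMomentTransform {σ : Measure ℝ} (h2 : Integrable (fun t : ℝ => t ^ 2) σ) :
    Tendsto (secondMomentTransform σ) atTop (𝓝 ((∫ t, t ^ 2 ∂σ : ℝ) : ℂ)) := by
  have := tendsto_integral_mul_resolvent (σ := σ) (g := fun t : ℝ => ((t ^ 2 : ℝ) : ℂ)) h2.ofReal
  rwa [integral_complex_ofReal] at this

/-- The total mass of the Nevanlinna measure is the variance. -/
lemma measureReal_univ_of_fTransform_eq {σ τ : Measure ℝ} [IsProbabilityMeasure σ]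
    [IsFiniteMeasure τ] (h2 : Integrable (fun t : ℝ => t ^ 2) σ)
    (h : ∀ z : ℂ, 0 < z.im → fTransform σ z = z - (∫ t, t ∂σ : ℝ) - cauchyTransform τ z) :
    τ.real Set.univ = ∫ t, t ^ 2 ∂σ - (∫ t, t ∂σ) ^ 2 := by
  have hM := tendsto_secondMomentTransform h2
  have hu := tendsto_inv_mul_I
  have hA := tendsto_mul_cauchyTransform σ
  have h1 : Tendsto (fun y : ℝ => (secondMomentTransform σ y - ((∫ t, t ∂σ : ℝ) : ℂ) ^ 2
          - ((∫ t, t ∂σ : ℝ) : ℂ) * ((y : ℂ) * Complex.I)⁻¹ * secondMomentTransform σ y)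
        / ((y : ℂ) * Complex.I * cauchyTransform σ (y * Complex.I))) atTop
      (𝓝 ((((∫ t, t ^ 2 ∂σ : ℝ) : ℂ) - ((∫ t, t ∂σ : ℝ) : ℂ) ^ 2
        - ((∫ t, t ∂σ : ℝ) : ℂ) * 0 * ((∫ t, t ^ 2 ∂σ : ℝ) : ℂ)) / ((σ.real Set.univ : ℝ) : ℂ))) :=
    ((hM.sub_const _).sub ((hu.const_mul _).mul hM)).div hA (by simp)
  have h3 := h1.congr' (f₂ := fun y : ℝ => (y : ℂ) * Complex.I * cauchyTransform τ (y * Complex.I)) (by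
    filter_upwards [eventually_gt_atTop 0] with y hy
    have h4 := mul_fTransform_sub h2 hy
    rw [h _ (ofReal_mul_I_im_pos hy), neg_div] at h4
    linear_combination h4)
  have h5 := tendsto_nhds_unique (tendsto_mul_cauchyTransform τ) h3
  simp only [probReal_univ, Complex.ofReal_one, div_one, mul_zero, zero_mul, sub_zero] at h5
  exact_mod_cast h5

/-- A probability measure with finite second moment has a Nevanlinna measure. -/
theorem exists_nevanlinna {σ : Measure ℝ} [IsProbabilityMeasure σ]
    (h2 : Integrable (fun t : ℝ => t ^ 2) σ) : ∃ τ : Measure ℝ, IsFiniteMeasure τ ∧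
      ∀ z : ℂ, 0 < z.im → fTransform σ z = z - (∫ t, t ∂σ : ℝ) - cauchyTransform τ z := by
  set m : ℝ := ∫ t, t ∂σ with hm
  set S : ℝ := ∫ t, ‖((t ^ 2 : ℝ) : ℂ)‖ ∂σ with hS
  have hS0 : 0 ≤ S := integral_nonneg fun t => norm_nonneg _
  -- For `y ≥ 1` the real part of `iy G_σ(iy)` is at least `∫ 1 / (t² + 1) dσ`, so `c₀` bounds the
  -- denominator of `mul_fTransform_sub` from below.
  set c₀ : ℝ := sqResolventIntegral σ Complex.I with hc
  have hc0 : 0 < c₀ := sqResolventIntegral_pos (by simp)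
  have hd : DifferentiableOn ℂ (fun z => fTransform σ z - (z - (m : ℂ))) {z | 0 < z.im} :=
    differentiableOn_fTransform.sub (by fun_prop)
  obtain ⟨τ, hτ, h⟩ := exists_stieltjes_measure (C := (S + m ^ 2 + |m| * S) / c₀) hd
    (fun z hz => by simpa using im_le_im_fTransform (σ := σ) hz) (fun y hy => by
      have hy0 : 0 < y := by linarith
      have h3 := congrArg norm (mul_fTransform_sub h2 hy0)
      rw [norm_mul, norm_ofReal_mul_I hy0, norm_div, norm_neg] at h3
      rw [h3]
      have hM : ‖secondMomentTransform σ y‖ ≤ S := norm_integral_mul_resolvent_le h2.ofReal hy0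
      have hu : ‖((y : ℂ) * Complex.I)⁻¹‖ ≤ 1 := by
        rw [norm_inv, norm_ofReal_mul_I hy0]
        exact inv_le_one_of_one_le₀ hy
      refine div_le_div₀ (by positivity) ?_ hc0 ?_
      · refine (norm_sub_le _ _).trans (add_le_add ((norm_sub_le _ _).trans (add_le_add hM ?_)) ?_)
        · simp [hm]
        · rw [norm_mul, norm_mul, Complex.norm_real, Real.norm_eq_abs]
          exact mul_le_mul (mul_le_of_le_one_right (abs_nonneg _) hu) hM (norm_nonneg _)
            (abs_nonneg _)
      · rw [hc]
        refine le_trans ?_ (Complex.re_le_norm _)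
        rw [re_mul_cauchyTransform σ hy0]
        refine integral_mono (integrable_sqResolvent (by simp)) ?_ fun t => ?_
        · refine (integrable_const (1 : ℝ)).mono' (Measurable.aestronglyMeasurable (by fun_prop))
            (ae_of_all _ fun t => ?_)
          rw [Real.norm_of_nonneg (by positivity)]
          exact div_le_one_of_le₀ (by nlinarith [sq_nonneg t]) (by positivity)
        · have h4 : ‖Complex.I - (t : ℂ)‖ ^ 2 = t ^ 2 + 1 := by
            rw [← Complex.normSq_eq_norm_sq, Complex.normSq_apply]
            simp
            ring
          simp only [h4]
          rw [div_le_div_iff₀ (by positivity) (by positivity)]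
          nlinarith [sq_nonneg t, mul_nonneg (sq_nonneg t) (by nlinarith : 0 ≤ y ^ 2 - 1)])
  refine ⟨τ, hτ, fun z hz => ?_⟩
  have := h z hz
  linear_combination this

end MonotoneCLT

namespace MonotoneCLT

open Filter Topology

/-! ### Monotone convolution powers -/

lemma isMonotonePower_monotonePower {μ : Measure ℝ} {n : ℕ} (h : ∃ m : Measure ℝ, IsMonotonePower μ n m) :
    IsMonotonePower μ n (monotonePower μ n) := by
  rw [monotonePower, dif_pos h]
  exact h.choose_spec

lemma isProbabilityMeasure_normalizedPower {μ : Measure ℝ} {n : ℕ} (h : ∃ m : Measure ℝ, IsMonotonePower μ n m) :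
    IsProbabilityMeasure (normalizedPower μ n) := by
  have := (isMonotonePower_monotonePower h).1
  exact Measure.isProbabilityMeasure_map (by fun_prop)

/-- Dilation of the measure conjugates the transform. Only the defining property of the chosen power
enters, so its uniqueness is not needed. -/
lemma fTransform_normalizedPower {μ : Measure ℝ} {n : ℕ} (hn : 0 < n) (h : ∃ m : Measure ℝ, IsMonotonePower μ n m)
    {z : ℂ} (hz : 0 < z.im) :
    fTransform (normalizedPower μ n) z
      = (fTransform μ)^[n] ((√(n : ℝ) : ℝ) * z) / (√(n : ℝ) : ℝ) := by
  have hs : 0 < √(n : ℝ) := Real.sqrt_pos.2 (by exact_mod_cast hn)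
  set s := √(n : ℝ) with hsdef
  have hsz : 0 < ((s : ℂ) * z).im := by simpa using mul_pos hs hz
  have hs0 : (s : ℂ) ≠ 0 := by exact_mod_cast hs.ne'
  rw [← (isMonotonePower_monotonePower h).2 _ hsz, fTransform_eq, fTransform_eq]
  have h1 : cauchyTransform (normalizedPower μ n) z
      = s * cauchyTransform (monotonePower μ n) (s * z) := by
    rw [cauchyTransform, normalizedPower, integral_map (by fun_prop), cauchyTransform,
      ← integral_const_mul]
    · refine integral_congr_ae (ae_of_all _ fun t => ?_)
      have h2 := sub_ofReal_ne_zero hsz t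
      have h3 := sub_ofReal_ne_zero hz (t / s)
      push_cast at h3 ⊢
      rw [← hsdef]
      field_simp
    · simp only [one_div]
      exact Measurable.aestronglyMeasurable (by fun_prop)
  rw [h1, one_div, one_div, mul_inv, mul_comm, div_eq_mul_inv]

section Iterate

variable {μ : Measure ℝ} [IsProbabilityMeasure μ]

lemma im_le_im_iterate_fTransform (n : ℕ) {z : ℂ} (hz : 0 < z.im) :
    z.im ≤ ((fTransform μ)^[n] z).im := by
  induction n with
  | zero => simp
  | succ n ih =>
    rw [Function.iterate_succ_apply']
    exact ih.trans (im_le_im_fTransform (hz.trans_le ih))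

lemma im_iterate_fTransform_pos (n : ℕ) {z : ℂ} (hz : 0 < z.im) :
    0 < ((fTransform μ)^[n] z).im := hz.trans_le (im_le_im_iterate_fTransform n hz)

lemma differentiableOn_iterate_fTransform (n : ℕ) :
    DifferentiableOn ℂ ((fTransform μ)^[n]) {z | 0 < z.im} := by
  induction n with
  | zero => exact differentiableOn_id
  | succ n ih =>
    rw [Function.iterate_succ']
    exact differentiableOn_fTransform.comp ih fun z hz => im_iterate_fTransform_pos n hz

lemma norm_iterate_fTransform_sub_le {ν : Measure ℝ} [IsFiniteMeasure ν]
    (h : ∀ z : ℂ, 0 < z.im → fTransform μ z = z - cauchyTransform ν z) (n : ℕ) {z : ℂ}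
    (hz : 0 < z.im) : ‖(fTransform μ)^[n] z - z‖ ≤ n * (ν.real Set.univ / z.im) := by
  induction n with
  | zero => simp
  | succ n ih =>
    have h1 := im_le_im_iterate_fTransform (μ := μ) n hz
    have h2 := im_iterate_fTransform_pos (μ := μ) n hz
    rw [Function.iterate_succ_apply', h _ h2]
    have h3 := norm_cauchyTransform_le (σ := ν) h2
    have h4 : ν.real Set.univ / ((fTransform μ)^[n] z).im ≤ ν.real Set.univ / z.im :=
      div_le_div_of_nonneg_left measureReal_nonneg hz h1
    calc _ = ‖((fTransform μ)^[n] z - z) - cauchyTransform ν ((fTransform μ)^[n] z)‖ := by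
          congr 1; ring
      _ ≤ _ := norm_sub_le _ _
      _ ≤ n * (ν.real Set.univ / z.im) + ν.real Set.univ / z.im :=
          add_le_add ih (h3.trans h4)
      _ = _ := by push_cast; ring

/-- Monotone convolution powers exist. -/
lemma exists_isMonotonePower {ν : Measure ℝ} [IsFiniteMeasure ν]
    (h : ∀ z : ℂ, 0 < z.im → fTransform μ z = z - cauchyTransform ν z) (n : ℕ) :
    ∃ m : Measure ℝ, IsMonotonePower μ n m := by
  have hne : ∀ z : ℂ, 0 < z.im → (fTransform μ)^[n] z ≠ 0 := by
    intro z hz h0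
    have := im_iterate_fTransform_pos (μ := μ) n hz
    simp [h0] at this
  -- The candidate Cauchy transform is the reciprocal of the iterate. The constant is 1 because the
  -- iterate does not lower imaginary parts; total mass 1 then follows from `F^n(iy) / (iy) → 1`.
  obtain ⟨τ, hτ, hG⟩ := exists_stieltjes_measure (φ := fun z => -((fTransform μ)^[n] z)⁻¹) (C := 1)
    (((differentiableOn_iterate_fTransform n).inv hne).neg) (fun z hz => by
      simp only [Complex.neg_im, Complex.inv_im, neg_div, neg_neg]
      have := im_iterate_fTransform_pos (μ := μ) n hz
      exact div_nonneg this.le (Complex.normSq_nonneg _)) (fun y hy => by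
      have hy0 : 0 < y := by linarith
      have h1 := im_le_im_iterate_fTransform (μ := μ) n (ofReal_mul_I_im_pos hy0)
      have h2 : y ≤ ‖(fTransform μ)^[n] (y * Complex.I)‖ := by
        refine le_trans ?_ ((le_abs_self _).trans (Complex.abs_im_le_norm _))
        simpa using h1
      rw [norm_neg, norm_inv, mul_inv_le_iff₀ (hy0.trans_le h2), one_mul]
      exact h2)
  have hFτ : ∀ z : ℂ, 0 < z.im → cauchyTransform τ z = ((fTransform μ)^[n] z)⁻¹ := fun z hz => by
    have := hG z hz
    simp only [neg_inj] at this
    exact this.symm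
  refine ⟨τ, ⟨?_⟩, fun z hz => by rw [fTransform_eq, hFτ z hz, one_div, inv_inv]⟩
  have h1 := tendsto_mul_cauchyTransform τ
  have h2 : Tendsto (fun y : ℝ => (fTransform μ)^[n] (y * Complex.I) / ((y : ℂ) * Complex.I)) atTop
      (𝓝 1) := by
    rw [tendsto_iff_norm_sub_tendsto_zero]
    have h3 : Tendsto (fun y : ℝ => n * ν.real Set.univ / y ^ 2) atTop (𝓝 0) :=
      tendsto_const_nhds.div_atTop (tendsto_pow_atTop two_ne_zero)
    refine squeeze_zero' (Eventually.of_forall fun y => norm_nonneg _) ?_ h3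
    filter_upwards [eventually_gt_atTop 0] with y hy
    have h4 := norm_iterate_fTransform_sub_le h n (ofReal_mul_I_im_pos hy)
    rw [div_sub_one (ofReal_mul_I_ne_zero hy), norm_div, norm_ofReal_mul_I hy]
    have h5 : ((y : ℂ) * Complex.I).im = y := by simp
    rw [h5] at h4
    rw [div_le_div_iff₀ hy (by positivity)]
    calc _ ≤ n * (ν.real Set.univ / y) * y ^ 2 := mul_le_mul_of_nonneg_right h4 (by positivity)
      _ = _ := by field_simp
  have h3 := (h2.inv₀ one_ne_zero).congr' (f₂ := fun y : ℝ =>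
      (y : ℂ) * Complex.I * cauchyTransform τ (y * Complex.I)) (by
    filter_upwards [eventually_gt_atTop 0] with y hy
    rw [hFτ _ (ofReal_mul_I_im_pos hy), inv_div, div_eq_mul_inv])
  have h4 := tendsto_nhds_unique h1 h3
  rw [inv_one] at h4
  have h5 : τ.real Set.univ = 1 := by exact_mod_cast h4
  rw [measureReal_def, ENNReal.toReal_eq_one_iff] at h5
  exact h5

end Iterate

end MonotoneCLT

namespace MonotoneCLT

open Filter Topology Metric

/-! ### The arcsine law -/

lemma image_sqrt_two_mul_cos :
    (fun θ : ℝ => √2 * Real.cos θ) '' Set.Ioo 0 Real.pi = Set.Ioo (-√2) √2 := by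
  have h2 : (0 : ℝ) < √2 := by positivity
  ext x
  constructor
  · rintro ⟨θ, hθ, rfl⟩
    have h1 : Real.cos θ < 1 := by
      simpa using Real.cos_lt_cos_of_nonneg_of_le_pi le_rfl hθ.2.le hθ.1
    have h3 : -1 < Real.cos θ := by
      simpa using Real.cos_lt_cos_of_nonneg_of_le_pi hθ.1.le le_rfl hθ.2
    constructor <;> simp only <;> nlinarith
  · intro hx
    have h1 : -1 < x / √2 := by rw [lt_div_iff₀ h2]; linarith [hx.1]
    have h3 : x / √2 < 1 := by rw [div_lt_iff₀ h2]; linarith [hx.2]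
    refine ⟨Real.arccos (x / √2), ⟨Real.arccos_pos.2 h3, ?_⟩, ?_⟩
    · exact lt_of_le_of_ne (Real.arccos_le_pi _) fun h => by
        rw [Real.arccos_eq_pi] at h; linarith
    · simp only
      rw [Real.cos_arccos h1.le h3.le]
      field_simp

/-- The arcsine law is the law of `√2 cos θ` with `θ` uniform on `(0, π)`. -/
lemma arcsineLaw_eq_map :
    arcsineLaw = ENNReal.ofReal (1 / Real.pi) •
      (volume.restrict (Set.Ioo 0 Real.pi)).map (fun θ : ℝ => √2 * Real.cos θ) := by
  have hmeas : Measurable fun θ : ℝ => √2 * Real.cos θ := by fun_prop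
  ext A hA
  rw [arcsineLaw, withDensity_apply _ hA, Measure.smul_apply, Measure.map_apply hmeas hA,
    ← lintegral_indicator hA]
  set f : ℝ → ℝ≥0∞ := A.indicator fun t => ENNReal.ofReal (1 / (Real.pi * √(2 - t ^ 2))) with hf
  have hinj : Set.InjOn (fun θ : ℝ => √2 * Real.cos θ) (Set.Ioo 0 Real.pi) := by
    intro a ha b hb hab
    refine Real.injOn_cos ⟨ha.1.le, ha.2.le⟩ ⟨hb.1.le, hb.2.le⟩ ?_
    exact mul_left_cancel₀ (by positivity) hab
  have h1 := lintegral_image_eq_lintegral_abs_deriv_mul (measurableSet_Ioo (a := 0) (b := Real.pi))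
    (f' := fun θ => √2 * -Real.sin θ)
    (fun θ _ => ((Real.hasDerivAt_cos θ).const_mul (√2)).hasDerivWithinAt) hinj f
  rw [image_sqrt_two_mul_cos] at h1
  rw [h1]
  have h2 : ∫⁻ θ in Set.Ioo 0 Real.pi, ENNReal.ofReal |√2 * -Real.sin θ| * f (√2 * Real.cos θ)
      = ∫⁻ θ in Set.Ioo 0 Real.pi,
        ((fun θ : ℝ => √2 * Real.cos θ) ⁻¹' A).indicator
          (fun _ => ENNReal.ofReal (1 / Real.pi)) θ := by
    refine setLIntegral_congr_fun measurableSet_Ioo fun θ hθ => ?_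
    have hs : 0 < Real.sin θ := Real.sin_pos_of_mem_Ioo hθ
    have h3 : √(2 - (√2 * Real.cos θ) ^ 2) = √2 * Real.sin θ := by
      rw [mul_pow, Real.sq_sqrt zero_le_two, Real.cos_sq']
      have : 2 - 2 * (1 - Real.sin θ ^ 2) = 2 * Real.sin θ ^ 2 := by ring
      rw [this, Real.sqrt_mul zero_le_two, Real.sqrt_sq hs.le]
    by_cases hm : √2 * Real.cos θ ∈ A
    · rw [Set.indicator_of_mem (by exact hm)]
      simp only [hf, Set.indicator_of_mem hm, h3]
      rw [← ENNReal.ofReal_mul (abs_nonneg _), mul_neg, abs_neg, abs_of_pos (by positivity)]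
      congr 1
      have : (0 : ℝ) < √2 := by positivity
      field_simp
    · rw [Set.indicator_of_notMem (by exact hm)]
      simp [hf, hm]
  rw [h2, lintegral_indicator_const (hmeas hA), smul_eq_mul]

instance isProbabilityMeasure_arcsineLaw : IsProbabilityMeasure arcsineLaw := by
  constructor
  rw [arcsineLaw_eq_map, Measure.smul_apply, Measure.map_apply (by fun_prop) MeasurableSet.univ]
  simp only [Set.preimage_univ, Measure.restrict_apply MeasurableSet.univ, Set.univ_inter,
    Real.volume_Ioo, sub_zero, smul_eq_mul]
  rw [← ENNReal.ofReal_mul (by positivity)]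
  simp [Real.pi_ne_zero]

lemma integral_arcsineLaw {f : ℝ → ℂ} (hf : Measurable f) :
    ∫ t, f t ∂arcsineLaw
      = (1 / Real.pi : ℝ) * ∫ θ in (0 : ℝ)..Real.pi, f (√2 * Real.cos θ) := by
  rw [arcsineLaw_eq_map, integral_smul_measure, integral_map (by fun_prop)
    hf.aestronglyMeasurable, intervalIntegral.integral_of_le Real.pi_pos.le,
    integral_Ioc_eq_integral_Ioo, ENNReal.toReal_ofReal (by positivity), Complex.real_smul]

/-- The difference is `2 sin((a+b)/2) sin((b-a)/2)`; the first sine dominates the second, which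
Jordan's inequality bounds below by `(b - a) / π`. -/
lemma abs_sub_le_of_cos {a b : ℝ} (ha : a ∈ Set.Ioo 0 Real.pi) (hb : b ∈ Set.Ioo 0 Real.pi)
    (hab : a ≤ b) : 2 * ((b - a) / Real.pi) ^ 2 ≤ Real.cos a - Real.cos b := by
  have hpi := Real.pi_pos
  obtain ⟨ha0, ha1⟩ := ha
  obtain ⟨hb0, hb1⟩ := hb
  have h1 : Real.cos a - Real.cos b = 2 * Real.sin ((a + b) / 2) * Real.sin ((b - a) / 2) := by
    rw [Real.cos_sub_cos, ← neg_sub b a, neg_div, Real.sin_neg]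
    ring
  have h2 : (b - a) / Real.pi ≤ Real.sin ((b - a) / 2) := by
    have := Real.mul_le_sin (x := (b - a) / 2) (by linarith) (by linarith)
    refine le_trans (le_of_eq ?_) this
    field_simp
  have h3 : Real.sin ((b - a) / 2) ≤ Real.sin ((a + b) / 2) := by
    rcases le_total ((a + b) / 2) (Real.pi / 2) with h | h
    · exact Real.sin_le_sin_of_le_of_le_pi_div_two (by linarith) h (by linarith)
    · rw [← Real.sin_pi_sub ((a + b) / 2)]
      exact Real.sin_le_sin_of_le_of_le_pi_div_two (by linarith) (by linarith) (by linarith)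
  have h0 : 0 ≤ (b - a) / Real.pi := by apply div_nonneg <;> linarith
  rw [h1]
  nlinarith

/-- In the angle variable the interval becomes a set whose diameter `abs_sub_le_of_cos` controls.
The square root is the effect of the singular endpoints. -/
lemma arcsineLaw_real_Ioc_le {x h : ℝ} (hh : 0 ≤ h) :
    arcsineLaw.real (Set.Ioc x (x + h)) ≤ √(h / (2 * √2)) := by
  have hpi := Real.pi_pos
  have h2 : (0 : ℝ) < √2 := by positivity
  set d := √(h / (2 * √2)) with hd
  have hd2 : d ^ 2 = h / (2 * √2) := Real.sq_sqrt (by positivity)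
  have hd0 : 0 ≤ d := Real.sqrt_nonneg _
  set S : Set ℝ := (fun θ : ℝ => √2 * Real.cos θ) ⁻¹' Set.Ioc x (x + h) ∩ Set.Ioo 0 Real.pi with hS
  have hkey : ∀ a ∈ S, ∀ b ∈ S, a ≤ b → b - a ≤ Real.pi * d := by
    intro a ha b hb hab
    have h3 := abs_sub_le_of_cos ha.2 hb.2 hab
    have h4 : √2 * Real.cos a ≤ x + h := ha.1.2
    have h5 : x < √2 * Real.cos b := hb.1.1
    have h6 : √2 * (2 * ((b - a) / Real.pi) ^ 2) ≤ h := by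
      have := mul_le_mul_of_nonneg_left h3 h2.le
      linarith
    have h7 : ((b - a) / Real.pi) ^ 2 ≤ d ^ 2 := by
      rw [hd2, le_div_iff₀ (by positivity)]
      linarith
    have h8 := (sq_le_sq₀ (div_nonneg (by linarith) hpi.le) hd0).1 h7
    rw [div_le_iff₀ hpi] at h8
    linarith
  have hdiam : Metric.ediam S ≤ ENNReal.ofReal (Real.pi * d) := by
    refine Metric.ediam_le fun a ha b hb => ?_
    rw [edist_dist]
    refine ENNReal.ofReal_le_ofReal ?_
    rw [Real.dist_eq, abs_le]
    rcases le_total a b with hab | hab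
    · have := hkey a ha b hb hab
      constructor <;> nlinarith
    · have := hkey b hb a ha hab
      constructor <;> nlinarith
  have hmain : arcsineLaw (Set.Ioc x (x + h)) ≤ ENNReal.ofReal d := by
    rw [arcsineLaw_eq_map, Measure.smul_apply, Measure.map_apply (by fun_prop) measurableSet_Ioc,
      Measure.restrict_apply (measurableSet_Ioc.preimage (by fun_prop)), smul_eq_mul]
    calc _ ≤ ENNReal.ofReal (1 / Real.pi) * ENNReal.ofReal (Real.pi * d) :=
          mul_le_mul_right ((Real.volume_le_diam S).trans hdiam) _
      _ = ENNReal.ofReal d := by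
          rw [← ENNReal.ofReal_mul (by positivity)]
          congr 1
          field_simp
  rw [measureReal_def]
  exact ENNReal.toReal_le_of_le_ofReal hd0 hmain

/-- The two roots of the quadratic have product 1, and a root of modulus 1 would make `z` real; so
one root lies inside the disc. -/
lemma exists_joukowski {z : ℂ} (hz : 0 < z.im) :
    ∃ q : ℂ, q ≠ 0 ∧ ‖q‖ < 1 ∧ z * (√2 : ℝ) * q = q ^ 2 + 1 := by
  have h2 : (0 : ℝ) < √2 := by positivity
  set s : ℂ := z * (√2 : ℝ) with hs
  have hsim : 0 < s.im := by
    rw [hs, Complex.im_mul_ofReal]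
    positivity
  have hnorm : ∀ q : ℂ, s * q = q ^ 2 + 1 → ‖q‖ ≠ 1 := by
    intro q hq h1
    have h3 : q * (starRingEnd ℂ) q = 1 := by
      rw [Complex.mul_conj, Complex.normSq_eq_norm_sq, h1]; simp
    have hq0 : q ≠ 0 := by rintro rfl; simp at h1
    have h4 : s = q + (starRingEnd ℂ) q := by
      apply mul_right_cancel₀ hq0
      linear_combination hq - h3
    rw [h4, Complex.add_conj] at hsim
    simp at hsim
  obtain ⟨r, hr⟩ := IsAlgClosed.exists_pow_nat_eq (s ^ 2 - 4) two_pos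
  have hp : ((s + r) / 2) * ((s - r) / 2) = 1 := by linear_combination (-1 / 4 : ℂ) * hr
  have e1 : s * ((s + r) / 2) = ((s + r) / 2) ^ 2 + 1 := by linear_combination (1 / 4 : ℂ) * -hr
  have e2 : s * ((s - r) / 2) = ((s - r) / 2) ^ 2 + 1 := by linear_combination (1 / 4 : ℂ) * -hr
  have hpn := congrArg norm hp
  rw [norm_mul, norm_one] at hpn
  rcases lt_trichotomy ‖(s + r) / 2‖ 1 with h | h | h
  · exact ⟨_, left_ne_zero_of_mul_eq_one hp, h, e1⟩
  · exact absurd h (hnorm _ e1)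
  · refine ⟨_, right_ne_zero_of_mul_eq_one hp, ?_, e2⟩
    nlinarith [norm_nonneg ((s - r) / 2)]

/-- With `√2 z = q + 1/q` and `ζ = e^{iθ}`, the integrand `1 / (z - √2 cos θ)` is a Cauchy kernel at
`q` times `√2 q / (1 - qζ)`. Cauchy's formula gives `G = √2 q / (1 - q²)`. Squaring avoids choosing
a branch of the root. -/
lemma fTransform_arcsineLaw_sq {z : ℂ} (hz : 0 < z.im) : fTransform arcsineLaw z ^ 2 = z ^ 2 - 2 := by
  obtain ⟨q, hq0, hq1, hq⟩ := exists_joukowski hz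
  have hpi := Real.pi_pos
  set s : ℂ := ((√2 : ℝ) : ℂ) with hs
  have hs2 : s ^ 2 = 2 := by
    rw [hs, ← Complex.ofReal_pow, Real.sq_sqrt zero_le_two]; simp
  have hs0 : s ≠ 0 := by
    intro h
    rw [h] at hs2
    norm_num at hs2
  have hne : ∀ ζ ∈ closedBall (0 : ℂ) 1, 1 - q * ζ ≠ 0 := by
    intro ζ hζ h
    rw [sub_eq_zero] at h
    have h3 := congrArg norm h
    simp at h3 hζ
    nlinarith [norm_nonneg q, norm_nonneg ζ]
  have hdiff : DiffContOnCl ℂ (fun ζ => s * q * (1 - q * ζ)⁻¹) (ball 0 1) := by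
    apply DifferentiableOn.diffContOnCl
    rw [closure_ball _ one_ne_zero]
    exact DifferentiableOn.const_mul (DifferentiableOn.inv (by fun_prop) hne) _
  have havg := DiffContOnCl.circleAverage_smul_div (R := 1) (c := 0) (w := q) (by simpa using hdiff)
    (by simpa using hq1)
  have hG : cauchyTransform arcsineLaw z = s * q * (1 - q * q)⁻¹ := by
    rw [← havg, cauchyTransform, integral_arcsineLaw
      (by simp only [one_div]; fun_prop), Real.circleAverage]
    set g : ℝ → ℂ := fun θ => 1 / (z - ((√2 * Real.cos θ : ℝ) : ℂ)) with hg
    have hgc : Continuous g := by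
      refine Continuous.div continuous_const (by fun_prop) fun θ => ?_
      exact sub_ofReal_ne_zero hz _
    have hkey : ∀ θ : ℝ, ((circleMap 0 1 θ - 0) / (circleMap 0 1 θ - q)) •
        (s * q * (1 - q * circleMap 0 1 θ)⁻¹) = g θ := by
      intro θ
      set ζ := circleMap 0 1 θ with hζ
      have hn : ‖ζ‖ = 1 := by simp [hζ]
      have hζ0 : ζ ≠ 0 := by intro h; simp [h] at hn
      have h1 : 1 - q * ζ ≠ 0 := hne ζ (by simp [hn])
      have h2 : ζ - q ≠ 0 := by
        intro h
        rw [sub_eq_zero] at h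
        rw [h] at hn
        linarith
      have hcos : ((√2 * Real.cos θ : ℝ) : ℂ) * (s * ζ) = ζ ^ 2 + 1 := by
        have e1 : ζ = Complex.cos θ + Complex.sin θ * Complex.I := by
          rw [← Complex.exp_mul_I, hζ]; simp [circleMap]
        have e2 := Complex.sin_sq_add_cos_sq θ
        push_cast
        rw [← hs, e1]
        linear_combination (Complex.cos θ * (Complex.cos θ + Complex.sin θ * Complex.I)) * hs2
          + e2 - Complex.sin θ ^ 2 * Complex.I_sq
      have h4 : (z - ((√2 * Real.cos θ : ℝ) : ℂ)) * (s * q * ζ) = (1 - q * ζ) * (ζ - q) := by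
        linear_combination ζ * hq - q * hcos
      have h5 : z - ((√2 * Real.cos θ : ℝ) : ℂ) ≠ 0 := sub_ofReal_ne_zero hz _
      rw [hg, smul_eq_mul, sub_zero]
      simp only []
      generalize ((√2 * Real.cos θ : ℝ) : ℂ) = c at *
      rw [← div_eq_mul_inv, div_mul_div_comm, div_eq_div_iff (mul_ne_zero h2 h1) h5]
      linear_combination h4
    have hint : ∫ θ in (0 : ℝ)..2 * Real.pi, g θ = 2 * ∫ θ in (0 : ℝ)..Real.pi, g θ := by
      have h1 := intervalIntegral.integral_add_adjacent_intervals
        (hgc.intervalIntegrable (μ := volume) 0 Real.pi)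
        (hgc.intervalIntegrable (μ := volume) Real.pi (2 * Real.pi))
      have h2 := intervalIntegral.integral_comp_sub_left (a := 0) (b := Real.pi) g (2 * Real.pi)
      have h3 : ∀ θ : ℝ, g (2 * Real.pi - θ) = g θ := fun θ => by
        simp only [hg, Real.cos_two_pi_sub]
      simp only [h3, sub_zero] at h2
      have h4 : 2 * Real.pi - Real.pi = Real.pi := by ring
      rw [h4] at h2
      rw [← h1, ← h2]
      ring
    simp_rw [hkey]
    rw [hint, Complex.real_smul]
    have : (Real.pi : ℂ) ≠ 0 := by exact_mod_cast hpi.ne'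
    push_cast
    field_simp
  have h1 : 1 - q * q ≠ 0 := hne q (by simpa using hq1.le)
  have hz2 : z = (q ^ 2 + 1) / (s * q) := by
    rw [eq_div_iff (mul_ne_zero hs0 hq0)]
    linear_combination hq
  rw [fTransform_eq, hG, hz2]
  field_simp
  linear_combination (2 * q ^ 2) * hs2

end MonotoneCLT

namespace MonotoneCLT

open Filter Topology

/-! ### Smoothing with the Poisson kernel -/

/-- The Poisson kernel of the upper half-plane at height `y`. -/
noncomputable def poissonDensity (y s : ℝ) : ℝ := y / (Real.pi * (s ^ 2 + y ^ 2))

lemma measurable_poissonDensity (y : ℝ) : Measurable (poissonDensity y) := by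
  unfold poissonDensity
  fun_prop

lemma poissonDensity_nonneg {y : ℝ} (hy : 0 < y) (s : ℝ) : 0 ≤ poissonDensity y s := by
  have := Real.pi_pos
  unfold poissonDensity
  positivity

lemma poissonDensity_eq {y : ℝ} (hy : 0 < y) (s : ℝ) :
    poissonDensity y s = (Real.pi * y)⁻¹ * (1 + (s / y) ^ 2)⁻¹ := by
  have := Real.pi_pos
  unfold poissonDensity
  field_simp
  ring

lemma integrable_poissonDensity {y : ℝ} (hy : 0 < y) : Integrable (poissonDensity y) := by
  have h := (integrable_inv_one_add_sq.comp_div hy.ne').const_mul (Real.pi * y)⁻¹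
  exact h.congr (ae_of_all _ fun s => (poissonDensity_eq hy s).symm)

lemma integral_poissonDensity {y : ℝ} (hy : 0 < y) : ∫ s, poissonDensity y s = 1 := by
  simp_rw [poissonDensity_eq hy]
  rw [integral_const_mul, Measure.integral_comp_div (fun x : ℝ => (1 + x ^ 2)⁻¹),
    integral_univ_inv_one_add_sq, abs_of_pos hy, smul_eq_mul]
  have := Real.pi_pos
  field_simp

/-- The half-width `√3 y` is chosen since `arctan √3 = π / 3`. A mass above one half is what lets
the smoothing inequality absorb the supremum. -/
lemma setIntegral_poissonDensity {y : ℝ} (hy : 0 < y) :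
    ∫ s in Set.Ioc (-(√3 * y)) (√3 * y), poissonDensity y s = 2 / 3 := by
  have h3 : (0 : ℝ) < √3 := by positivity
  have hpi := Real.pi_pos
  rw [← intervalIntegral.integral_of_le (by nlinarith)]
  simp_rw [poissonDensity_eq hy]
  rw [intervalIntegral.integral_const_mul,
    intervalIntegral.integral_comp_div (fun x : ℝ => (1 + x ^ 2)⁻¹) hy.ne', integral_inv_one_add_sq]
  have e1 : √3 * y / y = √3 := by field_simp
  have e2 : -(√3 * y) / y = -√3 := by field_simp
  have e3 : Real.arctan (√3) = Real.pi / 3 := by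
    rw [← Real.tan_pi_div_three, Real.arctan_tan] <;> linarith
  rw [e1, e2, Real.arctan_neg, e3, smul_eq_mul]
  field_simp
  norm_num

lemma integral_poissonDensity_sub {y : ℝ} (hy : 0 < y) (α : Measure ℝ) [IsFiniteMeasure α] (u : ℝ) :
    ∫ t, poissonDensity y (u - t) ∂α
      = -(1 / Real.pi) * (cauchyTransform α (u + y * Complex.I)).im := by
  have hz : (0 : ℝ) < ((u : ℂ) + y * Complex.I).im := by simpa using hy
  rw [im_cauchyTransform hz, sqResolventIntegral, neg_mul_neg, ← integral_const_mul,
    ← integral_const_mul]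
  refine integral_congr_ae (ae_of_all _ fun t => ?_)
  have h1 : ‖(u : ℂ) + y * Complex.I - t‖ ^ 2 = (u - t) ^ 2 + y ^ 2 := by
    rw [← Complex.normSq_eq_norm_sq, Complex.normSq_apply]
    simp
    ring
  simp only [h1, poissonDensity]
  have := Real.pi_pos
  simp
  field_simp

lemma integrable_prod_poissonDensity {y : ℝ} (hy : 0 < y) (α : Measure ℝ) [IsFiniteMeasure α] :
    Integrable (fun p : ℝ × ℝ => poissonDensity y (p.2 - p.1)) (α.prod volume) := by
  rw [integrable_prod_iff]
  · refine ⟨ae_of_all _ fun t => (integrable_poissonDensity hy).comp_sub_right t, ?_⟩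
    have : (fun t : ℝ => ∫ u, ‖poissonDensity y (u - t)‖) = fun _ => (1 : ℝ) := by
      ext t
      simp_rw [Real.norm_of_nonneg (poissonDensity_nonneg hy _)]
      rw [integral_sub_right_eq_self (poissonDensity y), integral_poissonDensity hy]
    simp only [this]
    exact integrable_const _
  · exact ((measurable_poissonDensity y).comp (measurable_snd.sub measurable_fst)).aestronglyMeasurable

lemma antitone_real_Iic_sub (α : Measure ℝ) [IsFiniteMeasure α] (x : ℝ) :
    Antitone fun s => α.real (Set.Iic (x - s)) := fun a b hab =>
  measureReal_mono (Set.Iic_subset_Iic.2 (by linarith))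

/-- The smoothed distribution function in terms of the Cauchy transform. -/
lemma integral_real_Iic_mul_poissonDensity {y : ℝ} (hy : 0 < y) (α : Measure ℝ)
    [IsProbabilityMeasure α] (x : ℝ) :
    ∫ s, α.real (Set.Iic (x - s)) * poissonDensity y s
      = -(1 / Real.pi) * ∫ u in Set.Iic x, (cauchyTransform α (u + y * Complex.I)).im := by
  rw [← integral_const_mul]
  simp_rw [← integral_poissonDensity_sub hy α]
  have hi : Integrable (Function.uncurry fun t u => poissonDensity y (u - t))
      (α.prod (volume.restrict (Set.Iic x))) := by
    have h1 := (integrable_prod_poissonDensity hy α).restrict (s := Set.univ ×ˢ Set.Iic x)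
    rw [← Measure.prod_restrict, Measure.restrict_univ] at h1
    exact h1
  rw [← integral_integral_swap hi]
  have hB : ∀ t : ℝ, ∫ u in Set.Iic x, poissonDensity y (u - t)
      = ∫ s, (Set.Iic (x - t)).indicator (poissonDensity y) s := by
    intro t
    rw [← integral_indicator measurableSet_Iic, ←
      integral_sub_right_eq_self ((Set.Iic (x - t)).indicator (poissonDensity y)) t]
    refine integral_congr_ae (ae_of_all _ fun u => ?_)
    simp only []
    by_cases h : u ≤ x
    · rw [Set.indicator_of_mem (by exact h), Set.indicator_of_mem (by simpa using h)]
    · rw [Set.indicator_of_notMem (by exact h), Set.indicator_of_notMem (by simpa using h)]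
  simp_rw [hB]
  have hset : MeasurableSet {p : ℝ × ℝ | p.2 + p.1 ≤ x} :=
    measurableSet_le (measurable_snd.add measurable_fst) measurable_const
  have hi2 : Integrable (Function.uncurry fun t s => (Set.Iic (x - t)).indicator (poissonDensity y) s)
      (α.prod volume) := by
    have h1 : Integrable (fun p : ℝ × ℝ => (1 : ℝ) * poissonDensity y p.2) (α.prod volume) :=
      (integrable_const (1 : ℝ)).mul_prod (integrable_poissonDensity hy)
    refine (h1.indicator hset).congr (ae_of_all _ fun p => ?_)
    simp only [Function.uncurry]
    by_cases h : p.2 + p.1 ≤ x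
    · rw [Set.indicator_of_mem (by exact h), Set.indicator_of_mem (by simp; linarith), one_mul]
    · rw [Set.indicator_of_notMem (by exact h), Set.indicator_of_notMem (by simp; linarith)]
  rw [integral_integral_swap hi2]
  refine integral_congr_ae (ae_of_all _ fun s => ?_)
  have h1 : (fun t => (Set.Iic (x - t)).indicator (poissonDensity y) s)
      = (Set.Iic (x - s)).indicator fun _ => poissonDensity y s := by
    ext t
    by_cases h : t + s ≤ x
    · rw [Set.indicator_of_mem (by simp; linarith), Set.indicator_of_mem (by simp; linarith)]
    · rw [Set.indicator_of_notMem (by simp; linarith), Set.indicator_of_notMem (by simp; linarith)]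
  simp only [h1]
  rw [integral_indicator_const _ measurableSet_Iic, smul_eq_mul]

lemma integrable_real_Iic_mul_poissonDensity {y : ℝ} (hy : 0 < y) (α : Measure ℝ)
    [IsProbabilityMeasure α] (x : ℝ) :
    Integrable fun s => α.real (Set.Iic (x - s)) * poissonDensity y s := by
  refine (integrable_poissonDensity hy).mono' ((antitone_real_Iic_sub α x).measurable.mul
    (measurable_poissonDensity y)).aestronglyMeasurable (ae_of_all _ fun s => ?_)
  rw [norm_mul, Real.norm_of_nonneg measureReal_nonneg,
    Real.norm_of_nonneg (poissonDensity_nonneg hy s)]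
  exact mul_le_of_le_one_left (poissonDensity_nonneg hy s) measureReal_le_one

section Kolmogorov

variable {α β : Measure ℝ} [IsProbabilityMeasure α] [IsProbabilityMeasure β]

lemma abs_real_sub_real_le_one (x : ℝ) : |α.real (Set.Iic x) - β.real (Set.Iic x)| ≤ 1 := by
  have h1 : α.real (Set.Iic x) ≤ 1 := measureReal_le_one
  have h2 : β.real (Set.Iic x) ≤ 1 := measureReal_le_one
  have h3 : 0 ≤ α.real (Set.Iic x) := measureReal_nonneg
  have h4 : 0 ≤ β.real (Set.Iic x) := measureReal_nonneg
  rw [abs_le]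
  constructor <;> linarith

lemma abs_real_sub_real_le_kolmogorovDist (x : ℝ) :
    |α.real (Set.Iic x) - β.real (Set.Iic x)| ≤ kolmogorovDist α β :=
  le_ciSup (f := fun x : ℝ => |α.real (Set.Iic x) - β.real (Set.Iic x)|)
    ⟨1, by rintro _ ⟨x, rfl⟩; exact abs_real_sub_real_le_one x⟩ x

/-- A lower bound of the smoothed function by its values on an interval. -/
lemma le_integral_mul_poissonDensity {y : ℝ} (hy : 0 < y) {g : ℝ → ℝ}
    (hg : Integrable fun s => g s * poissonDensity y s) {a Δ : ℝ} (hΔ : ∀ s, -Δ ≤ g s)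
    (ha : ∀ s ∈ Set.Ioc (-(√3 * y)) (√3 * y), a ≤ g s) :
    2 / 3 * (a + Δ) - Δ ≤ ∫ s, g s * poissonDensity y s := by
  have hp := integrable_poissonDensity hy
  set I := Set.Ioc (-(√3 * y)) (√3 * y) with hI
  have h1 : ∫ s, ((a + Δ) * I.indicator (poissonDensity y) s - Δ * poissonDensity y s)
      = 2 / 3 * (a + Δ) - Δ := by
    rw [integral_sub ((hp.indicator measurableSet_Ioc).const_mul _) (hp.const_mul _),
      integral_const_mul, integral_const_mul, integral_indicator measurableSet_Ioc,
      setIntegral_poissonDensity hy, integral_poissonDensity hy]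
    ring
  rw [← h1]
  refine integral_mono (((hp.indicator measurableSet_Ioc).const_mul _).sub (hp.const_mul _)) hg
    fun s => ?_
  have h2 := poissonDensity_nonneg hy s
  by_cases hs : s ∈ I
  · simp only [Set.indicator_of_mem hs]
    nlinarith [ha s hs]
  · simp only [Set.indicator_of_notMem hs]
    nlinarith [hΔ s]

/-- **Smoothing inequality**: the Kolmogorov distance is controlled by the distance of the
distribution functions smoothed with the Poisson kernel and by the modulus of continuity of one of
them. -/
lemma kolmogorovDist_le_of_smoothed {y S ω : ℝ} (hy : 0 < y)
    (hS : ∀ x, |∫ s, (α.real (Set.Iic (x - s)) - β.real (Set.Iic (x - s))) * poissonDensity y s| ≤ S)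
    (hω : ∀ x, β.real (Set.Ioc x (x + 2 * (√3 * y))) ≤ ω) :
    kolmogorovDist α β ≤ 3 * S + 2 * ω := by
  set Δ := kolmogorovDist α β with hΔ
  set c := √3 * y with hc
  set D : ℝ → ℝ := fun x => α.real (Set.Iic x) - β.real (Set.Iic x) with hD
  have hDΔ : ∀ x, |D x| ≤ Δ := abs_real_sub_real_le_kolmogorovDist
  have hint : ∀ x, Integrable fun s => D (x - s) * poissonDensity y s := by
    intro x
    refine ((integrable_real_Iic_mul_poissonDensity hy α x).sub
      (integrable_real_Iic_mul_poissonDensity hy β x)).congr (ae_of_all _ fun s => ?_)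
    simp only [Pi.sub_apply, hD]
    ring
  -- The distribution function of `α` only increases and that of `β` gains at most `ω`: the
  -- difference cannot drop by more than `ω` on a window.
  have hmono : ∀ v w, v ≤ w → w ≤ v + 2 * c → D v - ω ≤ D w := by
    intro v w h1 h2
    have h3 : α.real (Set.Iic v) ≤ α.real (Set.Iic w) := measureReal_mono (Set.Iic_subset_Iic.2 h1)
    have h4 : β.real (Set.Iic w) ≤ β.real (Set.Iic v) + β.real (Set.Ioc v (v + 2 * c)) := by
      refine (measureReal_mono ?_).trans (measureReal_union_le _ _)
      intro t ht
      rcases le_or_gt t v with h | h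
      · exact Or.inl h
      · exact Or.inr ⟨h, ht.out.trans h2⟩
    have h5 := hω v
    simp only [hD]
    linarith
  -- Smooth at a point shifted by `c`, so that the central window lies on one side of `x`. The
  -- kernel has mass `2/3` there, and `D` is bounded by `Δ` elsewhere. Taking the supremum and
  -- absorbing `Δ / 2` finishes.
  have hpt : ∀ x, |D x| ≤ 3 / 2 * S + Δ / 2 + ω := by
    intro x
    rw [abs_le]
    constructor
    · have h1 := le_integral_mul_poissonDensity hy (g := fun s => -D (x - c - s)) (a := -D x - ω)
        (Δ := Δ) (by simpa using (hint (x - c)).neg) (fun s => by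
          have := abs_le.1 (hDΔ (x - c - s)); linarith [this.2]) (fun s hs => by
          have h2 := hmono (x - c - s) x (by linarith [hs.1, hc]) (by linarith [hs.2, hc])
          linarith)
      simp only [neg_mul, integral_neg] at h1
      have h2 := (abs_le.1 (hS (x - c))).1
      linarith
    · have h1 := le_integral_mul_poissonDensity hy (g := fun s => D (x + c - s)) (a := D x - ω)
        (Δ := Δ) (hint (x + c)) (fun s => (abs_le.1 (hDΔ (x + c - s))).1) (fun s hs =>
          hmono x (x + c - s) (by linarith [hs.2, hc]) (by linarith [hs.1, hc]))
      have h2 := (abs_le.1 (hS (x + c))).2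
      linarith
  have : Δ ≤ 3 / 2 * S + Δ / 2 + ω := ciSup_le hpt
  linarith

end Kolmogorov

lemma integral_abs_add_rpow {y : ℝ} (hy : 0 < y) :
    ∫ s : ℝ, (|s| + y) ^ (-(3 / 2) : ℝ) = 4 * y ^ (-(1 / 2) : ℝ) := by
  rw [integral_comp_abs (f := fun s => (s + y) ^ (-(3 / 2) : ℝ))]
  have h1 : ∫ s in Set.Ioi (0 : ℝ), (s + y) ^ (-(3 / 2) : ℝ)
      = 0 - (-2 * ((0 : ℝ) + y) ^ (-(1 / 2) : ℝ)) := by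
    refine integral_Ioi_of_hasDerivAt_of_tendsto' (f := fun s => -2 * (s + y) ^ (-(1 / 2) : ℝ))
      (fun s hs => ?_) (integrableOn_add_rpow_Ioi_of_lt (by norm_num) (by linarith)) ?_
    · have hs0 : s + y ≠ 0 := by
        have : (0 : ℝ) ≤ s := hs
        positivity
      have h2 := (((hasDerivAt_id s).add_const y).rpow_const (p := -(1 / 2)) (Or.inl hs0)).const_mul
        (-2 : ℝ)
      simp only [id] at h2
      have e : (-(1 / 2) - 1 : ℝ) = -(3 / 2) := by norm_num
      rw [e] at h2
      have e2 : -2 * (1 * -(1 / 2) * (s + y) ^ (-(3 / 2) : ℝ)) = (s + y) ^ (-(3 / 2) : ℝ) := by ring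
      rwa [e2] at h2
    · have h2 := (tendsto_rpow_neg_atTop (y := (1 / 2 : ℝ)) (by norm_num)).comp
        (tendsto_atTop_add_const_right atTop y tendsto_id)
      simpa using h2.const_mul (-2 : ℝ)
  rw [h1, zero_add]
  ring

lemma integrable_abs_add_rpow {y : ℝ} (hy : 0 < y) :
    Integrable fun s : ℝ => (|s| + y) ^ (-(3 / 2) : ℝ) := by
  -- A nonintegrable function has Bochner integral 0 by convention, so the nonzero value just
  -- computed proves integrability.
  refine Integrable.of_integral_ne_zero ?_
  rw [integral_abs_add_rpow hy]
  positivity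

end MonotoneCLT

namespace MonotoneCLT

open Filter Topology

/-! ### Comparison with the arcsine law -/

/-- Factor `z² - 2 = (z - √2)(z + √2)`. The factor for the endpoint on the opposite side from `x`
has modulus at least `√2`, which pays for `|s| + y ≤ √2 |s + iy|` in the other. -/
lemma abs_sub_add_le_norm_sq_sub_two (x y : ℝ) :
    |x - √2| + y ≤ ‖((x : ℂ) + y * Complex.I) ^ 2 - 2‖ ∨
      |x + √2| + y ≤ ‖((x : ℂ) + y * Complex.I) ^ 2 - 2‖ := by
  have h2 : (0 : ℝ) < √2 := by positivity
  have hs2 : √2 ^ 2 = 2 := Real.sq_sqrt zero_le_two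
  have hfac : ((x : ℂ) + y * Complex.I) ^ 2 - 2
      = (((x - √2 : ℝ) : ℂ) + y * Complex.I) * (((x + √2 : ℝ) : ℂ) + y * Complex.I) := by
    have : ((√2 : ℝ) : ℂ) ^ 2 = 2 := by rw [← Complex.ofReal_pow, hs2]; simp
    push_cast
    linear_combination this
  have hn : ∀ s : ℝ, ‖(s : ℂ) + y * Complex.I‖ ^ 2 = s ^ 2 + y ^ 2 := by
    intro s
    rw [← Complex.normSq_eq_norm_sq, Complex.normSq_apply]
    simp
    ring
  have key : ∀ s s' : ℝ, √2 ≤ |s'| →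
      |s| + y ≤ ‖(s : ℂ) + y * Complex.I‖ * ‖(s' : ℂ) + y * Complex.I‖ := by
    intro s s' hs'
    refine le_of_sq_le_sq ?_ (by positivity)
    rw [mul_pow, hn, hn]
    have h3 : 2 ≤ s' ^ 2 := by
      rw [← hs2, ← sq_abs s']
      exact pow_le_pow_left₀ h2.le hs' 2
    have h4 : (|s| + y) ^ 2 ≤ 2 * (s ^ 2 + y ^ 2) := by
      nlinarith [sq_nonneg (|s| - y), sq_abs s]
    nlinarith [sq_nonneg s, sq_nonneg y, mul_nonneg (add_nonneg (sq_nonneg s) (sq_nonneg y))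
      (by nlinarith [sq_nonneg y] : 0 ≤ s' ^ 2 + y ^ 2 - 2)]
  rw [hfac, norm_mul]
  rcases le_total 0 x with hx | hx
  · left
    exact key _ _ (by rw [abs_of_nonneg (by linarith)]; linarith)
  · right
    rw [mul_comm]
    exact key _ _ (by rw [abs_of_nonpos (by linarith)]; linarith)

/-- For `|x| ≥ 1/2` use `xy = Re b · Im b`; for smaller `|x|` the real part of `z² - 2` forces `|b|
≥ 1`. This is the separation of the two square roots. -/
lemma half_lt_norm_mul {x y : ℝ} (hy : 0 < y) {b : ℂ} (hb : 0 < b.im)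
    (hb2 : b ^ 2 = ((x : ℂ) + y * Complex.I) ^ 2 - 2) : y / 2 < ‖b‖ * (y + b.im) := by
  have hb0 : 0 < ‖b‖ := norm_pos_iff.2 (by rintro rfl; simp at hb)
  have him := congrArg Complex.im hb2
  have hre := congrArg Complex.re hb2
  simp [sq] at him hre
  have hn : ‖b‖ ^ 2 = b.re * b.re + b.im * b.im := by
    rw [← Complex.normSq_eq_norm_sq, Complex.normSq_apply]
  rcases le_or_gt (1 / 2) |x| with hx | hx
  · have h1 : |x| * y = |b.re| * b.im := by
      have : x * y = b.re * b.im := by linarith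
      rw [← abs_of_pos hy, ← abs_mul, this, abs_mul, abs_of_pos hb]
    have h2 := Complex.abs_re_le_norm b
    nlinarith
  · have h1 : x ^ 2 < 1 := by
      rw [← sq_abs]
      nlinarith [abs_nonneg x]
    have h2 : 1 ≤ ‖b‖ ^ 2 := by nlinarith [sq_nonneg b.re, sq_nonneg y]
    have h3 : 1 ≤ ‖b‖ := by nlinarith
    nlinarith

/-- Closeness of squares gives closeness of `a` to `b` rather than to `-b` because both lie in the
upper half-plane. Then `1/a - 1/b` is of size `y / |b|³`, and `|b|² = |z² - 2|` is bounded below by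
the distance to an endpoint. -/
lemma norm_inv_sub_inv_le {x y : ℝ} (hy : 0 < y) {a b : ℂ} (ha : y ≤ a.im) (hb : 0 < b.im)
    (hb2 : b ^ 2 = ((x : ℂ) + y * Complex.I) ^ 2 - 2)
    (hab : ‖a ^ 2 - (((x : ℂ) + y * Complex.I) ^ 2 - 2)‖ ≤ y / 2) :
    ‖1 / a - 1 / b‖ ≤ 5 / 7 * y *
      ((|x - √2| + y) ^ (-(3 / 2) : ℝ) + (|x + √2| + y) ^ (-(3 / 2) : ℝ)) := by
  have hb0 : 0 < ‖b‖ := norm_pos_iff.2 (by rintro rfl; simp at hb)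
  have ha0 : 0 < ‖a‖ := norm_pos_iff.2 (by rintro rfl; simp at ha; linarith)
  have ha1 : a ≠ 0 := norm_pos_iff.1 ha0
  have hb1 : b ≠ 0 := norm_pos_iff.1 hb0
  rw [← hb2] at hab
  have hfac : a ^ 2 - b ^ 2 = (a - b) * (a + b) := by ring
  -- Otherwise `|a - b| ≥ |b|` while `|a + b| ≥ y + Im b`, and the product exceeds `y / 2` by
  -- `half_lt_norm_mul`.
  have hsum : ‖b‖ ≤ ‖a + b‖ := by
    by_contra! hlt
    have h1 : ‖b‖ ≤ ‖a - b‖ := by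
      have h2 : ‖(2 : ℂ) * b‖ ≤ ‖a + b‖ + ‖a - b‖ := by
        have : (2 : ℂ) * b = (a + b) - (a - b) := by ring
        rw [this]
        exact norm_sub_le _ _
      rw [norm_mul] at h2
      norm_num at h2
      linarith
    have h2 : y + b.im ≤ ‖a + b‖ := by
      refine le_trans ?_ ((le_abs_self _).trans (Complex.abs_im_le_norm (a + b)))
      rw [Complex.add_im]
      linarith
    have h3 := half_lt_norm_mul hy hb hb2
    rw [hfac, norm_mul] at hab
    have h4 := mul_le_mul h1 h2 (by linarith) (norm_nonneg _)
    linarith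
  have hy_le : ∀ s : ℝ, y ≤ |s| + y := fun s => by linarith [abs_nonneg s]
  have hbn : ‖b‖ ^ 2 = ‖((x : ℂ) + y * Complex.I) ^ 2 - 2‖ := by rw [← norm_pow, hb2]
  have hyb : y ≤ ‖b‖ ^ 2 := by
    rw [hbn]
    rcases abs_sub_add_le_norm_sq_sub_two x y with h | h
    · exact (hy_le _).trans h
    · exact (hy_le _).trans h
  -- From `y ≤ |b|²` one gets `|a|² ≥ |b|² / 2`, and `7/10` is a rational lower bound for `1/√2`;
  -- hence the final `5/7 = (1/2) / (7/10)`.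
  have hab7 : 7 / 10 * ‖b‖ ≤ ‖a‖ := by
    refine le_of_sq_le_sq ?_ ha0.le
    have h1 : ‖b‖ ^ 2 ≤ ‖a‖ ^ 2 + y / 2 := by
      rw [← norm_pow, ← norm_pow]
      have h2 : b ^ 2 = a ^ 2 - (a ^ 2 - b ^ 2) := by ring
      rw [h2]
      exact (norm_sub_le _ _).trans (by linarith)
    nlinarith
  have hdiff : 1 / a - 1 / b = -(a ^ 2 - b ^ 2) / (a * b * (a + b)) := by
    have h1 : a + b ≠ 0 := norm_pos_iff.1 (hb0.trans_le hsum)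
    field_simp
    ring
  have h1 : ‖1 / a - 1 / b‖ ≤ 5 / 7 * y * (‖b‖ ^ 3)⁻¹ := by
    rw [hdiff, norm_div, norm_neg, norm_mul, norm_mul]
    have h2 : 7 / 10 * ‖b‖ ^ 3 ≤ ‖a‖ * ‖b‖ * ‖a + b‖ := by
      have := mul_le_mul (mul_le_mul_of_nonneg_right hab7 hb0.le) hsum hb0.le (by positivity)
      refine le_trans (le_of_eq ?_) this
      ring
    calc _ ≤ (y / 2) / (7 / 10 * ‖b‖ ^ 3) := div_le_div₀ (by positivity) hab (by positivity) h2
      _ = _ := by field_simp; norm_num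
  refine h1.trans (mul_le_mul_of_nonneg_left ?_ (by positivity))
  have h3 : (‖b‖ ^ 3)⁻¹ = (‖b‖ ^ 2) ^ (-(3 / 2) : ℝ) := by
    rw [← Real.rpow_natCast ‖b‖ 2, ← Real.rpow_mul hb0.le, ← Real.rpow_natCast ‖b‖ 3,
      ← Real.rpow_neg hb0.le]
    norm_num
  rw [h3, hbn]
  have hpos : ∀ s : ℝ, 0 < |s| + y := fun s => by positivity
  rcases abs_sub_add_le_norm_sq_sub_two x y with h | h
  · have := Real.rpow_le_rpow_of_nonpos (hpos _) h (by norm_num : (-(3 / 2) : ℝ) ≤ 0)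
    have := Real.rpow_nonneg (hpos (x + √2)).le (-(3 / 2))
    linarith
  · have := Real.rpow_le_rpow_of_nonpos (hpos _) h (by norm_num : (-(3 / 2) : ℝ) ≤ 0)
    have := Real.rpow_nonneg (hpos (x - √2)).le (-(3 / 2))
    linarith

/-- If on a horizontal line at height `y` the square of the `F`-transform of `α` is within `y / 2`
of `z² - 2`, then `α` is within `8 √y` of the arcsine law in Kolmogorov distance. -/
theorem kolmogorovDist_arcsineLaw_le {α : Measure ℝ} [IsProbabilityMeasure α] {y : ℝ} (hy : 0 < y)
    (h : ∀ x : ℝ, ‖fTransform α (x + y * Complex.I) ^ 2 - (((x : ℂ) + y * Complex.I) ^ 2 - 2)‖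
      ≤ y / 2) : kolmogorovDist α arcsineLaw ≤ 8 * √y := by
  have hpi := Real.pi_pos
  have hz : ∀ x : ℝ, 0 < ((x : ℂ) + y * Complex.I).im := fun x => by simpa using hy
  set k : ℝ → ℝ := fun s => (|s| + y) ^ (-(3 / 2) : ℝ) with hk
  have hki : Integrable k := integrable_abs_add_rpow hy
  set g : ℝ → ℝ := fun x => 5 / 7 * y * (k (x - √2) + k (x + √2)) with hg
  have hgi : Integrable g := ((hki.comp_sub_right _).add (hki.comp_add_right _)).const_mul _
  have hgint : ∫ x, g x = 40 / 7 * √y := by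
    simp only [hg]
    rw [integral_const_mul, integral_add (hki.comp_sub_right _) (hki.comp_add_right _),
      integral_sub_right_eq_self k, integral_add_right_eq_self k, integral_abs_add_rpow hy]
    have : y * y ^ (-(1 / 2) : ℝ) = √y := by
      rw [Real.sqrt_eq_rpow]
      nth_rewrite 1 [← Real.rpow_one y]
      rw [← Real.rpow_add hy]
      norm_num
    linear_combination (40 / 7) * this
  have hinv : ∀ (σ : Measure ℝ) (z : ℂ), cauchyTransform σ z = 1 / fTransform σ z := fun σ z => by
    rw [fTransform_eq, one_div_one_div]
  have hdiff : ∀ x : ℝ, ‖cauchyTransform α (x + y * Complex.I)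
      - cauchyTransform arcsineLaw (x + y * Complex.I)‖ ≤ g x := by
    intro x
    rw [hinv, hinv]
    refine norm_inv_sub_inv_le hy ?_ ?_ (fTransform_arcsineLaw_sq (hz x)) (h x)
    · simpa using im_le_im_fTransform (σ := α) (hz x)
    · exact (hz x).trans_le (im_le_im_fTransform (hz x))
  have hG : ∀ (σ : Measure ℝ) [IsProbabilityMeasure σ],
      Integrable fun u : ℝ => (cauchyTransform σ (u + y * Complex.I)).im := by
    intro σ _
    have h1 := (integrable_prod_poissonDensity hy σ).integral_prod_right
    simp only [integral_poissonDensity_sub hy σ] at h1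
    refine (h1.const_mul (-Real.pi)).congr (ae_of_all _ fun u => ?_)
    simp only []
    field_simp
  have hS : ∀ x, |∫ s, (α.real (Set.Iic (x - s)) - arcsineLaw.real (Set.Iic (x - s)))
      * poissonDensity y s| ≤ 1 / Real.pi * (40 / 7 * √y) := by
    intro x
    have h1 : ∫ s, (α.real (Set.Iic (x - s)) - arcsineLaw.real (Set.Iic (x - s)))
        * poissonDensity y s = -(1 / Real.pi) * ∫ u in Set.Iic x,
          ((cauchyTransform α (u + y * Complex.I)).im
            - (cauchyTransform arcsineLaw (u + y * Complex.I)).im) := by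
      simp_rw [sub_mul]
      rw [integral_sub (integrable_real_Iic_mul_poissonDensity hy α x)
        (integrable_real_Iic_mul_poissonDensity hy arcsineLaw x),
        integral_real_Iic_mul_poissonDensity hy, integral_real_Iic_mul_poissonDensity hy,
        integral_sub (hG α).integrableOn (hG arcsineLaw).integrableOn]
      ring
    rw [h1, abs_mul, abs_neg, abs_of_pos (by positivity : 0 < 1 / Real.pi), ← hgint]
    refine mul_le_mul_of_nonneg_left ?_ (by positivity)
    have h2 : ‖∫ u in Set.Iic x, ((cauchyTransform α (u + y * Complex.I)).im
        - (cauchyTransform arcsineLaw (u + y * Complex.I)).im)‖ ≤ ∫ u in Set.Iic x, g u := by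
      refine norm_integral_le_of_norm_le hgi.integrableOn (ae_of_all _ fun u => ?_)
      rw [← Complex.sub_im]
      exact (Complex.abs_im_le_norm _).trans (hdiff u)
    refine h2.trans (setIntegral_le_integral hgi (ae_of_all _ fun u => ?_))
    exact (norm_nonneg _).trans (hdiff u)
  have hω : ∀ x, arcsineLaw.real (Set.Ioc x (x + 2 * (√3 * y))) ≤ 111 / 100 * √y := by
    intro x
    refine (arcsineLaw_real_Ioc_le (by positivity)).trans ?_
    rw [Real.sqrt_le_left (by positivity), mul_pow, Real.sq_sqrt hy.le,
      div_le_iff₀ (by positivity)]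
    have h3 : √3 ≤ 1.7321 := by
      rw [Real.sqrt_le_left (by norm_num)]; norm_num
    have h2 : 1.4142 ≤ √2 := Real.le_sqrt_of_sq_le (by norm_num)
    nlinarith
  -- The numerical total `3 · 40 / (7π) + 2 · 1.11` is below 8.
  refine (kolmogorovDist_le_of_smoothed hy hS hω).trans ?_
  have h1 : 1 / Real.pi ≤ 1 / 3.14 := one_div_le_one_div_of_le (by norm_num) Real.pi_gt_d2.le
  have h2 := Real.sqrt_nonneg y
  nlinarith

end MonotoneCLT

namespace MonotoneCLT

open Filter Topology

/-! ### Iteration estimates -/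

/-- The difference is the integral of `t / (w - t)`; this is the only place where a first absolute
moment turns into a rate. -/
lemma norm_mul_cauchyTransform_sub_le {τ : Measure ℝ} [IsFiniteMeasure τ] (hτ : Integrable id τ)
    {w : ℂ} (hw : 0 < w.im) :
    ‖w * cauchyTransform τ w - τ.real Set.univ‖ ≤ absMoment τ / w.im := by
  have h1 : w * cauchyTransform τ w - τ.real Set.univ = ∫ t : ℝ, (t : ℂ) / (w - t) ∂τ := by
    have h2 : ((τ.real Set.univ : ℝ) : ℂ) = ∫ _ : ℝ, (1 : ℂ) ∂τ := by simp
    rw [cauchyTransform, ← integral_const_mul, h2,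
      ← integral_sub ((integrable_one_div_sub hw).const_mul _) (integrable_const _)]
    refine integral_congr_ae (ae_of_all _ fun t => ?_)
    have := sub_ofReal_ne_zero hw t
    simp only []
    field_simp
    ring
  rw [h1]
  refine (norm_integral_div_sub_le hw hτ.ofReal).trans (le_of_eq ?_)
  simp [absMoment]

section Iterate

variable {μ ν : Measure ℝ} [IsProbabilityMeasure μ] [IsProbabilityMeasure ν]

/-- Each step changes `w²` by `-2 w G_ν(w) + G_ν(w)²`, that is by -2 up to an error bounded at the
initial height; the `n` errors are added. -/
lemma norm_iterate_sq_sub_le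
    (h : ∀ z : ℂ, 0 < z.im → fTransform μ z = z - cauchyTransform ν z) (hν : Integrable id ν)
    {Z : ℂ} (hZ : 0 < Z.im) (n : ℕ) :
    ‖(fTransform μ)^[n] Z ^ 2 - (Z ^ 2 - 2 * n)‖
      ≤ n * (2 * (absMoment ν / Z.im) + (1 / Z.im) ^ 2) := by
  induction n with
  | zero => simp
  | succ n ih =>
    have hw := im_iterate_fTransform_pos (μ := μ) n hZ
    have hZw := im_le_im_iterate_fTransform (μ := μ) n hZ
    rw [Function.iterate_succ_apply', h _ hw]
    set w := (fTransform μ)^[n] Z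
    have h1 := norm_mul_cauchyTransform_sub_le hν hw
    have h2 := norm_cauchyTransform_le (σ := ν) hw
    rw [probReal_univ] at h1 h2
    have hc0 : 0 ≤ absMoment ν := integral_nonneg fun t => abs_nonneg t
    have h3 : absMoment ν / w.im ≤ absMoment ν / Z.im := div_le_div_of_nonneg_left hc0 hZ hZw
    have h4 : 1 / w.im ≤ 1 / Z.im := one_div_le_one_div_of_le hZ hZw
    have e : (w - cauchyTransform ν w) ^ 2 - (Z ^ 2 - 2 * ((n + 1 : ℕ) : ℂ))
        = (w ^ 2 - (Z ^ 2 - 2 * n)) - 2 * (w * cauchyTransform ν w - (1 : ℝ))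
          + cauchyTransform ν w ^ 2 := by
      push_cast
      ring
    rw [e]
    have h5 := norm_add_le ((w ^ 2 - (Z ^ 2 - 2 * n)) - 2 * (w * cauchyTransform ν w - (1 : ℝ)))
      (cauchyTransform ν w ^ 2)
    have h6 := norm_sub_le (w ^ 2 - (Z ^ 2 - 2 * n)) (2 * (w * cauchyTransform ν w - (1 : ℝ)))
    rw [norm_mul] at h6
    rw [norm_pow] at h5
    have h7 := pow_le_pow_left₀ (norm_nonneg _) (h2.trans h4) 2
    have h8 : ‖(2 : ℂ)‖ = 2 := by norm_num
    rw [h8] at h6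
    rw [Nat.cast_succ]
    linarith

/-- With `R = -G_ρ`, the identity `(w - m + R) G = 1` makes the left side exactly `2RG + G²`.
Bounding it by the resolvent integral instead of a power of `Y` is what lets the errors telescope.
-/
lemma norm_step_le {ρ : Measure ℝ} [IsFiniteMeasure ρ] {m : ℝ} (hρ : Integrable id ρ)
    (hF : ∀ z : ℂ, 0 < z.im → fTransform ν z = z - m - cauchyTransform ρ z) {Y : ℝ} (hY : 0 < Y)
    {w : ℂ} (hw : Y ≤ w.im) :
    ‖(w - cauchyTransform ν w) ^ 2 - (w ^ 2 - 2 - 2 * m * cauchyTransform ν w)‖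
      ≤ (1 + 2 * (ρ.real Set.univ + (absMoment ρ + |m| * ρ.real Set.univ) / Y))
        * sqResolventIntegral ν w := by
  have hw0 : 0 < w.im := hY.trans_le hw
  set r := ρ.real Set.univ with hr
  set d := absMoment ρ with hd
  have hr0 : 0 ≤ r := measureReal_nonneg
  have hd0 : 0 ≤ d := integral_nonneg fun t => abs_nonneg t
  set G := cauchyTransform ν w with hG
  set R := -cauchyTransform ρ w with hR
  set F := fTransform ν w with hFdef
  have hFR : F = w - m + R := by rw [hFdef, hF w hw0, hR]; ring
  have hG0 : G ≠ 0 := cauchyTransform_ne_zero hw0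
  have hFG : F * G = 1 := by rw [hFdef, fTransform_eq, one_div, inv_mul_cancel₀ hG0]
  set I := sqResolventIntegral ρ w with hI
  set J := sqResolventIntegral ν w with hJ
  have hI0 : 0 ≤ I := sqResolventIntegral_nonneg
  have hJ0 : 0 ≤ J := sqResolventIntegral_nonneg
  -- Two expressions for `Im F_ν(w)`, one from `ν` and one from `ρ`, are compared.
  have hJI : J = ‖G‖ ^ 2 * (1 + I) := by
    have h1 := im_fTransform (σ := ν) hw0
    rw [← hFdef, ← hJ, ← hG] at h1
    have h2 : F.im = w.im * (1 + I) := by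
      rw [hFR, hR]
      simp only [Complex.add_im, Complex.sub_im, Complex.ofReal_im, Complex.neg_im,
        im_cauchyTransform hw0]
      ring
    rw [h2, eq_div_iff (by positivity)] at h1
    have := mul_left_cancel₀ hw0.ne' (show w.im * ((1 + I) * ‖G‖ ^ 2) = w.im * J by linarith)
    linarith
  have hG2 : ‖G‖ ^ 2 ≤ J := by
    have := sq_norm_cauchyTransform_le (σ := ν) hw0
    rwa [probReal_univ, one_mul] at this
  have hRn : ‖R‖ ≤ r / Y := by
    rw [hR, norm_neg]
    exact (norm_cauchyTransform_le hw0).trans (div_le_div_of_nonneg_left hr0 hY hw)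
  have hR2 : ‖R‖ ^ 2 ≤ r * I := by
    rw [hR, norm_neg]
    exact sq_norm_cauchyTransform_le hw0
  have hRw : ‖R * w‖ ≤ r + d / Y := by
    have h1 := norm_mul_cauchyTransform_sub_le hρ hw0
    have h2 : ‖w * cauchyTransform ρ w‖ ≤ ‖w * cauchyTransform ρ w - (r : ℝ)‖ + ‖((r : ℝ) : ℂ)‖ := by
      simpa using norm_add_le (w * cauchyTransform ρ w - (r : ℝ)) ((r : ℝ) : ℂ)
    rw [Complex.norm_real, Real.norm_of_nonneg hr0] at h2
    have h3 : d / w.im ≤ d / Y := div_le_div_of_nonneg_left hd0 hY hw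
    have h4 : ‖R * w‖ = ‖w * cauchyTransform ρ w‖ := by rw [hR, neg_mul, norm_neg, mul_comm]
    linarith
  have hRF : ‖R * F‖ ≤ (r + (d + |m| * r) / Y) * (1 + I) := by
    have e : R * F = R * w - m * R + R ^ 2 := by rw [hFR]; ring
    have h1 := norm_add_le (R * w - m * R) (R ^ 2)
    have h2 := norm_sub_le (R * w) (m * R)
    rw [norm_mul (m : ℂ), Complex.norm_real, Real.norm_eq_abs] at h2
    rw [norm_pow] at h1
    have h3 := mul_le_mul_of_nonneg_left hRn (abs_nonneg m)
    have h4 : 0 ≤ (d + |m| * r) / Y * I := by positivity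
    have h5 : (d + |m| * r) / Y = d / Y + |m| * (r / Y) := by ring
    rw [e]
    nlinarith
  -- Writing `RG = (RF) G²` trades the bound for `RF`, which allows a factor `1 + I`, for a multiple
  -- of `J` via `hJI`.
  have hRG : ‖R * G‖ ≤ (r + (d + |m| * r) / Y) * J := by
    have e : R * G = (R * F) * G ^ 2 := by linear_combination (-R * G) * hFG
    rw [e, norm_mul, norm_pow, hJI]
    have := mul_le_mul_of_nonneg_right hRF (sq_nonneg ‖G‖)
    linarith
  have e : (w - G) ^ 2 - (w ^ 2 - 2 - 2 * m * G) = 2 * (R * G) + G ^ 2 := by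
    rw [hFR] at hFG
    linear_combination (-2 : ℂ) * hFG
  rw [e]
  have h1 := norm_add_le (2 * (R * G)) (G ^ 2)
  rw [norm_mul, norm_pow] at h1
  have h8 : ‖(2 : ℂ)‖ = 2 := by norm_num
  rw [h8] at h1
  linarith

/-- The terms `2m G_ν` sum to `2m (Z - F^n(Z))` exactly. The errors sum to the growth of the
imaginary part over `Im Z`, and the second conclusion limits that growth to order `√n`; the two run
in one induction. -/
lemma norm_iterate_sq_sub_le_of_second {ρ : Measure ℝ} [IsFiniteMeasure ρ] {m : ℝ}
    (hμ : ∀ z : ℂ, 0 < z.im → fTransform μ z = z - cauchyTransform ν z) (hρ : Integrable id ρ)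
    (hF : ∀ z : ℂ, 0 < z.im → fTransform ν z = z - m - cauchyTransform ρ z) {Z : ℂ}
    (hZ : 1 ≤ Z.im) (n : ℕ) :
    ‖(fTransform μ)^[n] Z ^ 2 - (Z ^ 2 - 2 * n - 2 * m * (Z - (fTransform μ)^[n] Z))‖
      ≤ (1 + 2 * (ρ.real Set.univ + (absMoment ρ + |m| * ρ.real Set.univ) / Z.im))
        * ((((fTransform μ)^[n] Z).im - Z.im) / Z.im) ∧
    ((fTransform μ)^[n] Z).im ^ 2 ≤ Z.im ^ 2 + 3 * n := by
  have hZ0 : 0 < Z.im := by linarith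
  have hr0 : 0 ≤ ρ.real Set.univ := measureReal_nonneg
  have hd0 : 0 ≤ absMoment ρ := integral_nonneg fun t => abs_nonneg t
  set B := 1 + 2 * (ρ.real Set.univ + (absMoment ρ + |m| * ρ.real Set.univ) / Z.im) with hB
  have hB0 : 0 ≤ B := by positivity
  induction n with
  | zero => simp
  | succ n ih =>
    obtain ⟨ih1, ih2⟩ := ih
    have hw := im_iterate_fTransform_pos (μ := μ) n hZ0
    have hZw := im_le_im_iterate_fTransform (μ := μ) n hZ0
    have h1 := norm_step_le hρ hF hZ0 hZw
    rw [Function.iterate_succ_apply', hμ _ hw]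
    set w := (fTransform μ)^[n] Z
    set J := sqResolventIntegral ν w with hJ
    have hJ0 : 0 ≤ J := sqResolventIntegral_nonneg
    have hJ1 : J ≤ 1 / w.im ^ 2 := by simpa using sqResolventIntegral_le (σ := ν) hw
    have him : (w - cauchyTransform ν w).im = w.im + w.im * J := by
      rw [Complex.sub_im, im_cauchyTransform hw]
      ring
    constructor
    · have e : (w - cauchyTransform ν w) ^ 2
          - (Z ^ 2 - 2 * ((n + 1 : ℕ) : ℂ) - 2 * m * (Z - (w - cauchyTransform ν w)))
          = (w ^ 2 - (Z ^ 2 - 2 * n - 2 * m * (Z - w)))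
            + ((w - cauchyTransform ν w) ^ 2 - (w ^ 2 - 2 - 2 * m * cauchyTransform ν w)) := by
        push_cast
        ring
      rw [e, him]
      refine (norm_add_le _ _).trans ((add_le_add ih1 h1).trans ?_)
      -- The product `w.im * J` is the increment of the imaginary part in this step.
      have h2 : J ≤ w.im * J / Z.im := by
        rw [le_div_iff₀ hZ0, mul_comm]
        exact mul_le_mul_of_nonneg_right hZw hJ0
      have h3 := mul_le_mul_of_nonneg_left h2 hB0
      have h4 : (w.im + w.im * J - Z.im) / Z.im = (w.im - Z.im) / Z.im + w.im * J / Z.im := by ring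
      rw [h4, mul_add]
      linarith
    · rw [him]
      have hw1 : 1 ≤ w.im := hZ.trans hZw
      have h2 : w.im * J ≤ 1 / w.im := by
        calc w.im * J ≤ w.im * (1 / w.im ^ 2) := mul_le_mul_of_nonneg_left hJ1 hw.le
          -- Heights are at least 1, so the increment is at most `1 / Im w ≤ 1`; the square of the
          -- height then grows by at most `2 + 1 = 3`.
          _ = _ := by field_simp
      have h3 : 1 / w.im ≤ 1 := by rw [div_le_one hw]; exact hw1
      have h4 : w.im * (1 / w.im) = 1 := by field_simp
      have h5 : 0 ≤ w.im * J := by positivity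
      push_cast
      nlinarith

end Iterate

/-- If `a` and `b` are in the closed upper half-plane and `a² ≈ b² - 2` then `|a - b| ≤ 3`. -/
lemma norm_sub_le_three {a b : ℂ} (ha : 0 ≤ a.im) (hb : 0 < b.im) (hb1 : b.im ≤ 1 / 2)
    (h : ‖a ^ 2 - (b ^ 2 - 2)‖ ≤ b.im / 2) : ‖a - b‖ ≤ 3 := by
  rcases lt_or_ge |b.re| (1 / 2) with hx | hx
  · have h1 : ‖b‖ ≤ 1 := by
      have := Complex.norm_le_abs_re_add_abs_im b
      rw [abs_of_pos hb] at this
      linarith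
    have h2 : ‖a‖ ^ 2 ≤ 4 := by
      have e : a ^ 2 = (a ^ 2 - (b ^ 2 - 2)) + b ^ 2 - 2 := by ring
      have h3 := norm_sub_le ((a ^ 2 - (b ^ 2 - 2)) + b ^ 2) 2
      have h4 := norm_add_le (a ^ 2 - (b ^ 2 - 2)) (b ^ 2)
      rw [← e, norm_pow] at h3
      rw [norm_pow b] at h4
      have h5 : ‖(2 : ℂ)‖ = 2 := by norm_num
      have h6 := pow_le_one₀ (n := 2) (norm_nonneg b) h1
      linarith
    have h3 : ‖a‖ ≤ 2 := by nlinarith [norm_nonneg a]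
    have := norm_sub_le a b
    linarith
  · have him := (Complex.abs_im_le_norm (a ^ 2 - (b ^ 2 - 2))).trans h
    simp [sq] at him
    rw [abs_le] at him
    -- Comparing imaginary parts, `2 Re b Im b` exceeds the error in modulus, so `Re a` cannot have
    -- the sign opposite to `Re b`. Hence `|a - b| ≤ |a + b|`, and the product of the two is at most
    -- `5/2`.
    have hre : 0 ≤ a.re * b.re := by
      by_contra! hneg
      rcases le_abs.1 hx with h1 | h1
      · have h2 : a.re < 0 := by nlinarith
        nlinarith [mul_nonneg ha (neg_nonneg.2 h2.le)]
      · have h2 : 0 < a.re := by nlinarith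
        nlinarith [mul_nonneg ha h2.le]
    have h1 : ‖a - b‖ ^ 2 ≤ ‖a + b‖ ^ 2 := by
      rw [← Complex.normSq_eq_norm_sq, ← Complex.normSq_eq_norm_sq, Complex.normSq_apply,
        Complex.normSq_apply]
      simp only [Complex.sub_re, Complex.sub_im, Complex.add_re, Complex.add_im]
      nlinarith [mul_nonneg ha hb.le]
    have h2 : ‖a - b‖ ≤ ‖a + b‖ := le_of_sq_le_sq h1 (norm_nonneg _)
    have h3 : ‖a - b‖ * ‖a + b‖ ≤ 5 / 2 := by
      rw [← norm_mul]
      have e : (a - b) * (a + b) = (a ^ 2 - (b ^ 2 - 2)) - 2 := by ring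
      rw [e]
      have h5 : ‖(2 : ℂ)‖ = 2 := by norm_num
      have := norm_sub_le (a ^ 2 - (b ^ 2 - 2)) 2
      linarith
    nlinarith [norm_nonneg (a - b)]

/-! ### Choice of the smoothing height and the two rates. -/

section Rates

variable {μ ν : Measure ℝ} [IsProbabilityMeasure μ] [IsProbabilityMeasure ν]

lemma kolmogorovDist_normalizedPower_le
    (h : ∀ z : ℂ, 0 < z.im → fTransform μ z = z - cauchyTransform ν z) (hν : Integrable id ν)
    {k q : ℝ} (hk : 0 < k) (hck : absMoment ν = k ^ 2) (hq : 0 < q) {n : ℕ} (hn : (n : ℝ) = q ^ 4)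
    (hkq : 1 ≤ 8 * k ^ 3 * q) :
    kolmogorovDist (normalizedPower μ n) arcsineLaw ≤ 16 * √(k / q) := by
  have hex := exists_isMonotonePower h n
  have := isProbabilityMeasure_normalizedPower hex
  have hn0 : 0 < n := by
    have : (0 : ℝ) < n := by rw [hn]; positivity
    exact_mod_cast this
  have hs : √(n : ℝ) = q ^ 2 := by
    rw [hn, Real.sqrt_eq_iff_mul_self_eq (by positivity) (by positivity)]
    ring
  -- With `k = √c` and `q = n^{1/4}`, this height makes the main error `2c / (√n y)` equal to `y /
  -- 8`.
  set y := 4 * k / q with hy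
  have hy0 : 0 < y := by positivity
  have hmain : kolmogorovDist (normalizedPower μ n) arcsineLaw ≤ 8 * √y := by
    refine kolmogorovDist_arcsineLaw_le hy0 fun x => ?_
    set z : ℂ := (x : ℂ) + y * Complex.I with hz
    have hzim : z.im = y := by simp [hz]
    rw [fTransform_normalizedPower hn0 hex (by rw [hzim]; exact hy0), hs]
    have hZim : ((((q ^ 2 : ℝ) : ℂ)) * z).im = 4 * k * q := by
      rw [Complex.im_ofReal_mul, hzim, hy]
      field_simp
    have h1 := norm_iterate_sq_sub_le h hν (Z := ((q ^ 2 : ℝ) : ℂ) * z)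
      (by rw [hZim]; positivity) n
    rw [hZim, hck] at h1
    set W := (fTransform μ)^[n] (((q ^ 2 : ℝ) : ℂ) * z)
    have hqc : (q : ℂ) ≠ 0 := by exact_mod_cast hq.ne'
    have hnc : (n : ℂ) = (q : ℂ) ^ 4 := by exact_mod_cast congrArg (fun x : ℝ => (x : ℂ)) hn
    have e : (W / ((q ^ 2 : ℝ) : ℂ)) ^ 2 - (z ^ 2 - 2)
        = (W ^ 2 - ((((q ^ 2 : ℝ) : ℂ) * z) ^ 2 - 2 * n)) / ((q ^ 4 : ℝ) : ℂ) := by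
      rw [hnc]
      push_cast
      field_simp
    rw [e, norm_div, Complex.norm_real, Real.norm_of_nonneg (by positivity),
      div_le_iff₀ (by positivity)]
    refine h1.trans ?_
    rw [hn, mul_comm]
    refine mul_le_mul_of_nonneg_right ?_ (by positivity)
    have e1 : 2 * (k ^ 2 / (4 * k * q)) = y / 8 := by
      rw [hy]; field_simp; norm_num
    -- Equivalent to `1 ≤ 8 k³ q`, the source of the threshold `(8 c √c)⁻⁴`.
    have e2 : (1 / (4 * k * q)) ^ 2 ≤ y / 8 := by
      rw [hy, div_pow, one_pow, div_div, div_le_div_iff₀ (by positivity) (by positivity)]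
      have : 0 < k * q := by positivity
      nlinarith [mul_pos hk hq, mul_pos hq hq]
    linarith
  refine hmain.trans (le_of_eq ?_)
  have : √y = 2 * √(k / q) := by
    rw [hy, mul_div_assoc, Real.sqrt_mul (by norm_num)]
    have : √(4 : ℝ) = 2 := by
      rw [Real.sqrt_eq_iff_mul_self_eq (by norm_num) (by norm_num)]; norm_num
    rw [this]
  rw [this]
  ring

lemma kolmogorovDist_normalizedPower_le_of_second {ρ : Measure ℝ} [IsFiniteMeasure ρ]
    (hμ : ∀ z : ℂ, 0 < z.im → fTransform μ z = z - cauchyTransform ν z) (hρ : Integrable id ρ)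
    (hF : ∀ z : ℂ, 0 < z.im → fTransform ν z = z - (∫ t, t ∂ν : ℝ) - cauchyTransform ρ z)
    {s : ℝ} (hs : 0 < s) {n : ℕ} (hn : (n : ℝ) = s ^ 2) (hDs : 8 * rateConst ν ρ ≤ s) :
    kolmogorovDist (normalizedPower μ n) arcsineLaw ≤ 16 * √(rateConst ν ρ / s) := by
  have hex := exists_isMonotonePower hμ n
  have := isProbabilityMeasure_normalizedPower hex
  have hn0 : 0 < n := by
    have : (0 : ℝ) < n := by rw [hn]; positivity
    exact_mod_cast this
  have hsn : √(n : ℝ) = s := by rw [hn, Real.sqrt_sq hs.le]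
  have hr := measureReal_univ_of_fTransform_eq (integrable_sq_of_fTransform_eq hF) hF
  have hr0 : 0 ≤ ρ.real Set.univ := measureReal_nonneg
  have hd0 : 0 ≤ absMoment ρ := integral_nonneg fun t => abs_nonneg t
  have hm20 : 0 ≤ ∫ t, t ^ 2 ∂ν := integral_nonneg fun t => sq_nonneg t
  have hDdef : rateConst ν ρ = absMoment ρ + 3 * (1 + ∫ t, t ^ 2 ∂ν) ^ 2 := rfl
  set D := rateConst ν ρ with hD
  set m := ∫ t, t ∂ν with hm
  set m₂ := ∫ t, t ^ 2 ∂ν with hm2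
  set r := ρ.real Set.univ with hrdef
  set d := absMoment ρ with hd
  have hr2 : r ≤ m₂ := by nlinarith [sq_nonneg m]
  have hm_le : |m| ≤ (1 + m₂) / 2 := by
    have : m ^ 2 ≤ m₂ := by linarith
    nlinarith [sq_nonneg (|m| - 1), sq_abs m]
  have hD3 : 3 ≤ D := by nlinarith
  have hmD : |m| ≤ D / 6 := by nlinarith
  have hm2D : 1 + m₂ ≤ D / 3 := by nlinarith
  have hB : 1 + 2 * (r + (d + |m| * r) / (4 * D)) ≤ D := by
    have h1 : |m| * r ≤ (1 + m₂) ^ 2 := by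
      have := mul_le_mul hm_le hr2 hr0 (by linarith)
      nlinarith
    have h2 : (d + |m| * r) / (4 * D) ≤ 1 / 4 := by
      rw [div_le_iff₀ (by linarith)]
      nlinarith [sq_nonneg (1 + m₂)]
    linarith
  -- The starting point then has imaginary part exactly `4 D`, independent of `n`; `8 D ≤ s` ensures
  -- `y ≤ 1/2`.
  set y := 4 * D / s with hy
  have hy0 : 0 < y := by positivity
  have hy1 : y ≤ 1 / 2 := by
    rw [hy, div_le_iff₀ hs]; linarith
  have hmain : kolmogorovDist (normalizedPower μ n) arcsineLaw ≤ 8 * √y := by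
    refine kolmogorovDist_arcsineLaw_le hy0 fun x => ?_
    set z : ℂ := (x : ℂ) + y * Complex.I with hz
    have hzim : z.im = y := by simp [hz]
    rw [fTransform_normalizedPower hn0 hex (by rw [hzim]; exact hy0), hsn]
    have hZim : ((s : ℂ) * z).im = 4 * D := by
      rw [Complex.im_ofReal_mul, hzim, hy]
      field_simp
    obtain ⟨h1, h2⟩ := norm_iterate_sq_sub_le_of_second hμ hρ hF (Z := (s : ℂ) * z)
      (by rw [hZim]; linarith) n
    have h3 := im_iterate_fTransform_pos (μ := μ) n (z := (s : ℂ) * z) (by rw [hZim]; linarith)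
    have h3' := im_le_im_iterate_fTransform (μ := μ) n (z := (s : ℂ) * z) (by rw [hZim]; linarith)
    rw [hZim] at h1 h2 h3'
    set W := (fTransform μ)^[n] ((s : ℂ) * z)
    have hv : W.im - 4 * D ≤ 2 * s := by
      have : W.im ≤ 4 * D + 2 * s := by
        refine le_of_sq_le_sq ?_ (by positivity)
        rw [hn] at h2
        nlinarith
      linarith
    have h4 : ‖W ^ 2 - (((s : ℂ) * z) ^ 2 - 2 * n - 2 * m * ((s : ℂ) * z - W))‖ ≤ s / 2 := by
      refine h1.trans ?_
      have h5 : (W.im - 4 * D) / (4 * D) ≤ 2 * s / (4 * D) :=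
        div_le_div_of_nonneg_right hv (by linarith)
      have h6 : 0 ≤ (W.im - 4 * D) / (4 * D) := div_nonneg (by linarith) (by linarith)
      calc _ ≤ D * (2 * s / (4 * D)) := mul_le_mul hB h5 h6 (by linarith)
        _ = s / 2 := by field_simp; norm_num
    have hsc : (s : ℂ) ≠ 0 := by exact_mod_cast hs.ne'
    have hnc : (n : ℂ) = (s : ℂ) ^ 2 := by exact_mod_cast congrArg (fun x : ℝ => (x : ℂ)) hn
    set F := W / (s : ℂ) with hFd
    set σ : ℂ := (m : ℂ) / s with hσ
    have hσn : ‖σ‖ ≤ y / 24 := by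
      rw [hσ, norm_div, Complex.norm_real, Complex.norm_real, Real.norm_eq_abs,
        Real.norm_of_nonneg hs.le, hy, div_le_iff₀ hs]
      have : 4 * D / s / 24 * s = D / 6 := by field_simp; norm_num
      rw [this]
      exact hmD
    have h5 : ‖F ^ 2 - (z ^ 2 - 2 - 2 * σ * (z - F))‖ ≤ y / 24 := by
      have e : F ^ 2 - (z ^ 2 - 2 - 2 * σ * (z - F))
          = (W ^ 2 - (((s : ℂ) * z) ^ 2 - 2 * n - 2 * m * ((s : ℂ) * z - W))) / ((s ^ 2 : ℝ) : ℂ) := by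
        rw [hnc, hFd, hσ]
        push_cast
        field_simp
      rw [e, norm_div, Complex.norm_real, Real.norm_of_nonneg (by positivity),
        div_le_iff₀ (by positivity)]
      refine h4.trans ?_
      have : y / 24 * s ^ 2 = D / 6 * s := by rw [hy]; field_simp; norm_num
      rw [this]
      nlinarith
    have hσim : σ.im = 0 := by
      rw [hσ, ← Complex.ofReal_div, Complex.ofReal_im]
    have hFim : 0 ≤ F.im := by
      rw [hFd, Complex.div_ofReal_im]
      positivity
    -- Completing the square absorbs the drift: `F - σ` and `z - σ` satisfy the same approximate
    -- relation as a pair without drift. The bound 3 makes the drift cost at most `2 · 3 · y / 24 =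
    -- y / 4`.
    have h6 : ‖(F - σ) - (z - σ)‖ ≤ 3 := by
      refine norm_sub_le_three ?_ ?_ ?_ ?_
      · rw [Complex.sub_im, hσim]; linarith
      · rw [Complex.sub_im, hσim, hzim]; linarith
      · rw [Complex.sub_im, hσim, hzim]; linarith
      · have e : (F - σ) ^ 2 - ((z - σ) ^ 2 - 2) = F ^ 2 - (z ^ 2 - 2 - 2 * σ * (z - F)) := by ring
        rw [e, Complex.sub_im, hσim, hzim]
        linarith
    rw [sub_sub_sub_cancel_right] at h6
    have e : F ^ 2 - (z ^ 2 - 2) = (F ^ 2 - (z ^ 2 - 2 - 2 * σ * (z - F))) + 2 * σ * (F - z) := by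
      ring
    rw [e]
    refine (norm_add_le _ _).trans ?_
    rw [norm_mul, norm_mul]
    have h8 : ‖(2 : ℂ)‖ = 2 := by norm_num
    rw [h8]
    have h9 := mul_le_mul hσn h6 (norm_nonneg _) (by positivity)
    linarith
  refine hmain.trans (le_of_eq ?_)
  have : √y = 2 * √(D / s) := by
    rw [hy, mul_div_assoc, Real.sqrt_mul (by norm_num)]
    have : √(4 : ℝ) = 2 := by
      rw [Real.sqrt_eq_iff_mul_self_eq (by norm_num) (by norm_num)]; norm_num
    rw [this]
  rw [this]
  ring

end Rates

end MonotoneCLT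

/-! ### The degenerate case and the symmetric Bernoulli law. -/

namespace MonotoneCLT
open Filter Topology

lemma integral_one_div_ofReal_sub (τ : Measure ℝ) (z : ℂ) :
    ∫ t : ℝ, 1 / ((t : ℂ) - z) ∂τ = -cauchyTransform τ z := by
  rw [cauchyTransform, ← integral_neg]
  exact integral_congr_ae (ae_of_all _ fun t => by
    change 1 / ((t : ℂ) - z) = -(1 / (z - t))
    rw [← neg_sub z (t : ℂ), one_div_neg_eq_neg_one_div])

lemma isNevanlinnaMeasure_iff {σ τ : Measure ℝ} : IsNevanlinnaMeasure σ τ ↔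
    IsFiniteMeasure τ ∧ ∀ z : ℂ, 0 < z.im →
      fTransform σ z = z - (∫ t, t ∂σ : ℝ) - cauchyTransform τ z := by
  simp_rw [IsNevanlinnaMeasure, integral_one_div_ofReal_sub, ← sub_eq_add_neg]

lemma integrable_id_of_integrable_sq {σ : Measure ℝ} [IsFiniteMeasure σ]
    (h : Integrable (fun t : ℝ => t ^ 2) σ) : Integrable id σ := by
  simpa [Function.id_def] using integrable_pow_of_le (j := 1) one_le_two h

lemma cauchyTransform_eq_of_ae_eq_zero {ν : Measure ℝ} [IsProbabilityMeasure ν]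
    (h : ∀ᵐ t ∂ν, t = 0) (z : ℂ) : cauchyTransform ν z = 1 / z := by
  rw [cauchyTransform, integral_congr_ae (g := fun _ => 1 / z)]
  · simp
  · filter_upwards [h] with t ht
    simp [ht]

lemma ae_eq_zero_of_absMoment_eq_zero {ν : Measure ℝ} (hν : Integrable id ν)
    (h : absMoment ν = 0) : ∀ᵐ t ∂ν, t = 0 := by
  have := (integral_eq_zero_iff_of_nonneg (fun t : ℝ => abs_nonneg t) hν.abs).1 h
  filter_upwards [this] with t ht
  exact abs_eq_zero.1 ht

lemma integrable_one_div_sq_add_one (σ : Measure ℝ) [IsFiniteMeasure σ] :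
    Integrable (fun t : ℝ => 1 / (t ^ 2 + 1)) σ := by
  have hm : Measurable fun t : ℝ => 1 / (t ^ 2 + 1) := measurable_const.div (by fun_prop)
  refine (integrable_const (1 : ℝ)).mono' hm.aestronglyMeasurable (ae_of_all _ fun t => ?_)
  rw [Real.norm_of_nonneg (by positivity)]
  exact div_le_one_of_le₀ (by nlinarith [sq_nonneg t]) (by positivity)

lemma re_I_mul_cauchyTransform (σ : Measure ℝ) [IsFiniteMeasure σ] :
    (Complex.I * cauchyTransform σ Complex.I).re = ∫ t : ℝ, 1 / (t ^ 2 + 1) ∂σ := by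
  simpa using re_mul_cauchyTransform σ one_pos

/-- Equality case: the mean of `1 / (t² + 1)` is 1 only if `t = 0` almost everywhere. -/
lemma ae_eq_zero_of_cauchyTransform_I {ν : Measure ℝ} [IsProbabilityMeasure ν]
    (h : cauchyTransform ν Complex.I = -Complex.I) : ∀ᵐ t ∂ν, t = 0 := by
  have h1 := re_I_mul_cauchyTransform ν
  have h2 : ∫ t : ℝ, (1 - 1 / (t ^ 2 + 1)) ∂ν = 0 := by
    rw [integral_sub (integrable_const _) (integrable_one_div_sq_add_one ν), ← h1, h]
    simp
  have h0 : ∀ t : ℝ, 1 - 1 / (t ^ 2 + 1) = t ^ 2 / (t ^ 2 + 1) := fun t => by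
    have : t ^ 2 + 1 ≠ 0 := by positivity
    field_simp
    ring
  have h3 := (integral_eq_zero_iff_of_nonneg (μ := ν) (f := fun t : ℝ => 1 - 1 / (t ^ 2 + 1))
    (fun t => (by positivity : (0 : ℝ) ≤ _).trans_eq (h0 t).symm)
    ((integrable_const _).sub (integrable_one_div_sq_add_one ν))).1 h2
  filter_upwards [h3] with t ht
  rw [h0] at ht
  have : t ^ 2 + 1 ≠ 0 := by positivity
  simpa [this] using ht

lemma absMoment_eq_zero_of_ae {ν : Measure ℝ} (h : ∀ᵐ t ∂ν, t = 0) : absMoment ν = 0 :=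
  integral_eq_zero_of_ae (by filter_upwards [h] with t ht; simp [ht])

lemma integrable_id_of_ae_eq_zero {ν : Measure ℝ} (h : ∀ᵐ t ∂ν, t = 0) : Integrable id ν :=
  (integrable_zero ℝ ℝ ν).congr (by filter_upwards [h] with t ht; simp [ht])

lemma cauchyTransform_symmetricBernoulli_I :
    cauchyTransform symmetricBernoulli Complex.I = -Complex.I / 2 := by
  rw [cauchyTransform, symmetricBernoulli, integral_smul_measure,
    integral_add_measure (integrable_dirac (by simp)) (integrable_dirac (by simp)), integral_dirac,
    integral_dirac]
  apply Complex.ext <;>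
    simp [Complex.normSq_apply] <;> norm_num

lemma eq_symmetricBernoulli {μ : Measure ℝ} [IsProbabilityMeasure μ] (hm : ∫ t, t ∂μ = 0)
    (h : ∀ᵐ t ∂μ, t = -1 ∨ t = 1) : μ = symmetricBernoulli := by
  have hd : Disjoint ({-1} : Set ℝ) {1} := by norm_num
  have e : μ = μ {-1} • Measure.dirac (-1) + μ {1} • Measure.dirac 1 := by
    rw [← Measure.restrict_singleton, ← Measure.restrict_singleton,
      ← Measure.restrict_union hd (measurableSet_singleton _),
      Measure.restrict_eq_self_of_ae_mem]
    filter_upwards [h] with t ht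
    simpa [or_comm] using ht
  have h1 : μ.real {-1} + μ.real {1} = 1 := by
    rw [← measureReal_union hd (measurableSet_singleton _), measureReal_congr (t := Set.univ),
      probReal_univ]
    filter_upwards [h] with t ht
    exact propext ⟨fun _ => trivial, fun _ => ht⟩
  have h2 : -μ.real {-1} + μ.real {1} = 0 := by
    rw [← hm]
    conv_rhs => rw [e]
    rw [integral_add_measure, integral_smul_measure, integral_smul_measure, integral_dirac,
      integral_dirac]
    · simp [Measure.real]
    · exact (integrable_dirac (by simp)).smul_measure (measure_ne_top _ _)
    · exact (integrable_dirac (by simp)).smul_measure (measure_ne_top _ _)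
  have h3 : ∀ a : ℝ, μ.real {a} = 1 / 2 → μ {a} = 1 / 2 := fun a ha => by
    rw [← ENNReal.ofReal_toReal (measure_ne_top μ {a}), ← Measure.real, ha,
      ENNReal.ofReal_div_of_pos two_pos]
    simp
  rw [e, h3 _ (by linarith), h3 _ (by linarith), symmetricBernoulli, smul_add]

/-- The nonnegative function `(t² - 1)² / (t² + 1) = t² - 3 + 4 / (t² + 1)` has integral `1 - 3 + 4
· (1/2) = 0`. -/
lemma ae_eq_neg_one_or_one {μ : Measure ℝ} [IsProbabilityMeasure μ]
    (h2 : Integrable (fun t : ℝ => t ^ 2) μ) (hv : ∫ t, t ^ 2 ∂μ = 1)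
    (h : cauchyTransform μ Complex.I = -Complex.I / 2) : ∀ᵐ t ∂μ, t = -1 ∨ t = 1 := by
  have h1 := re_I_mul_cauchyTransform μ
  have hi := integrable_one_div_sq_add_one μ
  have h0 : ∀ t : ℝ, t ^ 2 - 3 + 4 * (1 / (t ^ 2 + 1)) = (t ^ 2 - 1) ^ 2 / (t ^ 2 + 1) :=
    fun t => by
      have : t ^ 2 + 1 ≠ 0 := by positivity
      field_simp
      ring
  have h3 : ∫ t : ℝ, (t ^ 2 - 3 + 4 * (1 / (t ^ 2 + 1))) ∂μ = 0 := by
    have hs : Integrable (fun t : ℝ => t ^ 2 - 3) μ := h2.sub (integrable_const _)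
    rw [integral_add hs (hi.const_mul _), integral_sub h2 (integrable_const _), integral_const_mul, ← h1, hv, h]
    simp [mul_div_assoc']
    norm_num
  have h4 := (integral_eq_zero_iff_of_nonneg (μ := μ)
    (f := fun t : ℝ => t ^ 2 - 3 + 4 * (1 / (t ^ 2 + 1)))
    (fun t => (by positivity : (0 : ℝ) ≤ _).trans_eq (h0 t).symm) ((h2.sub (integrable_const _)).add (hi.const_mul _))).1 h3
  filter_upwards [h4] with t ht
  rw [h0] at ht
  have : t ^ 2 + 1 ≠ 0 := by positivity
  have h5 : t ^ 2 - 1 = 0 := by simpa [this] using ht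
  exact (mul_self_eq_one_iff.1 (by rw [← sq]; linarith)).symm

end MonotoneCLT

/-! ### Conversion to the stated rates and assembly. -/

namespace MonotoneCLT
open Filter Topology

variable {μ ν : Measure ℝ} [IsProbabilityMeasure μ]

lemma cauchyTransform_I_iff (h : ∀ z : ℂ, 0 < z.im → fTransform μ z = z - cauchyTransform ν z) :
    cauchyTransform ν Complex.I = -Complex.I ↔ cauchyTransform μ Complex.I = -Complex.I / 2 := by
  have hI : 0 < Complex.I.im := by simp
  have h0 := cauchyTransform_ne_zero (σ := μ) hI
  have h1 := h Complex.I hI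
  rw [fTransform_eq] at h1
  have h2 : cauchyTransform ν Complex.I = Complex.I - 1 / cauchyTransform μ Complex.I := by
    rw [h1]; ring
  rw [h2]
  constructor
  · intro h3
    have h4 : 1 / cauchyTransform μ Complex.I = 2 * Complex.I := by linear_combination -h3
    rw [← one_div_one_div (cauchyTransform μ Complex.I), h4]
    simp [mul_comm, div_eq_mul_inv]
  · intro h3
    rw [h3, one_div_div, div_neg, Complex.div_I]
    ring

lemma ae_eq_zero_iff_eq_symmetricBernoulli [IsProbabilityMeasure ν]
    (h : ∀ z : ℂ, 0 < z.im → fTransform μ z = z - cauchyTransform ν z)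
    (hm : ∫ t, t ∂μ = 0) (h2 : Integrable (fun t : ℝ => t ^ 2) μ) (hv : ∫ t, t ^ 2 ∂μ = 1) :
    (∀ᵐ t ∂ν, t = 0) ↔ μ = symmetricBernoulli := by
  constructor
  · intro h0
    refine eq_symmetricBernoulli hm (ae_eq_neg_one_or_one h2 hv ((cauchyTransform_I_iff h).1 ?_))
    rw [cauchyTransform_eq_of_ae_eq_zero h0]
    simp
  · intro h0
    refine ae_eq_zero_of_cauchyTransform_I ((cauchyTransform_I_iff h).2 ?_)
    rw [h0, cauchyTransform_symmetricBernoulli_I]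

variable [IsProbabilityMeasure ν]

lemma kolmogorovDist_le_of_absMoment
    (h : ∀ z : ℂ, 0 < z.im → fTransform μ z = z - cauchyTransform ν z) (hν : Integrable id ν)
    (hc : 0 < absMoment ν) {n : ℕ} (hn : ((8 * absMoment ν * √(absMoment ν)) ^ 4)⁻¹ < (n : ℝ)) :
    kolmogorovDist (normalizedPower μ n) arcsineLaw
      ≤ 71 * absMoment ν ^ (1 / 4 : ℝ) * (n : ℝ) ^ (-(1 / 8) : ℝ) := by
  have hn0 : (0 : ℝ) < n := lt_of_le_of_lt (by positivity) hn
  obtain ⟨q, hq⟩ : ∃ q, q = (n : ℝ) ^ (1 / 4 : ℝ) := ⟨_, rfl⟩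
  obtain ⟨k, hk⟩ : ∃ k, k = √(absMoment ν) := ⟨_, rfl⟩
  have hq0 : 0 < q := hq ▸ Real.rpow_pos_of_pos hn0 _
  have hk0 : 0 < k := hk ▸ Real.sqrt_pos.2 hc
  have hk2 : absMoment ν = k ^ 2 := by rw [hk, Real.sq_sqrt hc.le]
  have hq4 : (n : ℝ) = q ^ 4 := by
    rw [hq, ← Real.rpow_natCast, ← Real.rpow_mul hn0.le]
    norm_num
  have h1 : 1 ≤ 8 * k ^ 3 * q := by
    rw [← hk, hk2, hq4, show 8 * k ^ 2 * k = 8 * k ^ 3 by ring, ← inv_pow] at hn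
    have h2 := lt_of_pow_lt_pow_left₀ 4 hq0.le hn
    rw [inv_lt_iff_one_lt_mul₀' (by positivity)] at h2
    exact h2.le
  refine (kolmogorovDist_normalizedPower_le h hν hk0 hk2 hq0 hq4 h1).trans ?_
  have e1 : √k = absMoment ν ^ (1 / 4 : ℝ) := by
    rw [hk, Real.sqrt_eq_rpow, Real.sqrt_eq_rpow, ← Real.rpow_mul hc.le]
    norm_num
  have e2 : (√q)⁻¹ = (n : ℝ) ^ (-(1 / 8) : ℝ) := by
    rw [hq, Real.sqrt_eq_rpow, ← Real.rpow_mul hn0.le, ← Real.rpow_neg hn0.le]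
    norm_num
  rw [Real.sqrt_div hk0.le, div_eq_mul_inv, e2, e1, mul_assoc]
  gcongr
  norm_num

lemma rateConst_ge (ν ρ : Measure ℝ) : 3 ≤ rateConst ν ρ := by
  have h1 : 0 ≤ absMoment ρ := integral_nonneg fun t => abs_nonneg t
  have h2 : 0 ≤ ∫ t, t ^ 2 ∂ν := integral_nonneg fun t => sq_nonneg t
  rw [rateConst]
  nlinarith

lemma kolmogorovDist_le_of_rateConst {ρ : Measure ℝ} [IsFiniteMeasure ρ]
    (h : ∀ z : ℂ, 0 < z.im → fTransform μ z = z - cauchyTransform ν z) (hρ : Integrable id ρ)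
    (hF : ∀ z : ℂ, 0 < z.im → fTransform ν z = z - (∫ t, t ∂ν : ℝ) - cauchyTransform ρ z)
    {n : ℕ} (hn : 12288 * rateConst ν ρ ^ 2 < (n : ℝ)) :
    kolmogorovDist (normalizedPower μ n) arcsineLaw
      ≤ 16 * √(rateConst ν ρ) * (n : ℝ) ^ (-(1 / 4) : ℝ) := by
  have hD := rateConst_ge ν ρ
  have hn0 : (0 : ℝ) < n := lt_of_le_of_lt (by positivity) hn
  have h1 : 8 * rateConst ν ρ ≤ √n := Real.le_sqrt_of_sq_le (by nlinarith)
  refine (kolmogorovDist_normalizedPower_le_of_second h hρ hF (Real.sqrt_pos.2 hn0)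
    (Real.sq_sqrt hn0.le).symm h1).trans_eq ?_
  have e2 : (√(√(n : ℝ)))⁻¹ = (n : ℝ) ^ (-(1 / 4) : ℝ) := by
    rw [Real.sqrt_eq_rpow, Real.sqrt_eq_rpow, ← Real.rpow_mul hn0.le, ← Real.rpow_neg hn0.le]
    norm_num
  rw [Real.sqrt_div (by linarith), div_eq_mul_inv, e2, mul_assoc]

/-- Here `F_ν(z) = z`, so the second estimate applies with `ρ = 0` and `D = 3`. -/
lemma kolmogorovDist_le_of_ae_eq_zero
    (h : ∀ z : ℂ, 0 < z.im → fTransform μ z = z - cauchyTransform ν z)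
    (h0 : ∀ᵐ t ∂ν, t = 0) {n : ℕ} (hn : 12288 < n) :
    kolmogorovDist (normalizedPower μ n) arcsineLaw ≤ 200 * (n : ℝ) ^ (-(1 / 4) : ℝ) := by
  have hm : ∫ t, t ∂ν = 0 := integral_eq_zero_of_ae h0
  have hF : ∀ z : ℂ, 0 < z.im → fTransform ν z = z - (∫ t, t ∂ν : ℝ) - cauchyTransform 0 z := by
    intro z _
    rw [fTransform_eq, cauchyTransform_eq_of_ae_eq_zero h0, hm]
    simp [cauchyTransform]
  have hD : rateConst ν 0 = 3 := by
    have : ∫ t, t ^ 2 ∂ν = 0 :=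
      integral_eq_zero_of_ae (by filter_upwards [h0] with t ht; simp [ht])
    simp [rateConst, absMoment, this]
  have hn0 : (12288 : ℝ) < n := by exact_mod_cast hn
  have h1 : 8 * rateConst ν 0 ≤ √n := Real.le_sqrt_of_sq_le (by rw [hD]; norm_num; linarith)
  have hp : (0 : ℝ) < n := by linarith
  refine (kolmogorovDist_normalizedPower_le_of_second h integrable_zero_measure hF
    (Real.sqrt_pos.2 hp) (Real.sq_sqrt hp.le).symm h1).trans ?_
  have e2 : (√(√(n : ℝ)))⁻¹ = (n : ℝ) ^ (-(1 / 4) : ℝ) := by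
    rw [Real.sqrt_eq_rpow, Real.sqrt_eq_rpow, ← Real.rpow_mul hp.le, ← Real.rpow_neg hp.le]
    norm_num
  rw [Real.sqrt_div (by linarith [hD]), div_eq_mul_inv, e2, hD, ← mul_assoc]
  gcongr
  have : √3 ≤ 2 := Real.sqrt_le_iff.2 ⟨by norm_num, by norm_num⟩
  linarith

end MonotoneCLT

theorem theorem3p1 (μ : Measure ℝ) [IsProbabilityMeasure μ] (hL2 : MemLp id 2 μ)
    (hmean : ∫ t, t ∂μ = 0) (hvar : ProbabilityTheory.variance id μ = 1) :
    (∃ ν : Measure ℝ, IsNevanlinnaMeasure μ ν) ∧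
    ∀ ν : Measure ℝ, IsNevanlinnaMeasure μ ν →
      -- (1)
      (Integrable id ν → 0 < absMoment ν → ∀ n : ℕ,
        max ((8 * √(3 * absMoment ν)) ^ 4) (((8 * absMoment ν * √(absMoment ν)) ^ 4)⁻¹) < (n : ℝ) →
        kolmogorovDist (normalizedPower μ n) arcsineLaw
          ≤ 71 * absMoment ν ^ (1 / 4 : ℝ) * (n : ℝ) ^ (-(1 / 8) : ℝ)) ∧
      -- the hypothesis of (1) on `ν` holds in particular when `m₄(μ) < ∞`
      (Integrable (fun t : ℝ => t ^ 4) μ → Integrable id ν) ∧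
      -- (2)
      (Integrable id ν → 0 < absMoment ν →
        ∀ ρ : Measure ℝ, IsNevanlinnaMeasure ν ρ → Integrable id ρ →
          Integrable (fun t : ℝ => t ^ 2) ν ∧
          ∀ n : ℕ,
            max (max (4 * (∫ t, t ∂ν) ^ 2) (4 * (∫ t, t ^ 2 ∂ν) ^ 2))
              (12288 * rateConst ν ρ ^ 2) < (n : ℝ) →
            kolmogorovDist (normalizedPower μ n) arcsineLaw
              ≤ 200 * √(rateConst ν ρ) * (n : ℝ) ^ (-(1 / 4) : ℝ)) ∧
      -- the hypotheses of (2) on `ν` and `ρ` hold in particular when `m₆(μ) < ∞`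
      (Integrable (fun t : ℝ => t ^ 6) μ →
        Integrable id ν ∧ ∃ ρ : Measure ℝ, IsNevanlinnaMeasure ν ρ ∧ Integrable id ρ) ∧
      -- (3)
      ((Integrable id ν ∧ absMoment ν = 0) ↔ μ = symmetricBernoulli) ∧
      (μ = symmetricBernoulli → ∀ n : ℕ, 12288 < n →
        kolmogorovDist (normalizedPower μ n) arcsineLaw ≤ 200 * (n : ℝ) ^ (-(1 / 4) : ℝ)) := by
  have h2 : Integrable (fun t : ℝ => t ^ 2) μ := hL2.integrable_sq
  have hv : ∫ t, t ^ 2 ∂μ = 1 := by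
    rw [ProbabilityTheory.variance_eq_integral aemeasurable_id] at hvar
    simpa [hmean] using hvar
  simp_rw [isNevanlinnaMeasure_iff]
  refine ⟨exists_nevanlinna h2, ?_⟩
  rintro ν ⟨hfin, hF⟩
  have hone : ν.real Set.univ = 1 := by
    rw [measureReal_univ_of_fTransform_eq h2 hF, hmean, hv]
    norm_num
  have hprob : IsProbabilityMeasure ν :=
    ⟨by simpa [Measure.real, ENNReal.toReal_eq_one_iff] using hone⟩
  have h : ∀ z : ℂ, 0 < z.im → fTransform μ z = z - cauchyTransform ν z := by
    simpa [hmean] using hF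
  have hiff := ae_eq_zero_iff_eq_symmetricBernoulli h hmean h2 hv
  refine ⟨fun hν hc n hn => ?_, fun h4 => ?_, ?_, fun h6 => ?_, ⟨?_, fun hμ => ?_⟩,
    fun hμ n hn => kolmogorovDist_le_of_ae_eq_zero h (hiff.2 hμ) hn⟩
  · exact kolmogorovDist_le_of_absMoment h hν hc ((le_max_right _ _).trans_lt hn)
  · exact integrable_id_of_integrable_sq (integrable_pow_of_fTransform_eq hF (k := 1) h4)
  · rintro - - ρ ⟨hρfin, hρF⟩ hρ
    refine ⟨integrable_sq_of_fTransform_eq hρF, fun n hn => ?_⟩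
    refine (kolmogorovDist_le_of_rateConst h hρ hρF ((le_max_right _ _).trans_lt hn)).trans ?_
    -- The argument gives the constant 16 in place of 200.
    gcongr
    norm_num
  · have hν4 : Integrable (fun t : ℝ => t ^ 4) ν := integrable_pow_of_fTransform_eq hF (k := 2) h6
    have hν2 : Integrable (fun t : ℝ => t ^ 2) ν := integrable_pow_of_le (by norm_num) hν4
    obtain ⟨ρ, hρfin, hρF⟩ := exists_nevanlinna hν2
    exact ⟨integrable_id_of_integrable_sq hν2, ρ, ⟨hρfin, hρF⟩,
      integrable_id_of_integrable_sq (integrable_pow_of_fTransform_eq hρF (k := 1) hν4)⟩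
  · rintro ⟨hν, h0⟩
    exact hiff.1 (ae_eq_zero_of_absMoment_eq_zero hν h0)
  · exact ⟨integrable_id_of_ae_eq_zero (hiff.2 hμ), absMoment_eq_zero_of_ae (hiff.2 hμ)⟩
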